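/- Identify $\mathbb R^2$ with $\mathbb C$ and let $J$ be the counterclockwise rotation by $\pi/2$. A closed Legendre curve is a pair of smooth $2\pi$-periodic maps $\gamma:\mathbb R\to\mathbb R^2$, $\nu:\mathbb R\to\mathbb R^2$ with $|\nu|=1$ and $\langle\gamma',\nu\rangle=0$. Put $\mu=J\nu$, $\ell=\langle\nu',\mu\rangle$, $\beta=\langle\gamma',\mu\rangle$ (so $\nu'=\ell\mu$ and $\gamma'=\beta\mu$). The curve is called $\ell$-convex if $\ell>0$, and its algebraic length is $L=\int_0^{2\pi}\beta\,du$. For a family $(\gamma,\nu)(\cdot,t)$ of closed Legendre curves put $$f=\frac{\beta}{\ell}-\frac{L}{2\pi},$$ where $\beta/\ell$ is the value of $\beta$ in the parametrization with $\ell=1$; thus $f=\beta-\frac{L}{2\pi}$ when $\ell=1$. **Theorem.** Let $(\gamma_0,\nu_0)$ be a closed Legendre curve with $\ell=1$ and algebraic length $L_0$. Consider the flow of closed Legendre curves starting at $(\gamma_0,\nu_0)$ $$\frac{\partial\gamma}{\partial t}=\frac{\ell f'}{\ell^2+\beta^2}\,\mu+f\,\nu,\qquad \frac{\partial\nu}{\partial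 t}=-\frac{\beta f'}{\ell^2+\beta^2}\,\mu. \qquad (1)$$ Then (1) has a solution on the time interval $[0,\infty)$, smooth in space and time up to and including $t=0$. Moreover, for every such solution: 1. $(\gamma,\nu)(\cdot,t)$ is $\ell$-convex for all $t\ge 0$; 2. its algebraic length is $L_0$ for all $t\ge0$; 3. as $t\to\infty$, it converges to a circle of radius $\frac{|L_0|}{2\pi}$ (which is $\frac{L_0}{2\pi}$ if $L_0\ge 0$) in the $C^\infty$ sense. That is, there are a point $c\in\mathbb C$ and a smooth $\varphi:\mathbb R\to\mathbb R$ with $\varphi'>0$ and $\varphi(u+2\pi)=\varphi(u)+2\pi$ such that $\gamma(u,t)\to c+\frac{L_0}{2\pi}e^{i\varphi(u)}$ and $\nu(u,t)\to e^{i\varphi(u)}$, uniformly in $u$ together with all derivatives in $u$. In particular, if $L_0=0$, then $\gamma(\cdot,t)$ converges to the point $c$. The same statements hold for the tangentially modified flow $$\frac{\partial\gamma}{\partial t}=\frac{f'}{\ell}\,\mu+f\,\nu,\qquad\frac{\partial\nu}{\partial t}=0, \qquad (2)$$ for which moreover $\ell=1$ for all $t\ge0$, so that $f=\beta-\frac{L}{2\pi}$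 along (2). -/

import Mathlib

open scoped ContDiff

noncomputable section

/-! Closed planar curves are `2π`-periodic maps `ℝ → ℂ`; the plane `ℝ²` is `ℂ` with its real inner
product `inner ℝ z w = Re (conj z * w)`, and the counterclockwise rotation `J` by `π / 2` is
multiplication by `Complex.I`. -/

namespace LegendreCurve

/-- A smooth closed Legendre curve (frontal): a smooth closed curve `γ` (possibly singular) together
with a smooth unit vector field `ν` along it such that `⟨γ', ν⟩ = 0`. -/
structure IsLegendre (γ ν : ℝ → ℂ) : Prop where
  smooth_curve : ContDiff ℝ ∞ γ
  smooth_normal : ContDiff ℝ ∞ ν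
  periodic_curve : Function.Periodic γ (2 * Real.pi)
  periodic_normal : Function.Periodic ν (2 * Real.pi)
  norm_normal : ∀ u, ‖ν u‖ = 1
  legendre : ∀ u, inner ℝ (deriv γ u) (ν u) = 0

/-- The second vector `μ = J ν` of the moving frame. -/
def mu (ν : ℝ → ℂ) (u : ℝ) : ℂ := Complex.I * ν u

/-- The first entry `ℓ = ⟨ν', μ⟩` of the curvature pair. -/
def ell (ν : ℝ → ℂ) (u : ℝ) : ℝ := inner ℝ (deriv ν u) (mu ν u)

/-- The second entry `β` of the curvature pair, defined by `γ' = β μ`, that is `β = ⟨γ', μ⟩`. -/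
def beta (γ ν : ℝ → ℂ) (u : ℝ) : ℝ := inner ℝ (deriv γ u) (mu ν u)

/-- An `ℓ`-convex Legendre curve: a Legendre curve with `ℓ > 0`. -/
def IsEllConvex (γ ν : ℝ → ℂ) : Prop := IsLegendre γ ν ∧ ∀ u, 0 < ell ν u

/-- The algebraic length `L = ∫ β`, which does not depend on the parametrization. -/
def algLength (γ ν : ℝ → ℂ) : ℝ := ∫ u in (0 : ℝ)..(2 * Real.pi), beta γ ν u

/-- The normal speed `f = β / ℓ - L / (2π)`. The quotient `β / ℓ` is the value of `β` in the
parametrization with `ℓ = 1`; in particular `f = β - L / (2π)` if `ℓ = 1`. -/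
def speed (γ ν : ℝ → ℂ) (u : ℝ) : ℝ :=
  beta γ ν u / ell ν u - algLength γ ν / (2 * Real.pi)

/-- A family `(γ t, ν t)`, `t ∈ [0, ∞)`, of closed Legendre curves, smooth in `(t, u)` up to and
including `t = 0`, and starting at `(γ₀, ν₀)`. -/
structure IsEvolution (γ₀ ν₀ : ℝ → ℂ) (γ ν : ℝ → ℝ → ℂ) : Prop where
  smooth_curve : ContDiffOn ℝ ∞ (fun q : ℝ × ℝ => γ q.1 q.2) (Set.Ici 0 ×ˢ Set.univ)
  smooth_normal : ContDiffOn ℝ ∞ (fun q : ℝ × ℝ => ν q.1 q.2) (Set.Ici 0 ×ˢ Set.univ)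
  legendre : ∀ t, 0 ≤ t → IsLegendre (γ t) (ν t)
  init_curve : γ 0 = γ₀
  init_normal : ν 0 = ν₀

/-- `(γ, ν)` solves, on the time interval `[0, ∞)` and with initial value `(γ₀, ν₀)`, the flow
`∂γ/∂t = (ℓ f' / (ℓ² + β²)) μ + f ν`, `∂ν/∂t = - (β f' / (ℓ² + β²)) μ`,
where `f` is the normal speed and `'` is the derivative in the curve parameter. -/
structure IsFlow (γ₀ ν₀ : ℝ → ℂ) (γ ν : ℝ → ℝ → ℂ) : Prop extends IsEvolution γ₀ ν₀ γ ν where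
  curve_eq : ∀ t, 0 ≤ t → ∀ u, HasDerivWithinAt (fun s => γ s u)
    (((ell (ν t) u * deriv (speed (γ t) (ν t)) u /
        (ell (ν t) u ^ 2 + beta (γ t) (ν t) u ^ 2) : ℝ) : ℂ) * mu (ν t) u
      + ((speed (γ t) (ν t) u : ℝ) : ℂ) * ν t u) (Set.Ici 0) t
  normal_eq : ∀ t, 0 ≤ t → ∀ u, HasDerivWithinAt (fun s => ν s u)
    (-((beta (γ t) (ν t) u * deriv (speed (γ t) (ν t)) u /
        (ell (ν t) u ^ 2 + beta (γ t) (ν t) u ^ 2) : ℝ) : ℂ) * mu (ν t) u) (Set.Ici 0) t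

/-- `(γ, ν)` solves, on the time interval `[0, ∞)` and with initial value `(γ₀, ν₀)`, the
tangentially modified flow `∂γ/∂t = (f' / ℓ) μ + f ν`, `∂ν/∂t = 0`. -/
structure IsModifiedFlow (γ₀ ν₀ : ℝ → ℂ) (γ ν : ℝ → ℝ → ℂ) : Prop
    extends IsEvolution γ₀ ν₀ γ ν where
  curve_eq : ∀ t, 0 ≤ t → ∀ u, HasDerivWithinAt (fun s => γ s u)
    (((deriv (speed (γ t) (ν t)) u / ell (ν t) u : ℝ) : ℂ) * mu (ν t) u
      + ((speed (γ t) (ν t) u : ℝ) : ℂ) * ν t u) (Set.Ici 0) t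
  normal_eq : ∀ t, 0 ≤ t → ∀ u, HasDerivWithinAt (fun s => ν s u) 0 (Set.Ici 0) t

/-- Convergence `g t → h` in `C^∞` as `t → ∞`: all derivatives in the curve parameter converge
uniformly. -/
def TendstoSmooth (g : ℝ → ℝ → ℂ) (h : ℝ → ℂ) : Prop :=
  ∀ k : ℕ, TendstoUniformly (fun t => iteratedDeriv k (g t)) (iteratedDeriv k h) Filter.atTop

/-- As `t → ∞`, `(γ t, ν t)` converges in `C^∞` to the circle `u ↦ c + R exp (i φ u)` with normal
`u ↦ exp (i φ u)`, traversed once: `φ` is a smooth increasing reparametrization of `ℝ / 2πℤ`. The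
radius is `|R|`, and the circle is the point `c` if `R = 0`. -/
def ConvergesToCircle (γ ν : ℝ → ℝ → ℂ) (c : ℂ) (R : ℝ) : Prop :=
  ∃ φ : ℝ → ℝ, ContDiff ℝ ∞ φ ∧ (∀ u, 0 < deriv φ u) ∧
    (∀ u, φ (u + 2 * Real.pi) = φ u + 2 * Real.pi) ∧
    TendstoSmooth γ (fun u => c + (R : ℂ) * Complex.exp ((φ u : ℂ) * Complex.I)) ∧
    TendstoSmooth ν (fun u => Complex.exp ((φ u : ℂ) * Complex.I))

end LegendreCurve

end

/-!
In the parametrization by the angle of the normal, that is with `ℓ = 1`, a closed Legendre curve is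
determined by its support function `p = ⟨γ, ν⟩`: its second coordinate is `⟨γ, μ⟩ = p'`, and `β =
p'' + p`. Both flows move the curve with normal speed `f = β - R`, `R = L / (2π)`, so `p` solves the
*linear* equation `∂ₜ p = p'' + p - R`, and the mean of `p` stays equal to `R`. Expanding in a
Fourier series, the modes of frequency one are stationary (they are translations of the curve) and
the `n`-th mode decays like `exp (-(n² - 1) t)` for `|n| ≥ 2`. Since the coefficients of a smooth
function decay rapidly, this gives a solution `R + Re (κ exp (i x)) + Q 0 t x`, smooth up to `t =
0`, with `Q` decaying exponentially with all its derivatives (`exists_heatData`). It describes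
curves converging to a circle of radius `|R|`.

The modified flow is exactly this evolution. For the original flow the normal rotates, with angular
speed `V = -β β' / (1 + β²)` in terms of the angle, so its solutions are obtained by composing with
the flow on the line of the time-dependent field `V` (`HeatData.isFlow_heatCurve`). As `V` decays
exponentially with all derivatives, this flow converges in `C^∞` to a diffeomorphism
(`IsBoundedField.exists_flow_limit`), which is the reparametrization `φ` of the limit circle
(`HeatData.convergesToCircle_heatCurve`). Both flows are treated together: the modified one
corresponds to the field `V = 0`.

It remains to see that every solution is of this form (`IsFrameFlow.eq_heatCurve`). As long as `ℓ >
0`, let `d` be the difference of the support function of a solution and the one above, compared at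
the same normal. Then `∫ d² ℓ du` is the integral of `d²` with respect to the angle, and an
integration by parts shows that its derivative is at most twice itself
(`IsFrameFlow.energy_derivative_le`); here the nonlocal term, which involves the error of the
length, has the favourable sign. Hence `d = 0`, and then the normal rotates with speed `V`, so that
`ℓ` is the positive stretching factor of the flow of `V`. As that factor is positive at all times,
`ℓ` cannot reach `0` at a first time, and the argument applies on all of `[0, ∞)`.
-/

open scoped Topology
open Filter Set

noncomputable section

namespace LegendreCurve

/-! ### Functions of two real variables -/

section TwoVariables

variable {E : Type*} [NormedAddCommGroup E] [NormedSpace ℝ E]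

lemma hasDerivAt_fst {f : ℝ × ℝ → E} {t u : ℝ} (h : DifferentiableAt ℝ f (t, u)) :
    HasDerivAt (fun s => f (s, u)) (fderiv ℝ f (t, u) (1, 0)) t :=
  h.hasFDerivAt.comp_hasDerivAt t ((hasDerivAt_id t).prodMk (hasDerivAt_const t u))

lemma hasDerivAt_snd {f : ℝ × ℝ → E} {t u : ℝ} (h : DifferentiableAt ℝ f (t, u)) :
    HasDerivAt (fun x => f (t, x)) (fderiv ℝ f (t, u) (0, 1)) u :=
  h.hasFDerivAt.comp_hasDerivAt u ((hasDerivAt_const u t).prodMk (hasDerivAt_id u))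

/-- Continuous partial derivatives give total differentiability. -/
lemma hasFDerivAt_of_partials {F F₁ F₂ : ℝ → ℝ → E}
    (h₁ : ∀ t u, HasDerivAt (fun s => F s u) (F₁ t u) t)
    (h₂ : ∀ t u, HasDerivAt (F t) (F₂ t u) u)
    (c₁ : Continuous fun q : ℝ × ℝ => F₁ q.1 q.2)
    (c₂ : Continuous fun q : ℝ × ℝ => F₂ q.1 q.2) (q : ℝ × ℝ) :
    HasFDerivAt (fun q : ℝ × ℝ => F q.1 q.2)
      ((ContinuousLinearMap.fst ℝ ℝ ℝ).smulRight (F₁ q.1 q.2) +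
        (ContinuousLinearMap.snd ℝ ℝ ℝ).smulRight (F₂ q.1 q.2)) q := by
  have key := hasStrictFDerivAt_uncurry_coprod (𝕜 := ℝ) (u := q) (f := F)
    (f₁ := fun t u => (1 : ℝ →L[ℝ] ℝ).smulRight (F₁ t u))
    (f₂ := fun t u => (1 : ℝ →L[ℝ] ℝ).smulRight (F₂ t u))
    (Eventually.of_forall fun v => by exact (h₁ v.1 v.2).hasFDerivAt)
    (Eventually.of_forall fun v => by exact (h₂ v.1 v.2).hasFDerivAt)
    (by
      have : Continuous fun q : ℝ × ℝ => (1 : ℝ →L[ℝ] ℝ).smulRight (F₁ q.1 q.2) := by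
        fun_prop
      exact this.continuousAt)
    (by
      have : Continuous fun q : ℝ × ℝ => (1 : ℝ →L[ℝ] ℝ).smulRight (F₂ q.1 q.2) := by
        fun_prop
      exact this.continuousAt)
  refine key.hasFDerivAt.congr_fderiv ?_
  ext <;> simp [Function.HasUncurry.uncurry]

lemma contDiff_succ_of_partials {n : ℕ} {F F₁ F₂ : ℝ → ℝ → E}
    (h₁ : ∀ t u, HasDerivAt (fun s => F s u) (F₁ t u) t)
    (h₂ : ∀ t u, HasDerivAt (F t) (F₂ t u) u)
    (c₁ : ContDiff ℝ n fun q : ℝ × ℝ => F₁ q.1 q.2)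
    (c₂ : ContDiff ℝ n fun q : ℝ × ℝ => F₂ q.1 q.2) :
    ContDiff ℝ (n + 1) fun q : ℝ × ℝ => F q.1 q.2 := by
  rw [contDiff_succ_iff_hasFDerivAt]
  refine ⟨_, ?_, hasFDerivAt_of_partials h₁ h₂ c₁.continuous c₂.continuous⟩
  exact (contDiff_const.smulRight c₁).add (contDiff_const.smulRight c₂)

/-- The chain rule along a curve `s ↦ (s, x s)`, in terms of partial derivatives. -/
lemma hasDerivAt_comp_graph {F : ℝ → ℝ → E}
    {x : ℝ → ℝ} {t x' : ℝ} {a b : E}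
    (hF : DifferentiableAt ℝ (fun q : ℝ × ℝ => F q.1 q.2) (t, x t))
    (h₁ : HasDerivAt (fun s => F s (x t)) a t) (h₂ : HasDerivAt (F t) b (x t))
    (hx : HasDerivAt x x' t) : HasDerivAt (fun s => F s (x s)) (a + x' • b) t := by
  have ha := (hasDerivAt_fst hF).unique h₁
  have hb := (hasDerivAt_snd hF).unique h₂
  have e₃ := hF.hasFDerivAt.comp_hasDerivAt t ((hasDerivAt_id t).prodMk hx)
  refine e₃.congr_deriv ?_
  rw [← ha, ← hb, ← map_smul, ← map_add]
  simp

/-- Mixed partial derivatives commute. -/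
lemma hasDerivAt_deriv_comm {F F₁ : ℝ → ℝ → E} {U : Set (ℝ × ℝ)} (hU : IsOpen U)
    (hF : ContDiffOn ℝ ∞ (fun q : ℝ × ℝ => F q.1 q.2) U)
    (h₁ : ∀ q ∈ U, HasDerivAt (fun s => F s q.2) (F₁ q.1 q.2) q.1) {t u : ℝ} (h : (t, u) ∈ U) :
    DifferentiableAt ℝ (F₁ t) u ∧ HasDerivAt (fun s => deriv (F s) u) (deriv (F₁ t) u) t := by
  let f : ℝ × ℝ → E := fun q => F q.1 q.2
  have hd : ∀ q ∈ U, DifferentiableAt ℝ f (q.1, q.2) := fun q hq =>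
    (hF.contDiffAt (hU.mem_nhds hq)).differentiableAt (by simp)
  have e₁ : ∀ q ∈ U, F₁ q.1 q.2 = fderiv ℝ f q (1, 0) := fun q hq =>
    (h₁ q hq).unique (hasDerivAt_fst (hd q hq))
  have e₂ : ∀ q ∈ U, deriv (F q.1) q.2 = fderiv ℝ f q (0, 1) := fun q hq =>
    (hasDerivAt_snd (hd q hq)).deriv
  have hc : ContDiffAt ℝ ∞ f (t, u) := hF.contDiffAt (hU.mem_nhds h)
  have hdd : DifferentiableAt ℝ (fderiv ℝ f) (t, u) :=
    (hc.fderiv_right (m := 1) (by norm_cast)).differentiableAt (by simp)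
  have symm : IsSymmSndFDerivAt ℝ f (t, u) := hc.isSymmSndFDerivAt (by simp; norm_cast)
  have n₁ : ∀ᶠ s in 𝓝 t, (s, u) ∈ U :=
    (Continuous.prodMk_left u).continuousAt.preimage_mem_nhds (hU.mem_nhds h)
  have n₂ : ∀ᶠ x in 𝓝 u, (t, x) ∈ U :=
    (Continuous.prodMk_right t).continuousAt.preimage_mem_nhds (hU.mem_nhds h)
  have k₂ : HasDerivAt (F₁ t) (fderiv ℝ (fderiv ℝ f) (t, u) (0, 1) (1, 0)) u := by
    have := (hasDerivAt_snd hdd).clm_apply (hasDerivAt_const u ((1, 0) : ℝ × ℝ))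
    refine (this.congr_of_eventuallyEq (n₂.mono fun x hx => e₁ (t, x) hx)).congr_deriv ?_
    simp
  have k₁ : HasDerivAt (fun s => deriv (F s) u)
      (fderiv ℝ (fderiv ℝ f) (t, u) (1, 0) (0, 1)) t := by
    have := (hasDerivAt_fst hdd).clm_apply (hasDerivAt_const t ((0, 1) : ℝ × ℝ))
    refine (this.congr_of_eventuallyEq (n₁.mono fun x hx => e₂ (x, u) hx)).congr_deriv ?_
    simp
  exact ⟨k₂.differentiableAt, k₁.congr_deriv ((symm (1, 0) (0, 1)).trans k₂.deriv.symm)⟩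

end TwoVariables

section ParametricIntegrals

variable {E : Type*} [NormedAddCommGroup E] [NormedSpace ℝ E]

/-- Differentiation under the integral sign over a compact interval. -/
lemma hasDerivAt_integral_of_continuousOn {F F' : ℝ → ℝ → E} {s : Set ℝ} {a b x₀ : ℝ}
    (hs : IsOpen s) (hx₀ : x₀ ∈ s) (hF : ∀ x ∈ s, ContinuousOn (F x) (uIcc a b))
    (hF' : ContinuousOn (fun q : ℝ × ℝ => F' q.1 q.2) (s ×ˢ uIcc a b))
    (h : ∀ x ∈ s, ∀ r ∈ uIcc a b, HasDerivAt (fun y => F y r) (F' x r) x) :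
    HasDerivAt (fun x => ∫ r in a..b, F x r) (∫ r in a..b, F' x₀ r) x₀ := by
  obtain ⟨ε, hε, hball⟩ := Metric.nhds_basis_closedBall.mem_iff.1 (hs.mem_nhds hx₀)
  obtain ⟨C, hC⟩ := ((isCompact_closedBall x₀ ε).prod (isCompact_uIcc (a := a) (b := b)))
    |>.exists_bound_of_continuousOn (hF'.mono (prod_mono hball le_rfl))
  have hmeas : ∀ f : ℝ → E, ContinuousOn f (uIcc a b) →
      MeasureTheory.AEStronglyMeasurable f (MeasureTheory.volume.restrict (uIoc a b)) :=
    fun f hf => (hf.mono uIoc_subset_uIcc).aestronglyMeasurable measurableSet_uIoc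
  have hF'₀ : ContinuousOn (F' x₀) (uIcc a b) :=
    hF'.comp (Continuous.prodMk_right x₀).continuousOn fun r hr => ⟨hx₀, hr⟩
  refine (intervalIntegral.hasDerivAt_integral_of_dominated_loc_of_deriv_le
    (F' := F') (bound := fun _ => C) (Metric.closedBall_mem_nhds x₀ hε) ?_
    (hF x₀ hx₀).intervalIntegrable (hmeas _ hF'₀) ?_ (by simp) ?_).2
  · filter_upwards [Metric.closedBall_mem_nhds x₀ hε] with x hx using hmeas _ (hF x (hball hx))
  · exact Eventually.of_forall fun r hr x hx => hC (x, r) ⟨hx, uIoc_subset_uIcc hr⟩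
  · exact Eventually.of_forall fun r hr x hx => h x (hball hx) r (uIoc_subset_uIcc hr)

lemma continuous_integral_zero {F : ℝ → ℝ → E}
    (hF : Continuous fun q : ℝ × ℝ => F q.1 q.2) :
    Continuous fun q : ℝ × ℝ => ∫ s in (0 : ℝ)..q.1, F s q.2 :=
  intervalIntegral.continuous_parametric_intervalIntegral_of_continuous
    (f := fun (q : ℝ × ℝ) s => F s q.2)
    (hF.comp (continuous_snd.prodMk (continuous_snd.comp continuous_fst))) continuous_fst

/-- A time integral `(t, u) ↦ ∫₀ᵗ F (s, u) ds` is as smooth as `F`. -/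
lemma contDiff_integral_zero [CompleteSpace E] (n : ℕ) {F : ℝ → ℝ → E}
    (hF : ContDiff ℝ n fun q : ℝ × ℝ => F q.1 q.2) :
    ContDiff ℝ n fun q : ℝ × ℝ => ∫ s in (0 : ℝ)..q.1, F s q.2 := by
  induction n generalizing F with
  | zero =>
    simp only [Nat.cast_zero, contDiff_zero] at hF ⊢
    exact continuous_integral_zero hF
  | succ n ih =>
    have hd : Differentiable ℝ fun q : ℝ × ℝ => F q.1 q.2 := hF.differentiable (by simp)
    have hp : ContDiff ℝ n fun q : ℝ × ℝ =>
        fderiv ℝ (fun q : ℝ × ℝ => F q.1 q.2) q (0, 1) :=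
      (hF.fderiv_right (m := n) (by norm_cast)).clm_apply contDiff_const
    have hpart : ∀ t u, HasDerivAt (F t)
        (fderiv ℝ (fun q : ℝ × ℝ => F q.1 q.2) (t, u) (0, 1)) u := fun t u =>
      (hd (t, u)).hasFDerivAt.comp_hasDerivAt u
        ((hasDerivAt_const u t).prodMk (hasDerivAt_id u))
    have hc : ∀ u, Continuous fun s => F s u := fun u =>
      hF.continuous.comp (Continuous.prodMk_left u)
    refine contDiff_succ_of_partials (F := fun t u => ∫ s in (0 : ℝ)..t, F s u) (F₁ := F)
      (F₂ := fun t u => ∫ s in (0 : ℝ)..t,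
        fderiv ℝ (fun q : ℝ × ℝ => F q.1 q.2) (s, u) (0, 1)) ?_ ?_
      (hF.of_le (by norm_cast; omega)) (ih (F := fun s u =>
        fderiv ℝ (fun q : ℝ × ℝ => F q.1 q.2) (s, u) (0, 1)) hp)
    · intro t u
      exact intervalIntegral.integral_hasDerivAt_right ((hc u).intervalIntegrable _ _)
        ((hc u).stronglyMeasurableAtFilter _ _) (hc u).continuousAt
    · intro t u
      refine hasDerivAt_integral_of_continuousOn (F := fun u s => F s u) (s := univ) isOpen_univ
        (mem_univ u) (fun x _ => (hc x).continuousOn) ?_ fun x _ r _ => hpart r x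
      exact (hp.continuous.comp (continuous_snd.prodMk continuous_fst)).continuousOn

end ParametricIntegrals

/-! ### Fourier coefficients of smooth periodic functions -/

/-- Rapid decay of a family of coefficients indexed by `ℤ`. -/
def RapidDecay (c : ℤ → ℂ) : Prop := ∀ k : ℕ, ∃ C : ℝ, ∀ n : ℤ, ‖c n‖ * (1 + |(n : ℝ)|) ^ k ≤ C

lemma RapidDecay.of_le {b c : ℤ → ℂ} (hc : RapidDecay c) (A : ℝ) (m : ℕ)
    (h : ∀ n, ‖b n‖ ≤ A * (1 + |(n : ℝ)|) ^ m * ‖c n‖) (hA : 0 ≤ A) : RapidDecay b := by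
  intro k
  obtain ⟨C, hC⟩ := hc (m + k)
  refine ⟨A * C, fun n => ?_⟩
  calc ‖b n‖ * (1 + |(n : ℝ)|) ^ k
      ≤ (A * (1 + |(n : ℝ)|) ^ m * ‖c n‖) * (1 + |(n : ℝ)|) ^ k := by gcongr; exact h n
    _ = A * (‖c n‖ * (1 + |(n : ℝ)|) ^ (m + k)) := by ring
    _ ≤ A * C := by gcongr; exact hC n

lemma summable_inv_one_add_abs_sq : Summable fun n : ℤ => ((1 + |(n : ℝ)|) ^ 2)⁻¹ := by
  refine Summable.of_nonneg_of_le (fun n => by positivity) (fun n => ?_)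
    ((Real.summable_one_div_int_pow.2 one_lt_two).add
      (summable_of_hasFiniteSupport (f := fun n : ℤ => if n = 0 then (1 : ℝ) else 0)
        ((finite_singleton (0 : ℤ)).subset (by intro n; simp))))
  by_cases hn : n = 0
  · simp [hn]
  · simp only [hn, if_false, add_zero, one_div]
    have : 0 < |(n : ℝ)| := by positivity
    rw [← sq_abs (n : ℝ)]
    gcongr
    linarith

lemma RapidDecay.summable {c : ℤ → ℂ} (hc : RapidDecay c) : Summable fun n => ‖c n‖ := by
  obtain ⟨C, hC⟩ := hc 2
  refine Summable.of_nonneg_of_le (fun n => norm_nonneg _) (fun n => ?_)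
    (summable_inv_one_add_abs_sq.mul_left C)
  rw [← div_eq_mul_inv, le_div_iff₀ (by positivity)]
  exact hC n

lemma norm_fourierCoeffOn_le {f : ℝ → ℂ} {C : ℝ} (hf : ∀ x, ‖f x‖ ≤ C) (n : ℤ) :
    ‖fourierCoeffOn Real.two_pi_pos f n‖ ≤ C := by
  rw [fourierCoeffOn_eq_integral, norm_smul]
  have hb : ‖∫ x in (0 : ℝ)..(2 * Real.pi),
      fourier (-n) (x : AddCircle (2 * Real.pi - 0)) • f x‖ ≤ C * |2 * Real.pi - 0| := by
    refine intervalIntegral.norm_integral_le_of_norm_le_const fun x _ => ?_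
    rw [norm_smul, fourier_apply, Circle.norm_coe, one_mul]
    exact hf x
  have hpi := Real.two_pi_pos
  rw [sub_zero, abs_of_pos hpi] at hb
  rw [sub_zero, Real.norm_of_nonneg (by positivity), one_div, inv_mul_le_iff₀ hpi]
  linarith

lemma periodic_deriv {E : Type*} [NormedAddCommGroup E] [NormedSpace ℝ E] {f : ℝ → E} {T : ℝ}
    (hf : Function.Periodic f T) : Function.Periodic (deriv f) T := by
  intro x
  rw [← deriv_comp_add_const]
  congr 1
  exact funext hf

lemma exists_norm_le_of_periodic {E : Type*} [NormedAddCommGroup E] {f : ℝ → E} {T : ℝ}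
    (hT : T ≠ 0) (hf : Continuous f) (hp : Function.Periodic f T) : ∃ C, ∀ x, ‖f x‖ ≤ C := by
  obtain ⟨C, hC⟩ := (hp.compact_of_continuous hT hf).isBounded.exists_norm_le
  exact ⟨C, fun x => hC _ (mem_range_self x)⟩

lemma fourierCoeffOn_deriv {f : ℝ → ℂ} (hf : ContDiff ℝ ∞ f)
    (hp : Function.Periodic f (2 * Real.pi)) {n : ℤ} (hn : n ≠ 0) :
    |(n : ℝ)| * ‖fourierCoeffOn Real.two_pi_pos f n‖ =
      ‖fourierCoeffOn Real.two_pi_pos (deriv f) n‖ := by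
  have hd : ∀ x, HasDerivAt f (deriv f x) x := fun x =>
    (hf.differentiable (by simp) x).hasDerivAt
  have hc : Continuous (deriv f) := hf.continuous_deriv (by simp)
  rw [fourierCoeffOn_of_hasDerivAt Real.two_pi_pos hn (fun x _ => hd x)
    (hc.intervalIntegrable _ _), show f (2 * Real.pi) = f 0 by simpa using hp 0]
  have hn' : |(n : ℝ)| ≠ 0 := by simpa using hn
  have hpi := Real.pi_pos
  simp only [sub_self, mul_zero, zero_sub, norm_mul, norm_div, norm_neg, norm_one]
  simp only [Complex.ofReal_zero, sub_zero, Complex.norm_real, Complex.norm_I, Complex.norm_intCast,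
    norm_mul, Complex.ofReal_mul, Complex.ofReal_ofNat, Complex.norm_ofNat,
    Real.norm_of_nonneg hpi.le]
  field_simp

lemma rapidDecay_fourierCoeffOn {f : ℝ → ℂ} (hf : ContDiff ℝ ∞ f)
    (hp : Function.Periodic f (2 * Real.pi)) :
    RapidDecay (fourierCoeffOn Real.two_pi_pos f) := by
  have key : ∀ k : ℕ, ∀ f : ℝ → ℂ, ContDiff ℝ ∞ f → Function.Periodic f (2 * Real.pi) →
      ∃ C : ℝ, ∀ n : ℤ, |(n : ℝ)| ^ k * ‖fourierCoeffOn Real.two_pi_pos f n‖ ≤ C := by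
    intro k
    induction k with
    | zero =>
      intro f hf hp
      obtain ⟨C, hC⟩ := exists_norm_le_of_periodic Real.two_pi_pos.ne' hf.continuous hp
      exact ⟨C, fun n => by simpa using norm_fourierCoeffOn_le hC n⟩
    | succ k ih =>
      intro f hf hp
      obtain ⟨C, hC⟩ := ih (deriv f) (contDiff_infty_iff_deriv.1 hf).2 (periodic_deriv hp)
      refine ⟨max C 0, fun n => ?_⟩
      by_cases hn : n = 0
      · simp [hn]
      · rw [pow_succ, mul_assoc, fourierCoeffOn_deriv hf hp hn]
        exact (hC n).trans (le_max_left _ _)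
  intro k
  obtain ⟨C, hC⟩ := key k f hf hp
  obtain ⟨C₀, hC₀⟩ := key 0 f hf hp
  refine ⟨2 ^ k * (C₀ + C), fun n => ?_⟩
  have h1 := hC n
  have h0 := hC₀ n
  simp only [pow_zero, one_mul] at h0
  have hle : (1 + |(n : ℝ)|) ^ k ≤ 2 ^ k * (1 + |(n : ℝ)| ^ k) := by
    rcases le_total |(n : ℝ)| 1 with h | h
    · calc (1 + |(n : ℝ)|) ^ k ≤ 2 ^ k := by gcongr; linarith
        _ ≤ 2 ^ k * (1 + |(n : ℝ)| ^ k) := by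
          have : (0 : ℝ) ≤ |(n : ℝ)| ^ k := by positivity
          nlinarith [pow_pos (two_pos (α := ℝ)) k]
    · calc (1 + |(n : ℝ)|) ^ k ≤ (2 * |(n : ℝ)|) ^ k := by gcongr; linarith
        _ = 2 ^ k * |(n : ℝ)| ^ k := mul_pow _ _ _
        _ ≤ 2 ^ k * (1 + |(n : ℝ)| ^ k) := by gcongr; linarith
  calc _ ≤ ‖fourierCoeffOn Real.two_pi_pos f n‖ * (2 ^ k * (1 + |(n : ℝ)| ^ k)) := by gcongr
    _ = 2 ^ k * (‖fourierCoeffOn Real.two_pi_pos f n‖ +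
        |(n : ℝ)| ^ k * ‖fourierCoeffOn Real.two_pi_pos f n‖) := by ring
    _ ≤ _ := by gcongr

/-- A smooth `2π`-periodic function is the sum of a rapidly decaying Fourier series. -/
lemma exists_rapidDecay_hasSum {f : ℝ → ℂ} (hf : ContDiff ℝ ∞ f)
    (hp : Function.Periodic f (2 * Real.pi)) :
    ∃ c : ℤ → ℂ, RapidDecay c ∧
      ∀ x : ℝ, HasSum (fun n : ℤ => c n * Complex.exp (n * x * Complex.I)) (f x) := by
  have hr := rapidDecay_fourierCoeffOn hf hp
  refine ⟨_, hr, fun x => ?_⟩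
  have : Fact (0 < 2 * Real.pi) := ⟨Real.two_pi_pos⟩
  let F : C(AddCircle (2 * Real.pi), ℂ) :=
    ⟨hp.lift, continuous_quot_lift _ hf.continuous⟩
  have hF : ∀ n, fourierCoeff F n = fourierCoeffOn Real.two_pi_pos f n := by
    intro n
    rw [fourierCoeffOn_eq_integral, fourierCoeff_eq_intervalIntegral _ _ 0]
    simp only [fourier_coe_apply, sub_zero, zero_add]
    rfl
  have hs : Summable (fourierCoeff F) := by
    rw [funext hF]
    exact hr.summable.of_norm
  have := has_pointwise_sum_fourier_series_of_summable hs (x : AddCircle (2 * Real.pi))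
  convert! this using 2 with n
  rw [hF, fourier_coe_apply, smul_eq_mul]
  congr 2
  push_cast
  field_simp

/-! ### The heat series -/

/-- A smooth function on the whole line which agrees with `exp (-s)` for `s ≥ -1` and vanishes for
`s ≤ -2`. Used in place of `exp (-s)`, it makes the solutions of the heat equation smooth for
negative times as well, so that there is no boundary at `t = 0`. -/
def cutoffExp (s : ℝ) : ℝ := Real.exp (-s) * Real.smoothTransition (s + 2)

lemma contDiff_cutoffExp : ContDiff ℝ ∞ cutoffExp :=
  (Real.contDiff_exp.comp contDiff_neg).mul
    (Real.smoothTransition.contDiff.comp (contDiff_id.add contDiff_const))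

lemma iteratedDeriv_cutoffExp (j : ℕ) {s : ℝ} (hs : 0 ≤ s) :
    iteratedDeriv j cutoffExp s = (-1) ^ j * Real.exp (-s) := by
  have h : cutoffExp =ᶠ[𝓝 s] fun r => Real.exp (-r) := by
    filter_upwards [lt_mem_nhds (show -1 < s by linarith)] with r hr
    rw [cutoffExp, Real.smoothTransition.one_of_one_le (by linarith), mul_one]
  rw [h.iteratedDeriv_eq, iteratedDeriv_comp_neg j Real.exp s, iteratedDeriv_eq_iterate,
    Real.iter_deriv_exp, smul_eq_mul]

lemma abs_cutoffExp_le (s : ℝ) : |cutoffExp s| ≤ Real.exp 4 * Real.exp (-|s|) := by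
  rw [cutoffExp, abs_mul, abs_of_nonneg (Real.smoothTransition.nonneg _), Real.abs_exp,
    ← Real.exp_add]
  rcases le_total s (-2) with h | h
  · rw [Real.smoothTransition.zero_of_nonpos (by linarith), mul_zero]
    positivity
  · refine (mul_le_of_le_one_right (Real.exp_nonneg _) (Real.smoothTransition.le_one _)).trans ?_
    refine Real.exp_le_exp.2 ?_
    rcases abs_cases s with h' | h' <;> linarith

lemma exists_abs_iteratedDeriv_cutoffExp_le (j : ℕ) :
    ∃ M, ∀ s, |iteratedDeriv j cutoffExp s| ≤ M := by
  obtain ⟨C, hC⟩ := isCompact_Icc (a := (-2 : ℝ)) (b := 0) |>.exists_bound_of_continuousOn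
    (contDiff_cutoffExp.continuous_iteratedDeriv j (by norm_cast; exact le_top)).continuousOn
  refine ⟨max C 1, fun s => ?_⟩
  rcases le_total 0 s with h | h
  · rw [iteratedDeriv_cutoffExp j h, abs_mul, abs_pow, abs_neg, abs_one, one_pow, one_mul,
      Real.abs_exp]
    exact (Real.exp_le_one_iff.2 (by linarith)).trans (le_max_right _ _)
  · rcases lt_or_ge s (-2) with h' | h'
    · have : cutoffExp =ᶠ[𝓝 s] fun _ => 0 := by
        filter_upwards [gt_mem_nhds h'] with r hr
        rw [cutoffExp, Real.smoothTransition.zero_of_nonpos (by linarith), mul_zero]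
      rw [this.iteratedDeriv_eq, iteratedDeriv_const]
      simp
    · exact (hC s ⟨h', h⟩).trans (le_max_left _ _)

/-- The rate `n² - 1` at which the `n`-th Fourier mode decays under `∂ₜ q = ∂ₓ² q + q`. -/
def rate (n : ℤ) : ℝ := (n : ℝ) ^ 2 - 1

/-- The `n`-th term `b n * e⁽ʲ⁾ ((n² - 1) t) * exp (i n x)` of the heat series, where `e⁽ʲ⁾` is the
`j`-th derivative of `cutoffExp`. -/
def heatTerm (j : ℕ) (b : ℤ → ℂ) (n : ℤ) (t x : ℝ) : ℂ :=
  b n * ((iteratedDeriv j cutoffExp (rate n * t) : ℝ) : ℂ) * Complex.exp (n * x * Complex.I)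

/-- The Fourier series in `x` whose coefficients at time `t` are `b n * e⁽ʲ⁾ ((n² - 1) t)`. -/
def heatSeries (j : ℕ) (b : ℤ → ℂ) (t x : ℝ) : ℂ := ∑' n : ℤ, heatTerm j b n t x

lemma norm_heatTerm (j : ℕ) (b : ℤ → ℂ) (t x : ℝ) (n : ℤ) :
    ‖heatTerm j b n t x‖ = ‖b n‖ * |iteratedDeriv j cutoffExp (rate n * t)| := by
  rw [heatTerm, norm_mul, norm_mul, Complex.norm_real, Real.norm_eq_abs,
    show (n : ℂ) * x * Complex.I = ((n * x : ℝ) : ℂ) * Complex.I by push_cast; ring,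
    Complex.norm_exp_ofReal_mul_I, mul_one]

lemma exists_norm_heatTerm_le (j : ℕ) :
    ∃ M, ∀ (b : ℤ → ℂ) (n : ℤ) (t x : ℝ), ‖heatTerm j b n t x‖ ≤ ‖b n‖ * M := by
  obtain ⟨M, hM⟩ := exists_abs_iteratedDeriv_cutoffExp_le j
  refine ⟨M, fun b n t x => ?_⟩
  rw [norm_heatTerm]
  gcongr
  exact hM _

lemma summable_heatTerm (j : ℕ) {b : ℤ → ℂ} (hb : RapidDecay b) (t x : ℝ) :
    Summable fun n : ℤ => heatTerm j b n t x := by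
  obtain ⟨M, hM⟩ := exists_norm_heatTerm_le j
  exact Summable.of_norm_bounded (hb.summable.mul_right M) fun n => hM b n t x

lemma RapidDecay.mul_int {b : ℤ → ℂ} (hb : RapidDecay b) :
    RapidDecay fun n => b n * (n * Complex.I) := by
  refine hb.of_le 1 1 (fun n => ?_) zero_le_one
  rw [norm_mul, norm_mul, Complex.norm_I, Complex.norm_intCast, mul_one, one_mul, pow_one,
    mul_comm]
  gcongr
  linarith

lemma RapidDecay.mul_rate {b : ℤ → ℂ} (hb : RapidDecay b) :
    RapidDecay fun n => b n * (rate n : ℂ) := by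
  refine hb.of_le 1 2 (fun n => ?_) zero_le_one
  rw [norm_mul, Complex.norm_real, Real.norm_eq_abs, one_mul, mul_comm]
  gcongr
  rw [rate, abs_le, ← sq_abs (n : ℝ)]
  constructor <;> nlinarith [abs_nonneg (n : ℝ)]

lemma hasDerivAt_heatTerm_space (j : ℕ) (b : ℤ → ℂ) (n : ℤ) (t x : ℝ) :
    HasDerivAt (fun y => heatTerm j b n t y)
      (heatTerm j (fun n => b n * (n * Complex.I)) n t x) x := by
  have h1 : HasDerivAt (fun y : ℝ => (n : ℂ) * y * Complex.I) (n * Complex.I) x := by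
    simpa using ((Complex.ofRealCLM.hasDerivAt (x := x)).const_mul (n : ℂ)).mul_const Complex.I
  refine (h1.cexp.const_mul _).congr_deriv ?_
  rw [heatTerm]
  ring

lemma hasDerivAt_heatTerm_time (j : ℕ) (b : ℤ → ℂ) (n : ℤ) (t x : ℝ) :
    HasDerivAt (fun s => heatTerm j b n s x)
      (heatTerm (j + 1) (fun n => b n * (rate n : ℂ)) n t x) t := by
  have h0 : HasDerivAt (iteratedDeriv j cutoffExp)
      (iteratedDeriv (j + 1) cutoffExp (rate n * t)) (rate n * t) := by
    rw [iteratedDeriv_succ]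
    exact (contDiff_cutoffExp.differentiable_iteratedDeriv j
      (by norm_cast; exact WithTop.coe_lt_top _) _).hasDerivAt
  have h2 : HasDerivAt (fun s => rate n * s) (rate n) t := by
    simpa using (hasDerivAt_id t).const_mul (rate n)
  have h1 := (h0.comp t h2).ofReal_comp
  refine ((h1.const_mul (b n)).mul_const _).congr_deriv ?_
  rw [heatTerm]
  push_cast
  ring

lemma hasDerivAt_heatSeries_space (j : ℕ) {b : ℤ → ℂ} (hb : RapidDecay b) (t x : ℝ) :
    HasDerivAt (heatSeries j b t) (heatSeries j (fun n => b n * (n * Complex.I)) t x) x := by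
  obtain ⟨M, hM⟩ := exists_norm_heatTerm_le j
  exact hasDerivAt_tsum (hb.mul_int.summable.mul_right M)
    (fun n y => hasDerivAt_heatTerm_space j b n t y) (fun n y => hM _ n t y)
    (summable_heatTerm j hb t 0) x

lemma hasDerivAt_heatSeries_time (j : ℕ) {b : ℤ → ℂ} (hb : RapidDecay b) (t x : ℝ) :
    HasDerivAt (fun s => heatSeries j b s x)
      (heatSeries (j + 1) (fun n => b n * (rate n : ℂ)) t x) t := by
  obtain ⟨M, hM⟩ := exists_norm_heatTerm_le (j + 1)
  exact hasDerivAt_tsum (hb.mul_rate.summable.mul_right M)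
    (fun n s => hasDerivAt_heatTerm_time j b n s x) (fun n s => hM _ n s x)
    (summable_heatTerm j hb 0 x) t

lemma continuous_heatSeries (j : ℕ) {b : ℤ → ℂ} (hb : RapidDecay b) :
    Continuous fun q : ℝ × ℝ => heatSeries j b q.1 q.2 := by
  obtain ⟨M, hM⟩ := exists_norm_heatTerm_le j
  have hc : Continuous (iteratedDeriv j cutoffExp) :=
    contDiff_cutoffExp.continuous_iteratedDeriv j (by norm_cast; exact le_top)
  refine continuous_tsum (fun n => ?_) (hb.summable.mul_right M) fun n q => hM b n q.1 q.2
  unfold heatTerm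
  fun_prop

/-- The partial derivatives of a heat series are again heat series with rapidly decaying
coefficients, whence the smoothness by induction. -/
lemma contDiff_heatSeries {b : ℤ → ℂ} (hb : RapidDecay b) :
    ContDiff ℝ ∞ fun q : ℝ × ℝ => heatSeries 0 b q.1 q.2 := by
  have key : ∀ m : ℕ, ∀ j : ℕ, ∀ b : ℤ → ℂ, RapidDecay b →
      ContDiff ℝ m fun q : ℝ × ℝ => heatSeries j b q.1 q.2 := by
    intro m
    induction m with
    | zero => exact fun j b hb => contDiff_zero.2 (continuous_heatSeries j hb)
    | succ m ih =>
      intro j b hb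
      exact contDiff_succ_of_partials (hasDerivAt_heatSeries_time j hb)
        (hasDerivAt_heatSeries_space j hb) (ih _ _ hb.mul_rate) (ih _ _ hb.mul_int)
  exact contDiff_infty.2 fun m => key m 0 b hb

lemma periodic_heatSeries (j : ℕ) (b : ℤ → ℂ) (t : ℝ) :
    Function.Periodic (heatSeries j b t) (2 * Real.pi) := by
  intro x
  refine tsum_congr fun n => ?_
  rw [heatTerm, heatTerm]
  congr 1
  rw [Complex.exp_eq_exp_iff_exists_int]
  exact ⟨n, by push_cast; ring⟩

lemma three_le_rate {n : ℤ} (hn : 2 ≤ |n|) : 3 ≤ rate n := by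
  have : (2 : ℝ) ≤ |(n : ℝ)| := by exact_mod_cast hn
  rw [rate, ← sq_abs]
  nlinarith

/-- The rate `n² - 1` is at least `3` if `|n| ≥ 2`. -/
lemma exists_norm_heatSeries_le {b : ℤ → ℂ} (hb : RapidDecay b) (hb2 : ∀ n, |n| < 2 → b n = 0) :
    ∃ C, ∀ t x, ‖heatSeries 0 b t x‖ ≤ C * Real.exp (-(3 * |t|)) := by
  refine ⟨∑' n, ‖b n‖ * Real.exp 4, fun t x => ?_⟩
  rw [heatSeries, ← tsum_mul_right]
  refine tsum_of_norm_bounded ((hb.summable.mul_right _).mul_right _).hasSum fun n => ?_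
  rw [norm_heatTerm, iteratedDeriv_zero]
  by_cases hn : |n| < 2
  · simp [hb2 n hn]
  · have h3 := three_le_rate (not_lt.1 hn)
    rw [mul_assoc]
    gcongr
    refine (abs_cutoffExp_le _).trans ?_
    rw [abs_mul, abs_of_nonneg (zero_le_three.trans h3)]
    gcongr

/-- Without the modes `|n| ≤ 1`, the heat series solves `∂ₜ q = ∂ₓ² q + q` for `t ≥ 0`. -/
lemma heatSeries_one_eq {b : ℤ → ℂ} (hb : RapidDecay b) (hb2 : ∀ n, |n| < 2 → b n = 0)
    {t : ℝ} (ht : 0 ≤ t) (x : ℝ) :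
    heatSeries 1 (fun n => b n * (rate n : ℂ)) t x =
      heatSeries 0 (fun n => b n * (n * Complex.I) * (n * Complex.I)) t x + heatSeries 0 b t x := by
  rw [heatSeries, heatSeries, heatSeries,
    ← (summable_heatTerm 0 hb.mul_int.mul_int t x).tsum_add (summable_heatTerm 0 hb t x)]
  refine tsum_congr fun n => ?_
  rw [heatTerm, heatTerm, heatTerm]
  by_cases hn : |n| < 2
  · simp [hb2 n hn]
  · have : 0 ≤ rate n * t := mul_nonneg (by linarith [three_le_rate (not_lt.1 hn)]) ht
    rw [iteratedDeriv_cutoffExp 1 this, iteratedDeriv_cutoffExp 0 this, rate]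
    push_cast
    linear_combination (-b n * n ^ 2 * Complex.exp (-((n ^ 2 - 1) * t)) *
      Complex.exp (n * x * Complex.I)) * Complex.I_sq

/-- The initial value of the series with the modes `|n| ≤ 1` removed, and the removed part. -/
lemma eq_add_heatSeries_zero {c a : ℤ → ℂ} (ha0 : ∀ n, |n| < 2 → a n = 0)
    (ha1 : ∀ n, ¬ |n| < 2 → a n = c n) {x : ℝ} {z : ℂ}
    (h : HasSum (fun n : ℤ => c n * Complex.exp (n * x * Complex.I)) z) :
    z = c 0 + c 1 * Complex.exp (x * Complex.I) + c (-1) * Complex.exp (-x * Complex.I) +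
      heatSeries 0 a 0 x := by
  have h0 : heatSeries 0 a 0 x = ∑' n : ℤ, a n * Complex.exp (n * x * Complex.I) := by
    refine tsum_congr fun n => ?_
    rw [heatTerm, mul_zero, iteratedDeriv_cutoffExp 0 le_rfl]
    simp
  have hfin := h.summable.sum_add_tsum_compl (s := {0, 1, -1})
  have hcompl : ∑' n : ((({0, 1, -1} : Finset ℤ) : Set ℤ)ᶜ : Set ℤ),
      c n * Complex.exp ((n : ℤ) * x * Complex.I) =
      ∑' n : ℤ, a n * Complex.exp (n * x * Complex.I) := by
    rw [tsum_subtype ((({0, 1, -1} : Finset ℤ) : Set ℤ)ᶜ)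
      fun n : ℤ => c n * Complex.exp (n * x * Complex.I)]
    refine tsum_congr fun n => ?_
    by_cases hn : |n| < 2
    · have : n ∈ (({0, 1, -1} : Finset ℤ) : Set ℤ) := by
        rw [abs_lt] at hn
        simp
        omega
      rw [indicator_of_notMem (not_not.2 this), ha0 n hn, zero_mul]
    · have : n ∈ ((({0, 1, -1} : Finset ℤ) : Set ℤ)ᶜ) := by
        simp only [Finset.coe_insert, Finset.coe_singleton, mem_compl_iff, mem_insert_iff,
          mem_singleton_iff]
        rintro (rfl | rfl | rfl) <;> simp at hn
      rw [indicator_of_mem this, ha1 n hn]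
  rw [hcompl, h.tsum_eq] at hfin
  rw [h0, ← hfin]
  simp
  ring

/-- A series without constant term is the derivative of a periodic function. -/
lemma integral_heatSeries_re {a : ℤ → ℂ} (ha : RapidDecay a) (ha0 : a 0 = 0) (t : ℝ) :
    ∫ x in (0 : ℝ)..(2 * Real.pi), (heatSeries 0 a t x).re = 0 := by
  obtain ⟨d, hd, hda⟩ : ∃ d, RapidDecay d ∧ (fun n => d n * (n * Complex.I)) = a := by
    refine ⟨fun n => a n * (n * Complex.I)⁻¹, ha.of_le 1 0 (fun n => ?_) zero_le_one, ?_⟩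
    · by_cases hn : n = 0
      · simp [hn, ha0]
      · have : (1 : ℝ) ≤ |(n : ℝ)| := by
          have : 1 ≤ |n| := Int.one_le_abs hn
          exact_mod_cast this
        rw [norm_mul, norm_inv, norm_mul, Complex.norm_I, Complex.norm_intCast, mul_one, one_mul,
          pow_zero, one_mul]
        exact mul_le_of_le_one_right (norm_nonneg _) (inv_le_one_of_one_le₀ this)
    · funext n
      by_cases hn : n = 0
      · simp [hn, ha0]
      · have : (n : ℂ) * Complex.I ≠ 0 := mul_ne_zero (by exact_mod_cast hn) Complex.I_ne_zero
        rw [mul_assoc, inv_mul_cancel₀ this, mul_one]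
  have hder : ∀ x, HasDerivAt (fun x => (heatSeries 0 d t x).re) (heatSeries 0 a t x).re x :=
    fun x => by
      have := hasDerivAt_heatSeries_space 0 hd t x
      rw [hda] at this
      exact Complex.reCLM.hasFDerivAt.comp_hasDerivAt x this
  have hcont : Continuous fun x => (heatSeries 0 a t x).re :=
    Complex.continuous_re.comp (continuous_iff_continuousAt.2 fun x =>
      (hasDerivAt_heatSeries_space 0 ha t x).continuousAt)
  rw [intervalIntegral.integral_eq_sub_of_hasDerivAt (fun x _ => hder x)
    (hcont.intervalIntegrable _ _), ← zero_add (2 * Real.pi), periodic_heatSeries 0 d t 0,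
    sub_self]

/-- The solution of the linear equation `∂ₜ p = ∂ₓ² p + p - R` satisfied by the support function,
split as `p (t, x) = R + Re (κ exp (i x)) + Q 0 t x`. Here `Q k` is the `k`-th derivative in `x` of
the part of `p` with frequencies at least `2`; it decays exponentially. The equation is only claimed
for `t ≥ 0`, the smoothness and the decay for all `t`. -/
structure HeatData (p₀ : ℝ → ℝ) (R : ℝ) (κ : ℂ) (Q : ℕ → ℝ → ℝ → ℝ) : Prop where
  smooth : ∀ k, ContDiff ℝ ∞ fun q : ℝ × ℝ => Q k q.1 q.2
  hasDerivAt_space : ∀ k t x, HasDerivAt (Q k t) (Q (k + 1) t x) x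
  hasDerivAt_time : ∀ k t x, 0 ≤ t → HasDerivAt (fun s => Q k s x) (Q (k + 2) t x + Q k t x) t
  periodic : ∀ k t, Function.Periodic (Q k t) (2 * Real.pi)
  decay : ∀ k, ∃ C, ∀ t x, ‖Q k t x‖ ≤ C * Real.exp (-(3 * |t|))
  integral_eq_zero : ∀ t, ∫ x in (0 : ℝ)..(2 * Real.pi), Q 0 t x = 0
  init : ∀ x, p₀ x = R + (κ * Complex.exp (x * Complex.I)).re + Q 0 0 x

/-- The linear equation is solved by Fourier series for every smooth initial value. -/
theorem exists_heatData {p₀ : ℝ → ℝ} (hp₀ : ContDiff ℝ ∞ p₀)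
    (hper : Function.Periodic p₀ (2 * Real.pi)) : ∃ R κ Q, HeatData p₀ R κ Q := by
  obtain ⟨c, hc, hsum⟩ := exists_rapidDecay_hasSum (f := fun x => (p₀ x : ℂ))
    (Complex.ofRealCLM.contDiff.comp hp₀) fun x => by simp only [hper x]
  let a : ℤ → ℂ := fun n => if |n| < 2 then 0 else c n
  have ha0 : ∀ n, |n| < 2 → a n = 0 := fun n hn => if_pos hn
  have ha : RapidDecay a := hc.of_le 1 0 (fun n => by
    simp only [a]; split_ifs <;> simp) zero_le_one
  let b : ℕ → ℤ → ℂ := fun k n => a n * (n * Complex.I) ^ k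
  have hbs : ∀ k, b (k + 1) = fun n => b k n * (n * Complex.I) := fun k => by
    funext n; simp only [b]; ring
  have hb : ∀ k, RapidDecay (b k) := fun k => by
    induction k with
    | zero => simpa [b] using ha
    | succ k ih => rw [hbs]; exact ih.mul_int
  have hb0 : ∀ k n, |n| < 2 → b k n = 0 := fun k n hn => by simp [b, ha0 n hn]
  refine ⟨(c 0).re, c 1 + (starRingEnd ℂ) (c (-1)), fun k t x => (heatSeries 0 (b k) t x).re,
    ?_, ?_, ?_, ?_, ?_, ?_, ?_⟩
  · exact fun k => Complex.reCLM.contDiff.comp (contDiff_heatSeries (hb k))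
  · intro k t x
    have := hasDerivAt_heatSeries_space 0 (hb k) t x
    rw [← hbs] at this
    exact Complex.reCLM.hasFDerivAt.comp_hasDerivAt x this
  · intro k t x ht
    have := hasDerivAt_heatSeries_time 0 (hb k) t x
    rw [zero_add, heatSeries_one_eq (hb k) (hb0 k) ht,
      show (fun n => b k n * (n * Complex.I) * (n * Complex.I)) = b (k + 2) by
        simp only [hbs]] at this
    exact Complex.reCLM.hasFDerivAt.comp_hasDerivAt t this
  · intro k t x
    simp only [periodic_heatSeries 0 (b k) t x]
  · intro k
    obtain ⟨C, hC⟩ := exists_norm_heatSeries_le (hb k) (hb0 k)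
    exact ⟨C, fun t x => (Complex.abs_re_le_norm _).trans (hC t x)⟩
  · exact fun t => integral_heatSeries_re (hb 0) (hb0 0 0 (by simp)) t
  · intro x
    have hsplit := eq_add_heatSeries_zero (a := b 0) (hb0 0)
      (fun n hn => by simp only [b, a, if_neg hn, pow_zero, mul_one]) (hsum x)
    have hre : ((starRingEnd ℂ) (c (-1)) * Complex.exp (x * Complex.I)).re =
        (c (-1) * Complex.exp (-x * Complex.I)).re := by
      rw [← Complex.conj_re]
      simp [← Complex.exp_conj]
    have := congrArg Complex.re hsplit
    simp only [Complex.ofReal_re, Complex.add_re] at this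
    rw [this, add_mul, Complex.add_re, hre]
    ring

/-! ### The flow of a time-dependent vector field on the line -/

/-- A smooth time-dependent vector field `V` on the line, bounded together with its derivative `V₁`
in the space variable. -/
structure IsBoundedField (V V₁ : ℝ → ℝ → ℝ) (M K : NNReal) : Prop where
  smooth : ContDiff ℝ ∞ fun q : ℝ × ℝ => V q.1 q.2
  smooth₁ : ContDiff ℝ ∞ fun q : ℝ × ℝ => V₁ q.1 q.2
  hasDerivAt : ∀ t x, HasDerivAt (V t) (V₁ t x) x
  bound : ∀ t x, ‖V t x‖ ≤ M
  bound₁ : ∀ t x, ‖V₁ t x‖ ≤ K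

namespace IsBoundedField

variable {V V₁ : ℝ → ℝ → ℝ} {M K : NNReal}

lemma lipschitzWith (h : IsBoundedField V V₁ M K) (t : ℝ) : LipschitzWith K (V t) :=
  lipschitzWith_of_nnnorm_deriv_le (fun x => (h.hasDerivAt t x).differentiableAt) fun x => by
    rw [(h.hasDerivAt t x).deriv]
    exact h.bound₁ t x

lemma eq_of_solutions (h : IsBoundedField V V₁ M K) {f g : ℝ → ℝ}
    (hf : ∀ t, HasDerivAt f (V t (f t)) t) (hg : ∀ t, HasDerivAt g (V t (g t)) t)
    (h0 : f 0 = g 0) : f = g :=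
  ODE_solution_unique_univ (s := fun _ => univ) (fun t => (h.lipschitzWith t).lipschitzOnWith)
    (fun t => ⟨hf t, mem_univ _⟩) (fun t => ⟨hg t, mem_univ _⟩) h0

/-- Solutions exist for all times: the solutions on the intervals `[-(n + 1), n + 1]` fit
together. -/
lemma exists_solution (h : IsBoundedField V V₁ M K) (u : ℝ) :
    ∃ f : ℝ → ℝ, f 0 = u ∧ ∀ t, HasDerivAt f (V t (f t)) t := by
  have hloc : ∀ n : ℕ, ∃ f : ℝ → ℝ, f 0 = u ∧
      ∀ t ∈ Ioo (-(n + 1 : ℝ)) (n + 1), HasDerivAt f (V t (f t)) t := by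
    intro n
    have hn : (0 : ℝ) ∈ Icc (-(n + 1 : ℝ)) (n + 1) := by
      constructor <;> linarith [n.cast_nonneg (α := ℝ)]
    have hPL : IsPicardLindelof V (tmin := -(n + 1 : ℝ)) (tmax := n + 1) ⟨0, hn⟩ u
        (M * (n + 1)) 0 M K :=
      { lipschitzOnWith := fun t _ => (h.lipschitzWith t).lipschitzOnWith
        continuousOn := fun x _ =>
          (h.smooth.continuous.comp (Continuous.prodMk_left x)).continuousOn
        norm_le := fun t _ x _ => h.bound t x
        mul_max_le := by simp }
    obtain ⟨f, hf0, hf⟩ := hPL.exists_eq_forall_mem_Icc_hasDerivWithinAt₀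
    exact ⟨f, hf0, fun t ht =>
      (hf t (Ioo_subset_Icc_self ht)).hasDerivAt (Icc_mem_nhds ht.1 ht.2)⟩
  choose f hf0 hf using hloc
  have hagree : ∀ n m : ℕ, n ≤ m → EqOn (f n) (f m) (Ioo (-(n + 1 : ℝ)) (n + 1)) := by
    intro n m hnm
    have hcast : (n : ℝ) ≤ m := by exact_mod_cast hnm
    refine ODE_solution_unique_of_mem_Ioo (s := fun _ => univ) (t₀ := 0)
      (fun t _ => (h.lipschitzWith t).lipschitzOnWith) ?_ (fun t ht => ⟨hf n t ht, mem_univ _⟩)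
      (fun t ht => ⟨hf m t ?_, mem_univ _⟩) ((hf0 n).trans (hf0 m).symm)
    · constructor <;> linarith [n.cast_nonneg (α := ℝ)]
    · constructor <;> linarith [ht.1, ht.2]
  refine ⟨fun t => f ⌈|t|⌉₊ t, hf0 _, fun t => ?_⟩
  have hmem : ∀ s : ℝ, s ∈ Ioo (-(⌈|s|⌉₊ + 1 : ℝ)) (⌈|s|⌉₊ + 1) := fun s => by
    have := Nat.le_ceil |s|
    have := neg_abs_le s
    have := le_abs_self s
    constructor <;> linarith
  have heq : ∀ s : ℝ, |s| < |t| + 1 → f ⌈|s|⌉₊ s = f (⌈|t|⌉₊ + 1) s := fun s hs => by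
    refine hagree _ _ ?_ (hmem s)
    rw [← Nat.ceil_add_one (abs_nonneg t)]
    exact Nat.ceil_mono hs.le
  have hN : t ∈ Ioo (-((⌈|t|⌉₊ + 1 : ℕ) + 1 : ℝ)) ((⌈|t|⌉₊ + 1 : ℕ) + 1) := by
    have := hmem t
    push_cast
    constructor <;> linarith [this.1, this.2]
  have hnear : ∀ᶠ s in 𝓝 t, |s| < |t| + 1 :=
    continuous_abs.continuousAt.eventually_lt continuousAt_const (by linarith)
  have := (hf _ t hN).congr_of_eventuallyEq (hnear.mono heq)
  rwa [← heq t (by linarith)] at this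

/-- The flow of a bounded field. -/
def flow (h : IsBoundedField V V₁ M K) (t u : ℝ) : ℝ := (h.exists_solution u).choose t

lemma flow_zero (h : IsBoundedField V V₁ M K) (u : ℝ) : h.flow 0 u = u :=
  (h.exists_solution u).choose_spec.1

lemma hasDerivAt_flow_time (h : IsBoundedField V V₁ M K) (t u : ℝ) :
    HasDerivAt (fun s => h.flow s u) (V t (h.flow t u)) t :=
  (h.exists_solution u).choose_spec.2 t

lemma eq_flow (h : IsBoundedField V V₁ M K) {f : ℝ → ℝ}
    (hf : ∀ t, HasDerivAt f (V t (f t)) t) (t : ℝ) : f t = h.flow t (f 0) :=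
  congrFun (h.eq_of_solutions hf (fun t => h.hasDerivAt_flow_time t (f 0))
    (h.flow_zero _).symm) t

lemma flow_add_of_periodic (h : IsBoundedField V V₁ M K) {T : ℝ}
    (hV : ∀ t, Function.Periodic (V t) T) (t u : ℝ) : h.flow t (u + T) = h.flow t u + T := by
  have := h.eq_flow (f := fun s => h.flow s u + T)
    (fun t => by rw [hV]; exact (h.hasDerivAt_flow_time t u).add_const T) t
  rw [this, flow_zero]

/-- The mean of `V₁` over the segment from `y` to `x`, that is, the difference quotient of `V`. -/
def quotient (V₁ : ℝ → ℝ → ℝ) (t x y : ℝ) : ℝ := ∫ r in (0 : ℝ)..1, V₁ t (y + r * (x - y))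

lemma continuous_quotient (h : IsBoundedField V V₁ M K) :
    Continuous fun q : ℝ × ℝ × ℝ => quotient V₁ q.1 q.2.1 q.2.2 := by
  refine intervalIntegral.continuous_parametric_intervalIntegral_of_continuous'
    (f := fun (q : ℝ × ℝ × ℝ) r => V₁ q.1 (q.2.2 + r * (q.2.1 - q.2.2))) ?_ 0 1
  have := h.smooth₁.continuous
  exact this.comp (f := fun p : (ℝ × ℝ × ℝ) × ℝ =>
    (p.1.1, p.1.2.2 + p.2 * (p.1.2.1 - p.1.2.2))) (by fun_prop)

lemma quotient_self (t x : ℝ) : quotient V₁ t x x = V₁ t x := by simp [quotient]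

lemma quotient_mul_sub (h : IsBoundedField V V₁ M K) (t x y : ℝ) :
    quotient V₁ t x y * (x - y) = V t x - V t y := by
  have hd : ∀ r : ℝ, HasDerivAt (fun r => V t (y + r * (x - y)))
      (V₁ t (y + r * (x - y)) * (x - y)) r := fun r => by
    refine (h.hasDerivAt t _).comp r ?_
    simpa using ((hasDerivAt_id r).mul_const (x - y)).const_add y
  have hc : Continuous fun r : ℝ => V₁ t (y + r * (x - y)) * (x - y) := by
    have := h.smooth₁.continuous
    exact (this.comp (f := fun r : ℝ => (t, y + r * (x - y))) (by fun_prop)).mul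
      continuous_const
  rw [quotient, ← intervalIntegral.integral_mul_const,
    intervalIntegral.integral_eq_sub_of_hasDerivAt (fun r _ => hd r) (hc.intervalIntegrable _ _)]
  simp

lemma norm_quotient_le (h : IsBoundedField V V₁ M K) (t x y : ℝ) :
    ‖quotient V₁ t x y‖ ≤ K := by
  simpa [quotient] using intervalIntegral.norm_integral_le_of_norm_le_const (a := 0) (b := 1)
    fun r _ => h.bound₁ t (y + r * (x - y))

end IsBoundedField

/-- A scalar linear homogeneous equation is solved by the exponential of an integral. -/
lemma eq_mul_exp_integral {δ W : ℝ → ℝ} (hW : Continuous W)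
    (hδ : ∀ t, HasDerivAt δ (W t * δ t) t) (t : ℝ) :
    δ t = δ 0 * Real.exp (∫ s in (0 : ℝ)..t, W s) := by
  have hI : ∀ t, HasDerivAt (fun t => ∫ s in (0 : ℝ)..t, W s) (W t) t := fun t =>
    hW.integral_hasStrictDerivAt 0 t |>.hasDerivAt
  have hconst : ∀ t, HasDerivAt (fun t => δ t * Real.exp (-∫ s in (0 : ℝ)..t, W s)) 0 t :=
    fun t => ((hδ t).mul (hI t).neg.exp).congr_deriv (by ring)
  have := is_const_of_deriv_eq_zero (fun t => (hconst t).differentiableAt)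
    (fun t => (hconst t).deriv) t 0
  simp only [intervalIntegral.integral_same, neg_zero, Real.exp_zero, mul_one] at this
  rw [← this, mul_assoc, ← Real.exp_add, neg_add_cancel, Real.exp_zero, mul_one]

namespace IsBoundedField

variable {V V₁ : ℝ → ℝ → ℝ} {M K : NNReal}

lemma continuous_flow_time (h : IsBoundedField V V₁ M K) (u : ℝ) :
    Continuous fun t => h.flow t u :=
  continuous_iff_continuousAt.2 fun t => (h.hasDerivAt_flow_time t u).continuousAt

/-- The difference of two solutions solves a linear equation whose coefficient is the difference
quotient of the field. -/
lemma flow_sub_flow (h : IsBoundedField V V₁ M K) (t u v : ℝ) :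
    h.flow t u - h.flow t v =
      (u - v) * Real.exp (∫ s in (0 : ℝ)..t, quotient V₁ s (h.flow s u) (h.flow s v)) := by
  have hW : Continuous fun s => quotient V₁ s (h.flow s u) (h.flow s v) :=
    h.continuous_quotient.comp (f := fun s => (s, h.flow s u, h.flow s v))
      (continuous_id.prodMk ((h.continuous_flow_time u).prodMk (h.continuous_flow_time v)))
  have := eq_mul_exp_integral (δ := fun t => h.flow t u - h.flow t v) hW (fun t => by
    rw [h.quotient_mul_sub]
    exact (h.hasDerivAt_flow_time t u).sub (h.hasDerivAt_flow_time t v)) t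
  simpa only [flow_zero] using this

lemma abs_flow_sub_flow_le (h : IsBoundedField V V₁ M K) (t u v : ℝ) :
    |h.flow t u - h.flow t v| ≤ |u - v| * Real.exp (K * |t|) := by
  rw [h.flow_sub_flow, abs_mul, Real.abs_exp]
  gcongr
  refine (Real.le_norm_self _).trans ?_
  simpa using intervalIntegral.norm_integral_le_of_norm_le_const (a := 0) (b := t)
    fun s _ => h.norm_quotient_le s (h.flow s u) (h.flow s v)

lemma continuous_flow (h : IsBoundedField V V₁ M K) :
    Continuous fun q : ℝ × ℝ => h.flow q.1 q.2 := by
  refine continuous_iff_continuousAt.2 fun ⟨t₀, u₀⟩ => ?_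
  have h1 : Tendsto (fun q : ℝ × ℝ => h.flow q.1 q.2 - h.flow q.1 u₀) (𝓝 (t₀, u₀)) (𝓝 0) := by
    refine squeeze_zero_norm (fun q => h.abs_flow_sub_flow_le q.1 q.2 u₀) ?_
    have : Continuous fun q : ℝ × ℝ => |q.2 - u₀| * Real.exp (K * |q.1|) := by fun_prop
    simpa using this.tendsto (t₀, u₀)
  have h2 : Tendsto (fun q : ℝ × ℝ => h.flow q.1 u₀) (𝓝 (t₀, u₀)) (𝓝 (h.flow t₀ u₀)) :=
    ((h.continuous_flow_time u₀).comp continuous_fst).tendsto (t₀, u₀)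
  simpa [ContinuousAt] using h1.add h2

/-- The derivative of the flow in the initial value is the limit of the difference quotients
computed in `flow_sub_flow`. -/
lemma hasDerivAt_flow_space (h : IsBoundedField V V₁ M K) (t u : ℝ) :
    HasDerivAt (h.flow t) (Real.exp (∫ s in (0 : ℝ)..t, V₁ s (h.flow s u))) u := by
  have hc : Continuous fun v =>
      Real.exp (∫ s in (0 : ℝ)..t, quotient V₁ s (h.flow s v) (h.flow s u)) := by
    refine Real.continuous_exp.comp
      (intervalIntegral.continuous_parametric_intervalIntegral_of_continuous'
        (f := fun v s => quotient V₁ s (h.flow s v) (h.flow s u)) ?_ 0 t)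
    exact h.continuous_quotient.comp (f := fun p : ℝ × ℝ => (p.2, h.flow p.2 p.1, h.flow p.2 u))
      (continuous_snd.prodMk ((h.continuous_flow.comp continuous_swap).prodMk
        ((h.continuous_flow_time u).comp continuous_snd)))
  rw [hasDerivAt_iff_tendsto_slope]
  have hlim := (hc.tendsto u).mono_left (nhdsWithin_le_nhds (s := {u}ᶜ))
  simp only [quotient_self] at hlim
  refine hlim.congr' ?_
  filter_upwards [self_mem_nhdsWithin] with v hv
  have hv' : v - u ≠ 0 := sub_ne_zero.2 hv
  rw [slope_def_field, h.flow_sub_flow t v u, mul_div_cancel_left₀ _ hv']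

/-- Both partial derivatives of the flow are expressed by the flow itself, hence are as smooth as it
is. -/
theorem contDiff_flow (h : IsBoundedField V V₁ M K) :
    ContDiff ℝ ∞ fun q : ℝ × ℝ => h.flow q.1 q.2 := by
  refine contDiff_infty.2 fun n => ?_
  induction n with
  | zero => exact contDiff_zero.2 h.continuous_flow
  | succ n ih =>
    have hpair : ContDiff ℝ n fun q : ℝ × ℝ => (q.1, h.flow q.1 q.2) := contDiff_fst.prodMk ih
    refine contDiff_succ_of_partials h.hasDerivAt_flow_time h.hasDerivAt_flow_space ?_ ?_
    · exact (h.smooth.of_le (by norm_cast; exact le_top)).comp hpair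
    · exact Real.contDiff_exp.comp (contDiff_integral_zero n
        (F := fun s u => V₁ s (h.flow s u))
        ((h.smooth₁.of_le (by norm_cast; exact le_top)).comp hpair))

end IsBoundedField

/-! ### Uniform bounds on space derivatives -/

section DerivBdd

variable {E F : Type*} [NormedAddCommGroup E] [NormedSpace ℝ E]
  [NormedAddCommGroup F] [NormedSpace ℝ F]

/-- `f t` is `k` times differentiable for each `t`, and its derivatives up to order `k` are bounded
by constant multiples of `w t`. -/
def DerivBdd (w : ℝ → ℝ) : ℕ → (ℝ → ℝ → E) → Prop
  | 0, f => ∃ C, ∀ t u, ‖f t u‖ ≤ C * w t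
  | k + 1, f => (∃ C, ∀ t u, ‖f t u‖ ≤ C * w t) ∧ (∀ t, Differentiable ℝ (f t)) ∧
      DerivBdd w k fun t => deriv (f t)

namespace DerivBdd

variable {w v : ℝ → ℝ} {k : ℕ} {f g : ℝ → ℝ → E}

lemma bound (h : DerivBdd w k f) : ∃ C, ∀ t u, ‖f t u‖ ≤ C * w t := by
  cases k with
  | zero => exact h
  | succ k => exact h.1

lemma of_succ (h : DerivBdd w (k + 1) f) : DerivBdd w k f := by
  induction k generalizing f with
  | zero => exact h.1
  | succ k ih => exact ⟨h.1, h.2.1, ih h.2.2⟩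

lemma succ_of_hasDerivAt {f' : ℝ → ℝ → E} (hb : DerivBdd w 0 f)
    (hd : ∀ t u, HasDerivAt (f t) (f' t u) u) (h : DerivBdd w k f') : DerivBdd w (k + 1) f := by
  refine ⟨hb, fun t u => (hd t u).differentiableAt, ?_⟩
  rwa [show (fun t => deriv (f t)) = f' from funext fun t => funext fun u => (hd t u).deriv]

lemma add (hf : DerivBdd w k f) (hg : DerivBdd w k g) :
    DerivBdd w k fun t u => f t u + g t u := by
  induction k generalizing f g with
  | zero =>
    obtain ⟨C, hC⟩ := hf
    obtain ⟨D, hD⟩ := hg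
    exact ⟨C + D, fun t u => (norm_add_le _ _).trans (by linarith [hC t u, hD t u])⟩
  | succ k ih =>
    refine succ_of_hasDerivAt ?_
      (fun t u => (hf.2.1 t u).hasDerivAt.add (hg.2.1 t u).hasDerivAt) (ih hf.2.2 hg.2.2)
    obtain ⟨C, hC⟩ := hf.1
    obtain ⟨D, hD⟩ := hg.1
    exact ⟨C + D, fun t u => (norm_add_le _ _).trans (by linarith [hC t u, hD t u])⟩

lemma const (c : E) : DerivBdd (fun _ => 1) k fun _ _ => c := by
  induction k generalizing c with
  | zero => exact ⟨‖c‖, fun t u => by simp⟩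
  | succ k ih =>
    exact succ_of_hasDerivAt ⟨‖c‖, fun t u => by simp⟩ (fun t u => hasDerivAt_const u c) (ih 0)

lemma mono_weight (hwv : ∀ t, |w t| ≤ v t) (h : DerivBdd w k f) : DerivBdd v k f := by
  have key : ∀ f : ℝ → ℝ → E, (∃ C, ∀ t u, ‖f t u‖ ≤ C * w t) → ∃ C, ∀ t u, ‖f t u‖ ≤ C * v t := by
    rintro f ⟨C, hC⟩
    refine ⟨|C|, fun t u => (hC t u).trans ((le_abs_self _).trans ?_)⟩
    rw [abs_mul]
    exact mul_le_mul_of_nonneg_left (hwv t) (abs_nonneg C)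
  induction k generalizing f with
  | zero => exact key f h
  | succ k ih => exact ⟨key f h.1, h.2.1, ih h.2.2⟩

lemma clm_comp (L : E →L[ℝ] F) (h : DerivBdd w k f) : DerivBdd w k fun t u => L (f t u) := by
  have key : ∀ f : ℝ → ℝ → E, (∃ C, ∀ t u, ‖f t u‖ ≤ C * w t) →
      ∃ C, ∀ t u, ‖L (f t u)‖ ≤ C * w t := by
    rintro f ⟨C, hC⟩
    refine ⟨‖L‖ * C, fun t u => (L.le_opNorm _).trans ?_⟩
    rw [mul_assoc]
    exact mul_le_mul_of_nonneg_left (hC t u) (norm_nonneg L)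
  induction k generalizing f with
  | zero => exact key f h
  | succ k ih =>
    exact succ_of_hasDerivAt (key f h.1)
      (fun t u => L.hasFDerivAt.comp_hasDerivAt u (h.2.1 t u).hasDerivAt) (ih h.2.2)

section Algebra

variable {A : Type*} [NormedRing A] [NormedAlgebra ℝ A] {a b : ℝ → ℝ → A}

lemma mul (ha : DerivBdd w k a) (hb : DerivBdd (fun _ => 1) k b) :
    DerivBdd w k fun t u => a t u * b t u := by
  have key : ∀ a b : ℝ → ℝ → A, (∃ C, ∀ t u, ‖a t u‖ ≤ C * w t) →
      (∃ C, ∀ t u, ‖b t u‖ ≤ C * 1) → ∃ C, ∀ t u, ‖a t u * b t u‖ ≤ C * w t := by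
    rintro a b ⟨C, hC⟩ ⟨D, hD⟩
    refine ⟨C * D, fun t u => (norm_mul_le _ _).trans ?_⟩
    refine (mul_le_mul (hC t u) (hD t u) (norm_nonneg _) ((norm_nonneg _).trans (hC t u))).trans ?_
    exact le_of_eq (by ring)
  induction k generalizing a b with
  | zero => exact key a b ha hb
  | succ k ih =>
    refine succ_of_hasDerivAt (key a b ha.1 hb.1)
      (fun t u => (ha.2.1 t u).hasDerivAt.mul (hb.2.1 t u).hasDerivAt) ?_
    exact (ih ha.2.2 hb.of_succ).add (ih ha.of_succ hb.2.2)

/-- A bounded solution of `a' = b a` inherits the bounds of its coefficient `b`. -/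
lemma of_linear (h0 : DerivBdd (fun _ => 1) 0 a)
    (hd : ∀ t u, HasDerivAt (a t) (b t u * a t u) u)
    (hb : ∀ j < k, DerivBdd (fun _ => 1) j b) : DerivBdd (fun _ => 1) k a := by
  induction k with
  | zero => exact h0
  | succ k ih =>
    exact succ_of_hasDerivAt h0 hd ((hb k (Nat.lt_succ_self k)).mul
      (ih fun j hj => hb j (hj.trans (Nat.lt_succ_self k))))

end Algebra

/-- The order is written `k + 1` so that the hypothesis contains the differentiability of `b`. -/
lemma inv_one_add_sq {b : ℝ → ℝ → ℝ} (hb : DerivBdd (fun _ => 1) (k + 1) b) :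
    DerivBdd (fun _ => 1) (k + 1) fun t u => (1 + b t u ^ 2)⁻¹ := by
  have h0 : DerivBdd (fun _ => 1) 0 fun t u => (1 + b t u ^ 2)⁻¹ := by
    refine ⟨1, fun t u => ?_⟩
    rw [mul_one, norm_inv, Real.norm_of_nonneg (by positivity)]
    exact inv_le_one_of_one_le₀ (by nlinarith [sq_nonneg (b t u)])
  have hd : ∀ t u, HasDerivAt (fun u => (1 + b t u ^ 2)⁻¹)
      (-2 * b t u * deriv (b t) u * (1 + b t u ^ 2)⁻¹ * (1 + b t u ^ 2)⁻¹) u := by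
    intro t u
    have hne : 1 + b t u ^ 2 ≠ 0 := by positivity
    refine ((((hb.2.1 t u).hasDerivAt.pow 2).const_add 1).inv hne).congr_deriv ?_
    rw [mul_assoc _ (1 + b t u ^ 2)⁻¹, ← mul_inv, ← pow_two, ← div_eq_mul_inv]
    simp
  have hpos : ∀ k, DerivBdd (fun _ => 1) (k + 1) b →
      DerivBdd (fun _ => 1) k fun t u => (1 + b t u ^ 2)⁻¹ := by
    intro k
    induction k with
    | zero => exact fun _ => h0
    | succ k ih =>
      intro hb
      have hi := ih hb.of_succ
      exact succ_of_hasDerivAt h0 hd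
        (((((const (-2 : ℝ)).mul hb.of_succ.of_succ).mul hb.2.2.of_succ).mul hi).mul hi)
  have hi := hpos k hb
  exact succ_of_hasDerivAt h0 hd ((((((const (-2 : ℝ)).mul hb.of_succ).mul hb.2.2).mul hi)).mul hi)

lemma of_hasDerivAt_seq {f : ℕ → ℝ → ℝ → E} (hb : ∀ k, ∃ C, ∀ t u, ‖f k t u‖ ≤ C * w t)
    (hd : ∀ k t u, HasDerivAt (f k t) (f (k + 1) t u) u) (j k : ℕ) : DerivBdd w k (f j) := by
  induction k generalizing j with
  | zero => exact hb j
  | succ k ih => exact succ_of_hasDerivAt (hb j) (hd j) (ih (j + 1))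

/-- Bounds are preserved by composition with a change of variable `u ↦ Φ t u`. -/
lemma comp {f Φ Φ₁ : ℝ → ℝ → ℝ} (hf : ∀ j, DerivBdd w j f)
    (hΦ : ∀ t u, HasDerivAt (Φ t) (Φ₁ t u) u) (hΦ₁ : ∀ j < k, DerivBdd (fun _ => 1) j Φ₁) :
    DerivBdd w k fun t u => f t (Φ t u) := by
  have h0 : ∀ f : ℝ → ℝ → ℝ, DerivBdd w 0 f → DerivBdd w 0 fun t u => f t (Φ t u) := by
    rintro f ⟨C, hC⟩
    exact ⟨C, fun t u => hC t _⟩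
  induction k generalizing f with
  | zero => exact h0 f (hf 0)
  | succ k ih =>
    have hf' : ∀ j, DerivBdd w j fun t => deriv (f t) := fun j => (hf (j + 1)).2.2
    refine succ_of_hasDerivAt (h0 f (hf 0))
      (fun t u => ((hf 1).2.1 t _).hasDerivAt.comp u (hΦ t u)) ?_
    exact (ih hf' fun j hj => hΦ₁ j (hj.trans (Nat.lt_succ_self k))).mul
      (hΦ₁ k (Nat.lt_succ_self k))

lemma norm_iteratedDeriv_le (h : DerivBdd w k f) :
    ∃ C, ∀ t u, ‖iteratedDeriv k (f t) u‖ ≤ C * w t := by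
  induction k generalizing f with
  | zero => simpa only [iteratedDeriv_zero] using h.bound
  | succ k ih => simpa only [iteratedDeriv_succ'] using ih h.2.2

end DerivBdd

end DerivBdd

/-! ### Exponential decay in time -/

section Decay

variable {E : Type*} [NormedAddCommGroup E] [NormedSpace ℝ E]

/-- The rate of decay in time of the modes of frequency at least `2`. -/
def decayWeight (t : ℝ) : ℝ := Real.exp (-(3 * |t|))

lemma decayWeight_pos (t : ℝ) : 0 < decayWeight t := Real.exp_pos _

lemma abs_decayWeight_le_one (t : ℝ) : |decayWeight t| ≤ 1 := by
  rw [abs_of_pos (decayWeight_pos t)]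
  exact Real.exp_le_one_iff.2 (by linarith [abs_nonneg t])

lemma tendsto_exp_neg_three_mul : Tendsto (fun t : ℝ => Real.exp (-(3 * t))) atTop (𝓝 0) :=
  Real.tendsto_exp_neg_atTop_nhds_zero.comp (tendsto_id.const_mul_atTop (by norm_num))

lemma DerivBdd.bdd {k : ℕ} {f : ℝ → ℝ → E} (h : DerivBdd decayWeight k f) :
    DerivBdd (fun _ => 1) k f :=
  h.mono_weight abs_decayWeight_le_one

lemma norm_integral_le_exp {f : ℝ → E} {C : ℝ} (hf : ∀ s, ‖f s‖ ≤ C * decayWeight s) {a b : ℝ}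
    (hab : a ≤ b) : ‖∫ s in a..b, f s‖ ≤ C / 3 * Real.exp (-(3 * a)) := by
  have hC : 0 ≤ C := nonneg_of_mul_nonneg_left ((norm_nonneg _).trans (hf 0)) (decayWeight_pos 0)
  have hd : ∀ s : ℝ, HasDerivAt (fun s : ℝ => -(C / 3 * Real.exp (-(3 * s))))
      (C * Real.exp (-(3 * s))) s := by
    intro s
    refine ((((hasDerivAt_id s).const_mul 3).neg.exp).const_mul (C / 3)).neg.congr_deriv ?_
    simp
    ring
  have hc : Continuous fun s : ℝ => C * Real.exp (-(3 * s)) := by fun_prop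
  refine (intervalIntegral.norm_integral_le_of_norm_le hab
    (Eventually.of_forall fun s _ => (hf s).trans ?_) (hc.intervalIntegrable a b)).trans ?_
  · exact mul_le_mul_of_nonneg_left (Real.exp_le_exp.2 (by linarith [le_abs_self s])) hC
  · rw [intervalIntegral.integral_eq_sub_of_hasDerivAt (fun s _ => hd s)
      (hc.intervalIntegrable _ _)]
    have : 0 ≤ C / 3 * Real.exp (-(3 * b)) := by positivity
    linarith

lemma norm_integral_zero_le {f : ℝ → E} {C : ℝ} (hf : ∀ s, ‖f s‖ ≤ C * decayWeight s) (t : ℝ) :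
    ‖∫ s in (0 : ℝ)..t, f s‖ ≤ C / 3 := by
  rcases le_total 0 t with ht | ht
  · simpa using norm_integral_le_exp hf ht
  · have h := norm_integral_le_exp (f := fun s => f (-s)) (C := C)
      (fun s => by simpa [decayWeight] using hf (-s)) (neg_nonneg.2 ht)
    rw [intervalIntegral.integral_comp_neg, neg_neg, neg_zero, intervalIntegral.integral_symm,
      norm_neg] at h
    simpa using h

lemma contDiff_deriv_space {f : ℝ → ℝ → E} (hf : ContDiff ℝ ∞ fun q : ℝ × ℝ => f q.1 q.2) :
    ContDiff ℝ ∞ fun q : ℝ × ℝ => deriv (f q.1) q.2 := by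
  have : (fun q : ℝ × ℝ => deriv (f q.1) q.2) =
      fun q => fderiv ℝ (fun q : ℝ × ℝ => f q.1 q.2) q (0, 1) :=
    funext fun q => (hasDerivAt_snd (f := fun q : ℝ × ℝ => f q.1 q.2)
      (hf.differentiable (by simp) (q.1, q.2))).deriv
  rw [this]
  exact (hf.fderiv_right (m := ∞) (by norm_cast)).clm_apply contDiff_const

lemma contDiff_slice {f : ℝ → ℝ → E} (hf : ContDiff ℝ ∞ fun q : ℝ × ℝ => f q.1 q.2) (t : ℝ) :
    ContDiff ℝ ∞ (f t) :=
  hf.comp (contDiff_prodMk_right t)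

lemma DerivBdd.integral {k : ℕ} {f : ℝ → ℝ → E}
    (hs : ContDiff ℝ ∞ fun q : ℝ × ℝ => f q.1 q.2) (hf : DerivBdd decayWeight k f) :
    DerivBdd (fun _ => 1) k fun t u => ∫ s in (0 : ℝ)..t, f s u := by
  have h0 : ∀ f : ℝ → ℝ → E, DerivBdd decayWeight 0 f →
      DerivBdd (fun _ => 1) 0 fun t u => ∫ s in (0 : ℝ)..t, f s u := by
    rintro f ⟨C, hC⟩
    exact ⟨C / 3, fun t u => by simpa using norm_integral_zero_le (fun s => hC s u) t⟩
  induction k generalizing f with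
  | zero => exact h0 f hf
  | succ k ih =>
    have hs' := contDiff_deriv_space hs
    refine DerivBdd.succ_of_hasDerivAt (h0 f hf.1) (fun t u => ?_) (ih hs' hf.2.2)
    refine hasDerivAt_integral_of_continuousOn (F := fun u s => f s u)
      (F' := fun u s => deriv (f s) u) (s := univ) isOpen_univ (mem_univ u)
      (fun x _ => (hs.continuous.comp (Continuous.prodMk_left x)).continuousOn) ?_
      fun x _ r _ => (hf.2.1 r x).hasDerivAt
    exact (hs'.continuous.comp (continuous_snd.prodMk continuous_fst)).continuousOn

/-- A family whose time derivative decays exponentially converges uniformly. -/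
lemma exists_tendstoUniformly [CompleteSpace E] {f f' : ℝ → ℝ → E}
    (hd : ∀ t u, HasDerivAt (fun s => f s u) (f' t u) t)
    (hc : ∀ u, Continuous fun s => f' s u) (hb : DerivBdd decayWeight 0 f') :
    ∃ g : ℝ → E, TendstoUniformly f g atTop := by
  obtain ⟨C, hC⟩ := hb
  have hb0 : Tendsto (fun t : ℝ => C / 3 * Real.exp (-(3 * t))) atTop (𝓝 0) := by
    simpa using tendsto_exp_neg_three_mul.const_mul (C / 3)
  have hdist : ∀ u s t, s ≤ t → dist (f s u) (f t u) ≤ C / 3 * Real.exp (-(3 * s)) := by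
    intro u s t hst
    rw [dist_comm, dist_eq_norm, ← intervalIntegral.integral_eq_sub_of_hasDerivAt
      (f := fun s => f s u) (fun r _ => hd r u) ((hc u).intervalIntegrable _ _)]
    exact norm_integral_le_exp (fun r => hC r u) hst
  have hlim : ∀ u, ∃ y, Tendsto (fun t => f t u) atTop (𝓝 y) := fun u =>
    cauchySeq_tendsto_of_complete (cauchySeq_of_le_tendsto_0' _ (hdist u) hb0)
  choose g hg using hlim
  refine ⟨g, Metric.tendstoUniformly_iff.2 fun ε hε => ?_⟩
  filter_upwards [hb0.eventually (gt_mem_nhds hε)] with t ht u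
  refine lt_of_le_of_lt ?_ ht
  rw [dist_comm]
  refine le_of_tendsto (tendsto_const_nhds.dist (hg u)) ?_
  filter_upwards [eventually_ge_atTop t] with s hs using hdist u t s hs

/-- A smooth family whose time derivative decays exponentially, together with all its space
derivatives, converges in `C^∞`. -/
theorem exists_limit_smooth [CompleteSpace E] {f f' : ℝ → ℝ → E}
    (hs : ContDiff ℝ ∞ fun q : ℝ × ℝ => f q.1 q.2)
    (hs' : ContDiff ℝ ∞ fun q : ℝ × ℝ => f' q.1 q.2)
    (hd : ∀ t u, HasDerivAt (fun s => f s u) (f' t u) t) (hb : ∀ k, DerivBdd decayWeight k f') :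
    ∃ g : ℝ → E, ContDiff ℝ ∞ g ∧
      ∀ k, TendstoUniformly (fun t => iteratedDeriv k (f t)) (iteratedDeriv k g) atTop := by
  have key : ∀ k : ℕ, ∀ f f' : ℝ → ℝ → E, ContDiff ℝ ∞ (fun q : ℝ × ℝ => f q.1 q.2) →
      ContDiff ℝ ∞ (fun q : ℝ × ℝ => f' q.1 q.2) →
      (∀ t u, HasDerivAt (fun s => f s u) (f' t u) t) → (∀ k, DerivBdd decayWeight k f') →
      ∃ g : ℝ → E, TendstoUniformly (fun t => iteratedDeriv k (f t)) g atTop := by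
    intro k
    induction k with
    | zero =>
      intro f f' _ hs' hd hb
      simpa only [iteratedDeriv_zero] using exists_tendstoUniformly hd
        (fun u => hs'.continuous.comp (Continuous.prodMk_left u)) (hb 0)
    | succ k ih =>
      intro f f' hs hs' hd hb
      simp only [iteratedDeriv_succ']
      exact ih _ _ (contDiff_deriv_space hs) (contDiff_deriv_space hs')
        (fun t u => (hasDerivAt_deriv_comm (U := univ) isOpen_univ hs.contDiffOn
          (fun q _ => hd q.1 q.2) (mem_univ _)).2) fun k => (hb (k + 1)).2.2
  choose g hg using fun k => key k f f' hs hs' hd hb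
  have hder : ∀ k u, HasDerivAt (g k) (g (k + 1) u) u := fun k u =>
    hasDerivAt_of_tendstoUniformly (hg (k + 1)) (Eventually.of_forall fun t x => by
      rw [iteratedDeriv_succ]
      exact ((contDiff_slice hs t).differentiable_iteratedDeriv k
        (by norm_cast; exact WithTop.coe_lt_top _) x).hasDerivAt)
      (fun x => (hg k).tendsto_at x) u
  have hiter : ∀ k, iteratedDeriv k (g 0) = g k := by
    intro k
    induction k with
    | zero => exact iteratedDeriv_zero
    | succ k ih => rw [iteratedDeriv_succ, ih]; exact funext fun u => (hder k u).deriv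
  refine ⟨g 0, contDiff_of_differentiable_iteratedDeriv fun k _ => ?_, fun k => ?_⟩
  · rw [hiter]
    exact fun u => (hder k u).differentiableAt
  · rw [hiter]
    exact hg k

end Decay

namespace IsBoundedField

variable {V V₁ : ℝ → ℝ → ℝ} {M K : NNReal}

/-- The factor by which the flow of a field stretches the line. -/
def stretch (h : IsBoundedField V V₁ M K) (t u : ℝ) : ℝ :=
  Real.exp (∫ s in (0 : ℝ)..t, V₁ s (h.flow s u))

lemma stretch_pos (h : IsBoundedField V V₁ M K) (t u : ℝ) : 0 < h.stretch t u := Real.exp_pos _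

lemma contDiff_comp_flow (h : IsBoundedField V V₁ M K) {f : ℝ → ℝ → ℝ}
    (hf : ContDiff ℝ ∞ fun q : ℝ × ℝ => f q.1 q.2) :
    ContDiff ℝ ∞ fun q : ℝ × ℝ => f q.1 (h.flow q.1 q.2) :=
  hf.comp (contDiff_fst.prodMk h.contDiff_flow)

lemma contDiff_stretch (h : IsBoundedField V V₁ M K) :
    ContDiff ℝ ∞ fun q : ℝ × ℝ => h.stretch q.1 q.2 :=
  Real.contDiff_exp.comp (contDiff_infty.2 fun n => contDiff_integral_zero n
    (F := fun s u => V₁ s (h.flow s u)) (contDiff_infty.1 (h.contDiff_comp_flow h.smooth₁) n))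

lemma derivBdd_field₁ (h : IsBoundedField V V₁ M K) (hV : ∀ k, DerivBdd decayWeight k V) (k : ℕ) :
    DerivBdd decayWeight k V₁ := by
  have := (hV (k + 1)).2.2
  rwa [show (fun t => deriv (V t)) = V₁ from
    funext fun t => funext fun u => (h.hasDerivAt t u).deriv] at this

lemma exists_abs_log_stretch_le (h : IsBoundedField V V₁ M K)
    (hV : ∀ k, DerivBdd decayWeight k V) :
    ∃ C, ∀ t u, |∫ s in (0 : ℝ)..t, V₁ s (h.flow s u)| ≤ C := by
  obtain ⟨C, hC⟩ := h.derivBdd_field₁ hV 0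
  exact ⟨C / 3, fun t u => norm_integral_zero_le (fun s => hC s (h.flow s u)) t⟩

/-- If the field decays exponentially with all derivatives, then all derivatives of its flow are
bounded for all times. -/
lemma derivBdd_stretch (h : IsBoundedField V V₁ M K) (hV : ∀ k, DerivBdd decayWeight k V) (k : ℕ) :
    DerivBdd (fun _ => 1) k h.stretch := by
  have hV₁ := h.derivBdd_field₁ hV
  have h0 : DerivBdd (fun _ => 1) 0 h.stretch := by
    obtain ⟨C, hC⟩ := h.exists_abs_log_stretch_le hV
    refine ⟨Real.exp C, fun t u => ?_⟩
    rw [mul_one, stretch, Real.norm_eq_abs, Real.abs_exp]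
    exact Real.exp_le_exp.2 ((le_abs_self _).trans (hC t u))
  have hs : ContDiff ℝ ∞ fun q : ℝ × ℝ => V₁ q.1 (h.flow q.1 q.2) :=
    h.contDiff_comp_flow h.smooth₁
  have hd : ∀ t u, HasDerivAt (h.stretch t)
      ((∫ s in (0 : ℝ)..t, deriv (fun x => V₁ s (h.flow s x)) u) * h.stretch t u) u := by
    intro t u
    have hc := (contDiff_deriv_space (f := fun s x => V₁ s (h.flow s x)) hs).continuous
    refine (hasDerivAt_integral_of_continuousOn (F := fun u s => V₁ s (h.flow s u))
      (F' := fun u s => deriv (fun x => V₁ s (h.flow s x)) u) (s := univ) isOpen_univ (mem_univ u)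
      (fun x _ => (hs.continuous.comp (Continuous.prodMk_left x)).continuousOn)
      (hc.comp (continuous_snd.prodMk continuous_fst)).continuousOn fun x _ r _ =>
      ?_).exp.congr_deriv (mul_comm _ _)
    exact ((contDiff_slice (f := fun s x => V₁ s (h.flow s x)) hs r).differentiable
      (by simp) x).hasDerivAt
  induction k with
  | zero => exact h0
  | succ k ih =>
    have hle : ∀ j ≤ k, DerivBdd (fun _ => 1) j h.stretch := by
      intro j hj
      induction hj using Nat.decreasingInduction with
      | self => exact ih
      | of_succ j _ hj => exact hj.of_succ
    -- the logarithmic derivative is the time integral of an exponentially decaying function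
    refine DerivBdd.of_linear h0 hd fun j hj => ?_
    have hcomp : DerivBdd decayWeight (j + 1) fun t u => V₁ t (h.flow t u) :=
      DerivBdd.comp hV₁ h.hasDerivAt_flow_space fun i hi => hle i (by omega)
    exact DerivBdd.integral (contDiff_deriv_space (f := fun s x => V₁ s (h.flow s x)) hs)
      hcomp.2.2

lemma derivBdd_comp_flow (h : IsBoundedField V V₁ M K) (hV : ∀ k, DerivBdd decayWeight k V)
    {w : ℝ → ℝ} {f : ℝ → ℝ → ℝ} (hf : ∀ j, DerivBdd w j f) (k : ℕ) :
    DerivBdd w k fun t u => f t (h.flow t u) :=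
  DerivBdd.comp hf h.hasDerivAt_flow_space fun j _ => h.derivBdd_stretch hV j

/-- The flow of an exponentially decaying field converges to a diffeomorphism. -/
theorem exists_flow_limit (h : IsBoundedField V V₁ M K) (hV : ∀ k, DerivBdd decayWeight k V) :
    ∃ φ : ℝ → ℝ, ContDiff ℝ ∞ φ ∧ (∀ u, 0 < deriv φ u) ∧
      ∀ u, Tendsto (fun t => h.flow t u) atTop (𝓝 (φ u)) := by
  obtain ⟨φ, hφ, hlim⟩ := exists_limit_smooth h.contDiff_flow (h.contDiff_comp_flow h.smooth)
    h.hasDerivAt_flow_time fun k => h.derivBdd_comp_flow hV hV k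
  refine ⟨φ, hφ, fun u => ?_, fun u => by simpa using (hlim 0).tendsto_at u⟩
  obtain ⟨C, hC⟩ := h.exists_abs_log_stretch_le hV
  have h1 : Tendsto (fun t => h.stretch t u) atTop (𝓝 (deriv φ u)) := by
    have := (hlim 1).tendsto_at u
    simp only [iteratedDeriv_one] at this
    exact this.congr fun t => (h.hasDerivAt_flow_space t u).deriv
  refine (Real.exp_pos (-C)).trans_le (ge_of_tendsto h1 (Eventually.of_forall fun t => ?_))
  exact Real.exp_le_exp.2 (neg_le_of_abs_le (hC t u))

end IsBoundedField

/-! ### The moving frame -/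

lemma inner_I_mul_self {z : ℂ} (hz : ‖z‖ = 1) (r : ℝ) : inner ℝ ((r : ℂ) * (Complex.I * z))
    (Complex.I * z) = r := by
  rw [← Complex.real_smul, real_inner_smul_left, real_inner_self_eq_norm_sq, norm_mul,
    Complex.norm_I, hz]
  norm_num

/-- Coordinates of a vector `a` in the orthonormal frame `z, I * z`. -/
lemma eq_frame {z : ℂ} (hz : ‖z‖ = 1) (a : ℂ) :
    a = ((inner ℝ a z : ℝ) + (inner ℝ a (Complex.I * z) : ℝ) * Complex.I) * z := by
  have h : z.re * z.re + z.im * z.im = 1 := by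
    rw [← Complex.normSq_apply, Complex.normSq_eq_norm_sq, hz, one_pow]
  apply Complex.ext
  · simp [Complex.inner]
    linear_combination -a.re * h
  · simp [Complex.inner]
    linear_combination -a.im * h

lemma ell_eq {ν : ℝ → ℂ} {u r : ℝ} (hν : ‖ν u‖ = 1)
    (hd : HasDerivAt ν ((r : ℂ) * (Complex.I * ν u)) u) : ell ν u = r := by
  rw [ell, mu, hd.deriv, inner_I_mul_self hν]

lemma beta_eq {γ ν : ℝ → ℂ} {u r : ℝ} (hν : ‖ν u‖ = 1)
    (hd : HasDerivAt γ ((r : ℂ) * (Complex.I * ν u)) u) : beta γ ν u = r := by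
  rw [beta, mu, hd.deriv, inner_I_mul_self hν]

namespace IsLegendre

variable {γ ν : ℝ → ℂ}

lemma hasDerivAt_curve (h : IsLegendre γ ν) (u : ℝ) :
    HasDerivAt γ ((beta γ ν u : ℂ) * (Complex.I * ν u)) u := by
  refine (h.smooth_curve.differentiable (by simp) u).hasDerivAt.congr_deriv ?_
  conv_lhs => rw [eq_frame (h.norm_normal u) (deriv γ u), h.legendre u]
  rw [beta, mu]
  push_cast
  ring

lemma hasDerivAt_normal (h : IsLegendre γ ν) (u : ℝ) :
    HasDerivAt ν ((ell ν u : ℂ) * (Complex.I * ν u)) u := by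
  have hd := (h.smooth_normal.differentiable (by simp) u).hasDerivAt
  have hz : inner ℝ (deriv ν u) (ν u) = (0 : ℝ) := by
    have h1 : HasDerivAt (fun x => inner ℝ (ν x) (ν x)) (0 : ℝ) u := by
      simp only [real_inner_self_eq_norm_sq, h.norm_normal]
      exact hasDerivAt_const u _
    have h2 := (hd.inner ℝ hd).unique h1
    rw [real_inner_comm] at h2
    linarith
  refine hd.congr_deriv ?_
  conv_lhs => rw [eq_frame (h.norm_normal u) (deriv ν u), hz]
  rw [ell, mu]
  push_cast
  ring

/-- The derivatives of the coordinates `⟨γ, ν⟩` and `⟨γ, μ⟩` of the curve in its frame. -/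
lemma hasDerivAt_support (h : IsLegendre γ ν) (u : ℝ) :
    HasDerivAt (fun x => (inner ℝ (γ x) (ν x) : ℝ)) (ell ν u * inner ℝ (γ u) (mu ν u)) u := by
  refine ((h.hasDerivAt_curve u).inner ℝ (h.hasDerivAt_normal u)).congr_deriv ?_
  simp [Complex.inner, mu]
  ring

lemma hasDerivAt_support_mu (h : IsLegendre γ ν) (u : ℝ) :
    HasDerivAt (fun x => (inner ℝ (γ x) (mu ν x) : ℝ))
      (beta γ ν u - ell ν u * inner ℝ (γ u) (ν u)) u := by
  have hm : HasDerivAt (mu ν) (Complex.I * ((ell ν u : ℂ) * (Complex.I * ν u))) u :=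
    (h.hasDerivAt_normal u).const_mul Complex.I
  refine ((h.hasDerivAt_curve u).inner ℝ hm).congr_deriv ?_
  have hz : (ν u).re * (ν u).re + (ν u).im * (ν u).im = 1 := by
    rw [← Complex.normSq_apply, Complex.normSq_eq_norm_sq, h.norm_normal u, one_pow]
  simp [Complex.inner, mu]
  linear_combination beta γ ν u * hz

end IsLegendre

/-- A vector rotating with angular speed `Φ'` has argument `Φ`, up to a constant. -/
lemma eq_mul_exp_of_hasDerivAt {ν : ℝ → ℂ} {Φ ℓ : ℝ → ℝ} {s : Set ℝ} (hs : Convex ℝ s)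
    (hν : ∀ u ∈ s, HasDerivWithinAt ν ((ℓ u : ℂ) * (Complex.I * ν u)) s u)
    (hΦ : ∀ u ∈ s, HasDerivWithinAt Φ (ℓ u) s u) {a b : ℝ} (ha : a ∈ s) (hb : b ∈ s) :
    ν b = ν a * Complex.exp (-(Φ a * Complex.I)) * Complex.exp (Φ b * Complex.I) := by
  have hd : ∀ u ∈ s, HasDerivWithinAt (fun u => ν u * Complex.exp (-(Φ u * Complex.I))) 0 s u := by
    intro u hu
    refine ((hν u hu).mul (((hΦ u hu).ofReal_comp.mul_const Complex.I).neg.cexp)).congr_deriv ?_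
    ring
  have := hs.norm_image_sub_le_of_norm_hasDerivWithin_le (C := 0) hd (by simp) ha hb
  rw [zero_mul, norm_le_zero_iff, sub_eq_zero] at this
  rw [← this, mul_assoc, ← Complex.exp_add, neg_add_cancel, Complex.exp_zero, mul_one]

/-! ### Solutions in terms of the heat equation and a change of variable -/

/-- The value of `β` in the parametrization with `ℓ = 1`. -/
def curvRadius (R : ℝ) (Q : ℕ → ℝ → ℝ → ℝ) (t x : ℝ) : ℝ := R + (Q 2 t x + Q 0 t x)

/-- The space derivative of `curvRadius`. -/
def curvRadiusDeriv (Q : ℕ → ℝ → ℝ → ℝ) (t x : ℝ) : ℝ := Q 3 t x + Q 1 t x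

/-- The support function `R + Re (κ exp (i x)) + Q 0 t x`. -/
def support (R : ℝ) (κ : ℂ) (Q : ℕ → ℝ → ℝ → ℝ) (t x : ℝ) : ℝ :=
  R + (κ * Complex.exp (x * Complex.I)).re + Q 0 t x

/-- The space derivative of `support`. -/
def supportDeriv (κ : ℂ) (Q : ℕ → ℝ → ℝ → ℝ) (t x : ℝ) : ℝ :=
  -(κ * Complex.exp (x * Complex.I)).im + Q 1 t x

/-- The curve with normal `w * exp (i x)` and support function `support R κ Q t`, reparametrized by
`x = Φ t u`. The mode of frequency one of the support function is a translation. -/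
def heatCurve (R : ℝ) (κ : ℂ) (Q : ℕ → ℝ → ℝ → ℝ) (w : ℂ) (Φ : ℝ → ℝ → ℝ) (t u : ℝ) : ℂ :=
  w * (starRingEnd ℂ) κ + (R + (Q 0 t (Φ t u) + Q 1 t (Φ t u) * Complex.I)) *
    (w * Complex.exp (Φ t u * Complex.I))

/-- The normal of `heatCurve`. -/
def heatNormal (w : ℂ) (Φ : ℝ → ℝ → ℝ) (t u : ℝ) : ℂ := w * Complex.exp (Φ t u * Complex.I)

lemma norm_heatNormal {w : ℂ} (hw : ‖w‖ = 1) (Φ : ℝ → ℝ → ℝ) (t u : ℝ) :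
    ‖heatNormal w Φ t u‖ = 1 := by
  rw [heatNormal, norm_mul, hw, Complex.norm_exp_ofReal_mul_I, one_mul]

/-- The mode of frequency one of the support function gives the constant term of `heatCurve`. -/
lemma heatCurve_eq_support (R : ℝ) (κ : ℂ) (Q : ℕ → ℝ → ℝ → ℝ) (w : ℂ) (Φ : ℝ → ℝ → ℝ)
    (t u : ℝ) : heatCurve R κ Q w Φ t u =
      (support R κ Q t (Φ t u) + supportDeriv κ Q t (Φ t u) * Complex.I) *
        heatNormal w Φ t u := by
  have h : (starRingEnd ℂ) (κ * Complex.exp (Φ t u * Complex.I)) * Complex.exp (Φ t u * Complex.I) =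
      (starRingEnd ℂ) κ := by
    rw [map_mul, ← Complex.exp_conj, mul_assoc, ← Complex.exp_add]
    simp
  have hz : ∀ z : ℂ, (starRingEnd ℂ) z = z.re - z.im * Complex.I := fun z => by
    apply Complex.ext <;> simp
  rw [hz] at h
  rw [heatCurve, heatNormal, support, supportDeriv, ← h]
  push_cast
  ring

lemma hasDerivAt_re_exp (κ : ℂ) (x : ℝ) :
    HasDerivAt (fun x : ℝ => (κ * Complex.exp (x * Complex.I)).re)
      (-(κ * Complex.exp (x * Complex.I)).im) x := by
  have h := (((Complex.ofRealCLM.hasDerivAt (x := x)).mul_const Complex.I).cexp).const_mul κ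
  refine (Complex.reCLM.hasFDerivAt.comp_hasDerivAt x h).congr_deriv ?_
  simp
  ring

lemma hasDerivAt_im_exp (κ : ℂ) (x : ℝ) :
    HasDerivAt (fun x : ℝ => (κ * Complex.exp (x * Complex.I)).im)
      (κ * Complex.exp (x * Complex.I)).re x := by
  have h := (((Complex.ofRealCLM.hasDerivAt (x := x)).mul_const Complex.I).cexp).const_mul κ
  refine (Complex.imCLM.hasFDerivAt.comp_hasDerivAt x h).congr_deriv ?_
  simp
  ring

namespace HeatData

variable {p₀ : ℝ → ℝ} {R : ℝ} {κ : ℂ} {Q : ℕ → ℝ → ℝ → ℝ}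

lemma contDiff_curvRadius (H : HeatData p₀ R κ Q) :
    ContDiff ℝ ∞ fun q : ℝ × ℝ => curvRadius R Q q.1 q.2 :=
  contDiff_const.add ((H.smooth 2).add (H.smooth 0))

lemma contDiff_curvRadiusDeriv (H : HeatData p₀ R κ Q) :
    ContDiff ℝ ∞ fun q : ℝ × ℝ => curvRadiusDeriv Q q.1 q.2 :=
  (H.smooth 3).add (H.smooth 1)

lemma contDiff_support (H : HeatData p₀ R κ Q) :
    ContDiff ℝ ∞ fun q : ℝ × ℝ => support R κ Q q.1 q.2 := by
  have h : ContDiff ℝ ∞ fun q : ℝ × ℝ => κ * Complex.exp (q.2 * Complex.I) :=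
    contDiff_const.mul (((Complex.ofRealCLM.contDiff.comp contDiff_snd).mul contDiff_const).cexp)
  exact (contDiff_const.add (Complex.reCLM.contDiff.comp h)).add (H.smooth 0)

lemma contDiff_supportDeriv (H : HeatData p₀ R κ Q) :
    ContDiff ℝ ∞ fun q : ℝ × ℝ => supportDeriv κ Q q.1 q.2 := by
  have h : ContDiff ℝ ∞ fun q : ℝ × ℝ => κ * Complex.exp (q.2 * Complex.I) :=
    contDiff_const.mul (((Complex.ofRealCLM.contDiff.comp contDiff_snd).mul contDiff_const).cexp)
  exact (Complex.imCLM.contDiff.comp h).neg.add (H.smooth 1)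

lemma hasDerivAt_support_space (H : HeatData p₀ R κ Q) (t x : ℝ) :
    HasDerivAt (support R κ Q t) (supportDeriv κ Q t x) x :=
  ((hasDerivAt_re_exp κ x).const_add R).add (H.hasDerivAt_space 0 t x)

lemma hasDerivAt_supportDeriv_space (H : HeatData p₀ R κ Q) (t x : ℝ) :
    HasDerivAt (supportDeriv κ Q t) (curvRadius R Q t x - support R κ Q t x) x := by
  refine ((hasDerivAt_im_exp κ x).neg.add (H.hasDerivAt_space 1 t x)).congr_deriv ?_
  rw [curvRadius, support]
  ring

lemma hasDerivAt_support_time (H : HeatData p₀ R κ Q) {t : ℝ} (ht : 0 ≤ t) (x : ℝ) :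
    HasDerivAt (fun s => support R κ Q s x) (curvRadius R Q t x - R) t := by
  refine ((H.hasDerivAt_time 0 t x ht).const_add _).congr_deriv ?_
  rw [curvRadius]
  ring

lemma hasDerivAt_curvRadius (H : HeatData p₀ R κ Q) (t x : ℝ) :
    HasDerivAt (curvRadius R Q t) (curvRadiusDeriv Q t x) x :=
  ((H.hasDerivAt_space 2 t x).add (H.hasDerivAt_space 0 t x)).const_add R

lemma periodic_curvRadius (H : HeatData p₀ R κ Q) (t : ℝ) :
    Function.Periodic (curvRadius R Q t) (2 * Real.pi) := fun x => by
  rw [curvRadius, curvRadius, H.periodic 2 t x, H.periodic 0 t x]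

lemma periodic_curvRadiusDeriv (H : HeatData p₀ R κ Q) (t : ℝ) :
    Function.Periodic (curvRadiusDeriv Q t) (2 * Real.pi) := fun x => by
  rw [curvRadiusDeriv, curvRadiusDeriv, H.periodic 3 t x, H.periodic 1 t x]

lemma continuous_slice (H : HeatData p₀ R κ Q) (k : ℕ) (t : ℝ) : Continuous (Q k t) :=
  (contDiff_slice (H.smooth k) t).continuous

lemma integral_curvRadius (H : HeatData p₀ R κ Q) (t a : ℝ) :
    ∫ x in a..(a + 2 * Real.pi), curvRadius R Q t x = 2 * Real.pi * R := by
  have h2 : ∫ x in (0 : ℝ)..(2 * Real.pi), Q 2 t x = 0 := by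
    rw [intervalIntegral.integral_eq_sub_of_hasDerivAt (fun x _ => H.hasDerivAt_space 1 t x)
      ((H.continuous_slice 2 t).intervalIntegrable _ _), ← zero_add (2 * Real.pi),
      H.periodic 1 t 0, sub_self]
  rw [(H.periodic_curvRadius t).intervalIntegral_add_eq a 0, zero_add]
  simp only [curvRadius]
  rw [intervalIntegral.integral_add (f := fun _ => R) (g := fun x => Q 2 t x + Q 0 t x) (by simp)
    (((H.continuous_slice 2 t).add (H.continuous_slice 0 t)).intervalIntegrable _ _),
    intervalIntegral.integral_add (f := Q 2 t) (g := Q 0 t)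
    ((H.continuous_slice 2 t).intervalIntegrable _ _)
    ((H.continuous_slice 0 t).intervalIntegrable _ _), h2, H.integral_eq_zero t]
  simp

lemma derivBdd (H : HeatData p₀ R κ Q) (j k : ℕ) : DerivBdd decayWeight k (Q j) :=
  DerivBdd.of_hasDerivAt_seq H.decay H.hasDerivAt_space j k

lemma derivBdd_curvRadiusDeriv (H : HeatData p₀ R κ Q) (k : ℕ) :
    DerivBdd decayWeight k (curvRadiusDeriv Q) :=
  (H.derivBdd 3 k).add (H.derivBdd 1 k)

lemma derivBdd_curvRadius (H : HeatData p₀ R κ Q) (k : ℕ) :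
    DerivBdd (fun _ => 1) k (curvRadius R Q) :=
  (DerivBdd.const R).add ((H.derivBdd 2 k).add (H.derivBdd 0 k)).bdd

section Curve

variable {w : ℂ} {Φ : ℝ → ℝ → ℝ}

lemma hasDerivAt_heatNormal {Ψ : ℝ → ℝ} {r x : ℝ} (hΨ : HasDerivAt Ψ r x) :
    HasDerivAt (fun x => w * Complex.exp (Ψ x * Complex.I))
      ((r : ℂ) * (Complex.I * (w * Complex.exp (Ψ x * Complex.I)))) x := by
  refine ((hΨ.ofReal_comp.mul_const Complex.I).cexp.const_mul w).congr_deriv ?_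
  ring

lemma hasDerivAt_heatCurve (H : HeatData p₀ R κ Q) {t u r : ℝ} (hΦ : HasDerivAt (Φ t) r u) :
    HasDerivAt (heatCurve R κ Q w Φ t)
      (((r * curvRadius R Q t (Φ t u) : ℝ) : ℂ) * (Complex.I * heatNormal w Φ t u)) u := by
  have h0 := ((H.hasDerivAt_space 0 t (Φ t u)).comp u hΦ).ofReal_comp
  have h1 := ((H.hasDerivAt_space 1 t (Φ t u)).comp u hΦ).ofReal_comp
  refine ((((h0.add (h1.mul_const Complex.I)).const_add (R : ℂ)).mul
    (hasDerivAt_heatNormal (w := w) hΦ)).const_add (w * (starRingEnd ℂ) κ)).congr_deriv ?_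
  rw [curvRadius, heatNormal]
  simp only [Pi.add_apply, Function.comp_apply]
  push_cast
  linear_combination (r * Q 1 t (Φ t u) * w * Complex.exp (Φ t u * Complex.I)) * Complex.I_sq

lemma hasDerivAt_heatCurve_time (H : HeatData p₀ R κ Q) {t u r : ℝ} (ht : 0 ≤ t)
    (hΦ : HasDerivAt (fun s => Φ s u) r t) :
    HasDerivAt (fun s => heatCurve R κ Q w Φ s u)
      (((curvRadiusDeriv Q t (Φ t u) + r * curvRadius R Q t (Φ t u) : ℝ) : ℂ) *
          (Complex.I * heatNormal w Φ t u) +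
        ((curvRadius R Q t (Φ t u) - R : ℝ) : ℂ) * heatNormal w Φ t u) t := by
  have hQ : ∀ k, HasDerivAt (fun s => Q k s (Φ s u))
      (Q (k + 2) t (Φ t u) + Q k t (Φ t u) + r • Q (k + 1) t (Φ t u)) t := fun k =>
    hasDerivAt_comp_graph (x := fun s => Φ s u) ((H.smooth k).differentiable (by simp) _)
      (H.hasDerivAt_time k t _ ht) (H.hasDerivAt_space k t _) hΦ
  refine (((((hQ 0).ofReal_comp.add ((hQ 1).ofReal_comp.mul_const Complex.I)).const_add
    (R : ℂ)).mul (hasDerivAt_heatNormal (w := w) hΦ)).const_add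
    (w * (starRingEnd ℂ) κ)).congr_deriv ?_
  rw [curvRadius, curvRadiusDeriv, heatNormal]
  simp only [Pi.add_apply, smul_eq_mul]
  push_cast
  linear_combination (r * Q 1 t (Φ t u) * w * Complex.exp (Φ t u * Complex.I)) * Complex.I_sq

end Curve

end HeatData

section Solution

variable {p₀ : ℝ → ℝ} {R : ℝ} {κ w : ℂ} {Q : ℕ → ℝ → ℝ → ℝ} {V V₁ : ℝ → ℝ → ℝ} {M K : NNReal}

lemma ell_heatNormal (hw : ‖w‖ = 1) (h : IsBoundedField V V₁ M K) (t u : ℝ) :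
    ell (heatNormal w h.flow t) u = h.stretch t u :=
  ell_eq (norm_heatNormal hw _ t u) (HeatData.hasDerivAt_heatNormal (h.hasDerivAt_flow_space t u))

lemma contDiff_heatNormal (h : IsBoundedField V V₁ M K) :
    ContDiff ℝ ∞ fun q : ℝ × ℝ => heatNormal w h.flow q.1 q.2 :=
  contDiff_const.mul (((Complex.ofRealCLM.contDiff.comp h.contDiff_flow).mul contDiff_const).cexp)

lemma exp_add_two_pi_mul_I (x : ℝ) : Complex.exp ((x + 2 * Real.pi : ℝ) * Complex.I) =
    Complex.exp (x * Complex.I) := by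
  rw [Complex.exp_eq_exp_iff_exists_int]
  exact ⟨1, by push_cast; ring⟩

namespace HeatData

lemma beta_heatCurve (H : HeatData p₀ R κ Q) (hw : ‖w‖ = 1) (h : IsBoundedField V V₁ M K)
    (t u : ℝ) : beta (heatCurve R κ Q w h.flow t) (heatNormal w h.flow t) u =
      h.stretch t u * curvRadius R Q t (h.flow t u) :=
  beta_eq (norm_heatNormal hw _ t u) (H.hasDerivAt_heatCurve (h.hasDerivAt_flow_space t u))

lemma algLength_heatCurve (H : HeatData p₀ R κ Q) (hw : ‖w‖ = 1) (h : IsBoundedField V V₁ M K)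
    (hV : ∀ t, Function.Periodic (V t) (2 * Real.pi)) (t : ℝ) :
    algLength (heatCurve R κ Q w h.flow t) (heatNormal w h.flow t) = 2 * Real.pi * R := by
  have hc : Continuous (curvRadius R Q t) := (contDiff_slice H.contDiff_curvRadius t).continuous
  have := intervalIntegral.integral_comp_mul_deriv (a := 0) (b := 2 * Real.pi)
    (f := h.flow t) (f' := h.stretch t) (g := curvRadius R Q t)
    (fun u _ => h.hasDerivAt_flow_space t u)
    (contDiff_slice h.contDiff_stretch t).continuous.continuousOn hc
  rw [algLength, ← H.integral_curvRadius t (h.flow t 0), ← h.flow_add_of_periodic hV, zero_add,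
    ← this]
  refine intervalIntegral.integral_congr fun u _ => ?_
  simp only [H.beta_heatCurve hw h, Function.comp_apply]
  ring

lemma speed_heatCurve (H : HeatData p₀ R κ Q) (hw : ‖w‖ = 1) (h : IsBoundedField V V₁ M K)
    (hV : ∀ t, Function.Periodic (V t) (2 * Real.pi)) (t : ℝ) :
    speed (heatCurve R κ Q w h.flow t) (heatNormal w h.flow t) =
      fun u => curvRadius R Q t (h.flow t u) - R := by
  funext u
  rw [speed, H.beta_heatCurve hw h, ell_heatNormal hw h, H.algLength_heatCurve hw h hV]
  have := (h.stretch_pos t u).ne'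
  have := Real.pi_ne_zero
  field_simp

lemma deriv_speed_heatCurve (H : HeatData p₀ R κ Q) (hw : ‖w‖ = 1) (h : IsBoundedField V V₁ M K)
    (hV : ∀ t, Function.Periodic (V t) (2 * Real.pi)) (t u : ℝ) :
    deriv (speed (heatCurve R κ Q w h.flow t) (heatNormal w h.flow t)) u =
      curvRadiusDeriv Q t (h.flow t u) * h.stretch t u := by
  rw [H.speed_heatCurve hw h hV]
  exact (((H.hasDerivAt_curvRadius t _).comp u (h.hasDerivAt_flow_space t u)).sub_const R).deriv

lemma contDiff_heatCurve (H : HeatData p₀ R κ Q) (h : IsBoundedField V V₁ M K) :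
    ContDiff ℝ ∞ fun q : ℝ × ℝ => heatCurve R κ Q w h.flow q.1 q.2 := by
  have hQ : ∀ k, ContDiff ℝ ∞ fun q : ℝ × ℝ => (Q k q.1 (h.flow q.1 q.2) : ℂ) := fun k =>
    Complex.ofRealCLM.contDiff.comp (h.contDiff_comp_flow (H.smooth k))
  exact contDiff_const.add ((contDiff_const.add ((hQ 0).add ((hQ 1).mul contDiff_const))).mul
    (contDiff_heatNormal h))

lemma isLegendre_heatCurve (H : HeatData p₀ R κ Q) (hw : ‖w‖ = 1) (h : IsBoundedField V V₁ M K)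
    (hV : ∀ t, Function.Periodic (V t) (2 * Real.pi)) (t : ℝ) :
    IsLegendre (heatCurve R κ Q w h.flow t) (heatNormal w h.flow t) where
  smooth_curve := contDiff_slice (H.contDiff_heatCurve h) t
  smooth_normal := contDiff_slice (contDiff_heatNormal h) t
  periodic_curve u := by
    simp only [heatCurve, h.flow_add_of_periodic hV, H.periodic 0 t _, H.periodic 1 t _,
      exp_add_two_pi_mul_I]
  periodic_normal u := by
    simp only [heatNormal, h.flow_add_of_periodic hV, exp_add_two_pi_mul_I]
  norm_normal := norm_heatNormal hw _ t
  legendre u := by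
    rw [(H.hasDerivAt_heatCurve (h.hasDerivAt_flow_space t u)).deriv]
    simp [Complex.inner]
    ring

lemma isEvolution_heatCurve (H : HeatData p₀ R κ Q) (hw : ‖w‖ = 1) (h : IsBoundedField V V₁ M K)
    (hV : ∀ t, Function.Periodic (V t) (2 * Real.pi)) :
    IsEvolution (heatCurve R κ Q w h.flow 0) (heatNormal w h.flow 0) (heatCurve R κ Q w h.flow)
      (heatNormal w h.flow) where
  smooth_curve := (H.contDiff_heatCurve h).contDiffOn
  smooth_normal := (contDiff_heatNormal h).contDiffOn
  legendre t _ := H.isLegendre_heatCurve hw h hV t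
  init_curve := rfl
  init_normal := rfl

/-- The angular speed `-β β' / (1 + β²)` of the normal under the original flow, as a function of
time and of the angle of the normal. The flow of this vector field is the change of variable that
turns solutions of the modified flow into solutions of the original one. -/
def field (R : ℝ) (Q : ℕ → ℝ → ℝ → ℝ) (t x : ℝ) : ℝ :=
  -(curvRadius R Q t x * curvRadiusDeriv Q t x / (1 + curvRadius R Q t x ^ 2))

lemma isFlow_heatCurve (H : HeatData p₀ R κ Q) (hw : ‖w‖ = 1)
    (h : IsBoundedField (field R Q) V₁ M K)
    (hV : ∀ t, Function.Periodic (field R Q t) (2 * Real.pi)) :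
    IsFlow (heatCurve R κ Q w h.flow 0) (heatNormal w h.flow 0) (heatCurve R κ Q w h.flow)
      (heatNormal w h.flow) where
  toIsEvolution := H.isEvolution_heatCurve hw h hV
  curve_eq t ht u := by
    refine ((H.hasDerivAt_heatCurve_time ht (h.hasDerivAt_flow_time t u)).congr_deriv
      ?_).hasDerivWithinAt
    rw [ell_heatNormal hw h, H.beta_heatCurve hw h, H.deriv_speed_heatCurve hw h hV,
      H.speed_heatCurve hw h hV]
    have h1 := (h.stretch_pos t u).ne'
    rw [mu, field]
    congr 3
    field_simp
    ring
  normal_eq t ht u := by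
    refine ((hasDerivAt_heatNormal (w := w) (h.hasDerivAt_flow_time t u)).congr_deriv
      ?_).hasDerivWithinAt
    rw [ell_heatNormal hw h, H.beta_heatCurve hw h, H.deriv_speed_heatCurve hw h hV]
    have h1 := (h.stretch_pos t u).ne'
    rw [mu, heatNormal, field, ← Complex.ofReal_neg]
    congr 2
    field_simp

lemma isModifiedFlow_heatCurve (H : HeatData p₀ R κ Q) (hw : ‖w‖ = 1)
    (h : IsBoundedField (fun _ _ => 0) V₁ M K) :
    IsModifiedFlow (heatCurve R κ Q w h.flow 0) (heatNormal w h.flow 0)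
      (heatCurve R κ Q w h.flow) (heatNormal w h.flow) where
  toIsEvolution := H.isEvolution_heatCurve hw h fun _ _ => rfl
  curve_eq t ht u := by
    refine ((H.hasDerivAt_heatCurve_time ht (h.hasDerivAt_flow_time t u)).congr_deriv
      ?_).hasDerivWithinAt
    rw [ell_heatNormal hw h, H.deriv_speed_heatCurve hw h fun _ _ => rfl,
      H.speed_heatCurve hw h fun _ _ => rfl]
    have h1 := (h.stretch_pos t u).ne'
    rw [mu]
    congr 3
    field_simp
    ring
  normal_eq t ht u := by
    refine ((hasDerivAt_heatNormal (w := w) (h.hasDerivAt_flow_time t u)).congr_deriv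
      ?_).hasDerivWithinAt
    simp

/-! ### Convergence -/

lemma derivBdd_field (H : HeatData p₀ R κ Q) (k : ℕ) : DerivBdd decayWeight k (field R Q) := by
  have hinv : DerivBdd (fun _ => 1) k fun t u => (1 + curvRadius R Q t u ^ 2)⁻¹ :=
    (DerivBdd.inv_one_add_sq (H.derivBdd_curvRadius (k + 1))).of_succ
  have h := (((H.derivBdd_curvRadiusDeriv k).mul (H.derivBdd_curvRadius k)).mul hinv).mul
    (DerivBdd.const (-1 : ℝ))
  have he : field R Q = fun t u => curvRadiusDeriv Q t u * curvRadius R Q t u *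
      (1 + curvRadius R Q t u ^ 2)⁻¹ * -1 := by
    funext t u
    rw [field]
    ring
  rw [he]
  exact h

lemma contDiff_field (H : HeatData p₀ R κ Q) :
    ContDiff ℝ ∞ fun q : ℝ × ℝ => field R Q q.1 q.2 :=
  ((H.contDiff_curvRadius.mul H.contDiff_curvRadiusDeriv).div
    (contDiff_const.add (H.contDiff_curvRadius.pow 2)) fun q => by positivity).neg

lemma periodic_field (H : HeatData p₀ R κ Q) (t : ℝ) :
    Function.Periodic (field R Q t) (2 * Real.pi) := fun x => by
  simp only [field, H.periodic_curvRadius t _, H.periodic_curvRadiusDeriv t _]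

lemma exists_isBoundedField (H : HeatData p₀ R κ Q) :
    ∃ V₁ M K, IsBoundedField (field R Q) V₁ M K := by
  have hd := fun t x => (contDiff_slice H.contDiff_field t).differentiable (by simp) x
  obtain ⟨C, hC⟩ := (H.derivBdd_field 1).bdd.bound
  obtain ⟨D, hD⟩ := (H.derivBdd_field 1).bdd.2.2.bound
  refine ⟨fun t => deriv (field R Q t), C.toNNReal, D.toNNReal, H.contDiff_field,
    contDiff_deriv_space H.contDiff_field, fun t x => (hd t x).hasDerivAt, fun t x => ?_,
    fun t x => ?_⟩
  · exact (hC t x).trans (by simp)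
  · exact (hD t x).trans (by simp)

lemma derivBdd_heatNormal (hw : ‖w‖ = 1) (h : IsBoundedField V V₁ M K)
    (hV : ∀ k, DerivBdd decayWeight k V) (k : ℕ) :
    DerivBdd (fun _ => 1) k (heatNormal w h.flow) := by
  refine DerivBdd.of_linear (b := fun t u => (h.stretch t u : ℂ) * Complex.I)
    ⟨1, fun t u => by rw [norm_heatNormal hw, mul_one]⟩ (fun t u => ?_) fun j _ => ?_
  · rw [mul_assoc]
    exact hasDerivAt_heatNormal (h.hasDerivAt_flow_space t u)
  · exact ((h.derivBdd_stretch hV j).clm_comp Complex.ofRealCLM).mul (DerivBdd.const Complex.I)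

/-- The normal converges to `w * exp (i φ)`, with `φ` the limit of the flow; the constant `w` is
absorbed into `φ`. -/
lemma exists_tendstoSmooth_heatNormal (hw : ‖w‖ = 1) (h : IsBoundedField V V₁ M K)
    (hV : ∀ k, DerivBdd decayWeight k V) (hper : ∀ t, Function.Periodic (V t) (2 * Real.pi)) :
    ∃ φ : ℝ → ℝ, ContDiff ℝ ∞ φ ∧ (∀ u, 0 < deriv φ u) ∧
      (∀ u, φ (u + 2 * Real.pi) = φ u + 2 * Real.pi) ∧
      TendstoSmooth (heatNormal w h.flow) fun u => Complex.exp (φ u * Complex.I) := by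
  obtain ⟨φ, hφ, hpos, hlim⟩ := h.exists_flow_limit hV
  obtain ⟨g, -, hg⟩ := exists_limit_smooth (contDiff_heatNormal (w := w) h)
    (f' := fun t u => (V t (h.flow t u) : ℂ) * (Complex.I * heatNormal w h.flow t u))
    ((Complex.ofRealCLM.contDiff.comp (h.contDiff_comp_flow h.smooth)).mul
      (contDiff_const.mul (contDiff_heatNormal h)))
    (fun t u => hasDerivAt_heatNormal (h.hasDerivAt_flow_time t u))
    (fun k => ((h.derivBdd_comp_flow hV hV k).clm_comp Complex.ofRealCLM).mul
      ((DerivBdd.const Complex.I).mul (derivBdd_heatNormal hw h hV k)))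
  have hw' : w = Complex.exp (w.arg * Complex.I) := by
    have := Complex.norm_mul_exp_arg_mul_I w
    rw [hw] at this
    simpa using this.symm
  refine ⟨fun u => φ u + w.arg, hφ.add contDiff_const, fun u => by simpa using hpos u,
    fun u => ?_, ?_⟩
  · have h1 := hlim (u + 2 * Real.pi)
    simp only [h.flow_add_of_periodic hper] at h1
    have := tendsto_nhds_unique h1 ((hlim u).add_const _)
    simp only [this]
    ring
  · have hgφ : g = fun u => Complex.exp ((φ u + w.arg : ℝ) * Complex.I) := by
      funext u
      have h1 : Tendsto (fun t => heatNormal w h.flow t u) atTop (𝓝 (g u)) := by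
        simpa using (hg 0).tendsto_at u
      have hcont : Continuous fun x : ℝ => w * Complex.exp (x * Complex.I) := by fun_prop
      have h2 := (hcont.tendsto (φ u)).comp (hlim u)
      rw [tendsto_nhds_unique h1 h2]
      nth_rewrite 1 [hw']
      rw [← Complex.exp_add]
      congr 1
      push_cast
      ring
    rw [← hgφ]
    exact hg

/-- The curve is `R` times its normal, up to a constant and a term that decays in `C^∞`. -/
theorem convergesToCircle_heatCurve (H : HeatData p₀ R κ Q) (hw : ‖w‖ = 1)
    (h : IsBoundedField V V₁ M K) (hV : ∀ k, DerivBdd decayWeight k V)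
    (hper : ∀ t, Function.Periodic (V t) (2 * Real.pi)) :
    ConvergesToCircle (heatCurve R κ Q w h.flow) (heatNormal w h.flow)
      (w * (starRingEnd ℂ) κ) R := by
  obtain ⟨φ, hφ, hpos, hadd, hlim⟩ := exists_tendstoSmooth_heatNormal hw h hV hper
  refine ⟨φ, hφ, hpos, hadd, fun k => ?_, hlim⟩
  let e : ℝ → ℝ → ℂ := fun t u =>
    (Q 0 t (h.flow t u) + Q 1 t (h.flow t u) * Complex.I) * heatNormal w h.flow t u
  have he : DerivBdd decayWeight k e := by
    have hq : ∀ j, DerivBdd decayWeight k fun t u => (Q j t (h.flow t u) : ℂ) := fun j =>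
      (h.derivBdd_comp_flow hV (H.derivBdd j) k).clm_comp Complex.ofRealCLM
    exact ((hq 0).add ((hq 1).mul (DerivBdd.const Complex.I))).mul (derivBdd_heatNormal hw h hV k)
  have hν : ∀ t, ContDiff ℝ ∞ (heatNormal w h.flow t) := contDiff_slice (contDiff_heatNormal h)
  have hes : ∀ t, ContDiff ℝ ∞ (e t) := by
    have hq : ∀ j t, ContDiff ℝ ∞ fun u => (Q j t (h.flow t u) : ℂ) := fun j t =>
      Complex.ofRealCLM.contDiff.comp
        (contDiff_slice (f := fun t u => Q j t (h.flow t u)) (h.contDiff_comp_flow (H.smooth j)) t)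
    exact fun t => ((hq 0 t).add ((hq 1 t).mul contDiff_const)).mul (hν t)
  have hk : ∀ f : ℝ → ℂ, ContDiff ℝ ∞ f → ∀ u, ContDiffAt ℝ k f u := fun f hf u =>
    (hf.of_le (by norm_cast; exact le_top)).contDiffAt
  have hcirc : ∀ f : ℝ → ℂ, ContDiff ℝ ∞ f → ∀ u,
      iteratedDeriv k (fun u => w * (starRingEnd ℂ) κ + (R : ℂ) * f u) u =
        iteratedDeriv k (fun _ : ℝ => w * (starRingEnd ℂ) κ) u + (R : ℂ) * iteratedDeriv k f u := by
    intro f hf u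
    rw [iteratedDeriv_fun_add (hk _ contDiff_const u) (hk _ (contDiff_const.mul hf) u),
      iteratedDeriv_const_mul_field (R : ℂ) f]
  have hexp : ContDiff ℝ ∞ fun u => Complex.exp ((φ u : ℂ) * Complex.I) :=
    ((Complex.ofRealCLM.contDiff.comp hφ).mul contDiff_const).cexp
  have hγ : ∀ t u, iteratedDeriv k (heatCurve R κ Q w h.flow t) u =
      iteratedDeriv k (fun _ : ℝ => w * (starRingEnd ℂ) κ) u +
        (R : ℂ) * iteratedDeriv k (heatNormal w h.flow t) u + iteratedDeriv k (e t) u := by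
    intro t u
    rw [← hcirc _ (hν t) u, ← iteratedDeriv_fun_add
      (hk _ (contDiff_const.add (contDiff_const.mul (hν t))) u) (hk _ (hes t) u)]
    congr 1
    funext x
    simp only [heatCurve, heatNormal, e]
    ring
  obtain ⟨C, hC⟩ := he.norm_iteratedDeriv_le
  have he0 : TendstoUniformly (fun t => iteratedDeriv k (e t)) (fun _ => 0) atTop := by
    have h0 : Tendsto (fun t : ℝ => C * Real.exp (-(3 * t))) atTop (𝓝 0) := by
      simpa using tendsto_exp_neg_three_mul.const_mul C
    refine Metric.tendstoUniformly_iff.2 fun ε hε => ?_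
    filter_upwards [h0.eventually (gt_mem_nhds hε), eventually_ge_atTop 0] with t ht ht0 u
    rw [dist_zero_left]
    refine (hC t u).trans_lt ?_
    rwa [decayWeight, abs_of_nonneg ht0]
  have hRν : TendstoUniformly (fun t u => (R : ℂ) * iteratedDeriv k (heatNormal w h.flow t) u)
      (fun u => (R : ℂ) * iteratedDeriv k (fun u => Complex.exp ((φ u : ℂ) * Complex.I)) u)
      atTop :=
    (uniformContinuous_const_smul (R : ℂ)).comp_tendstoUniformly (hlim k)
  have hsum := (hRν.add he0)
  refine Metric.tendstoUniformly_iff.2 fun ε hε => ?_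
  filter_upwards [Metric.tendstoUniformly_iff.1 hsum ε hε] with t ht u
  have := ht u
  rw [hγ, hcirc _ hexp, add_assoc, dist_add_left]
  simpa using this

end HeatData

end Solution

/-! ### Functions smooth up to the boundary of the half plane `t ≥ 0` -/

section HalfPlane

/-- The domain `t ≥ 0` of the evolutions. -/
def halfPlane : Set (ℝ × ℝ) := Ici 0 ×ˢ univ

lemma mem_halfPlane {t : ℝ} (ht : 0 ≤ t) (u : ℝ) : (t, u) ∈ halfPlane := ⟨ht, mem_univ u⟩

lemma continuous_extend {E : Type*} [TopologicalSpace E] {g : ℝ × ℝ → E}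
    (hg : ContinuousOn g halfPlane) :
    Continuous fun q : ℝ × ℝ => g (max q.1 0, q.2) :=
  hg.comp_continuous (by fun_prop) fun q => mem_halfPlane (le_max_right _ _) _

lemma uniqueDiffOn_halfPlane : UniqueDiffOn ℝ halfPlane :=
  (uniqueDiffOn_Ici 0).prod uniqueDiffOn_univ

variable {E : Type*} [NormedAddCommGroup E] [NormedSpace ℝ E] {F : ℝ → ℝ → E}

lemma contDiffOn_deriv_space (hF : ContDiffOn ℝ ∞ (fun q : ℝ × ℝ => F q.1 q.2) halfPlane) :
    ContDiffOn ℝ ∞ (fun q : ℝ × ℝ => deriv (F q.1) q.2) halfPlane := by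
  have h := (hF.fderivWithin uniqueDiffOn_halfPlane (m := ∞) (by norm_cast)).clm_apply
    (contDiffOn_const (c := ((0, 1) : ℝ × ℝ)))
  refine h.congr fun q hq => ?_
  have hd := (hF.differentiableOn (by simp) q hq).hasFDerivWithinAt
  have h1 : HasDerivWithinAt (fun x : ℝ => (q.1, x)) (0, 1) univ q.2 :=
    ((hasDerivAt_const q.2 q.1).prodMk (hasDerivAt_id q.2)).hasDerivWithinAt
  have h2 := hd.comp_hasDerivWithinAt q.2 (t := halfPlane) h1 fun x _ => mem_halfPlane hq.1 x
  exact (h2.hasDerivAt univ_mem).deriv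

lemma contDiffOn_deriv_time {F₁ : ℝ → ℝ → E}
    (hF : ContDiffOn ℝ ∞ (fun q : ℝ × ℝ => F q.1 q.2) halfPlane)
    (h₁ : ∀ t, 0 ≤ t → ∀ u, HasDerivWithinAt (fun s => F s u) (F₁ t u) (Ici 0) t) :
    ContDiffOn ℝ ∞ (fun q : ℝ × ℝ => F₁ q.1 q.2) halfPlane := by
  have h := (hF.fderivWithin uniqueDiffOn_halfPlane (m := ∞) (by norm_cast)).clm_apply
    (contDiffOn_const (c := ((1, 0) : ℝ × ℝ)))
  refine h.congr fun q hq => ?_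
  have hd := (hF.differentiableOn (by simp) q hq).hasFDerivWithinAt
  have h1 : HasDerivWithinAt (fun s : ℝ => (s, q.2)) (1, 0) (Ici 0) q.1 :=
    ((hasDerivAt_id q.1).prodMk (hasDerivAt_const q.1 q.2)).hasDerivWithinAt
  have h2 := hd.comp_hasDerivWithinAt q.1 (t := halfPlane) h1 fun s hs => mem_halfPlane hs q.2
  exact (uniqueDiffOn_Ici 0 q.1 hq.1).eq_deriv _ (h₁ q.1 hq.1 q.2) h2

end HalfPlane

/-! ### The angle of the normal of a solution -/

/-- A family of closed Legendre curves whose normal rotates with angular speed `a`, and whose points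
move with speed `f` in the direction of the normal and `b` in the direction of `μ`. -/
structure IsFrameFlow (γ₀ ν₀ : ℝ → ℂ) (γ ν : ℝ → ℝ → ℂ) (a b : ℝ → ℝ → ℝ) : Prop
    extends IsEvolution γ₀ ν₀ γ ν where
  curve_eq : ∀ t, 0 ≤ t → ∀ u, HasDerivWithinAt (fun s => γ s u)
    ((b t u : ℂ) * mu (ν t) u + ((speed (γ t) (ν t) u : ℝ) : ℂ) * ν t u) (Ici 0) t
  normal_eq : ∀ t, 0 ≤ t → ∀ u, HasDerivWithinAt (fun s => ν s u)
    ((a t u : ℂ) * mu (ν t) u) (Ici 0) t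

/-- The angle of the normal, as a function of time and of the angle at time `0`, if the normal
rotates with angular speed `a`. Only the values of `a` for nonnegative times matter. -/
def angle (a : ℝ → ℝ → ℝ) (t u : ℝ) : ℝ := u + ∫ s in (0 : ℝ)..t, a (max s 0) u

namespace IsLegendre

variable {γ ν : ℝ → ℂ}

lemma periodic_ell (h : IsLegendre γ ν) : Function.Periodic (ell ν) (2 * Real.pi) := fun u => by
  rw [ell, ell, mu, mu, periodic_deriv h.periodic_normal u, h.periodic_normal u]

lemma continuous_ell (h : IsLegendre γ ν) : Continuous (ell ν) :=
  (h.smooth_normal.continuous_deriv (by simp)).inner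
    (continuous_const.mul h.smooth_normal.continuous)

lemma continuous_beta (h : IsLegendre γ ν) : Continuous (beta γ ν) :=
  (h.smooth_curve.continuous_deriv (by simp)).inner
    (continuous_const.mul h.smooth_normal.continuous)

lemma periodic_beta (h : IsLegendre γ ν) : Function.Periodic (beta γ ν) (2 * Real.pi) := fun u => by
  rw [beta, beta, mu, mu, periodic_deriv h.periodic_curve u, h.periodic_normal u]

lemma normal_eq_exp (h : IsLegendre γ ν) (hℓ : ∀ u, ell ν u = 1) (u : ℝ) :
    ν u = ν 0 * Complex.exp (u * Complex.I) := by
  have := eq_mul_exp_of_hasDerivAt (ν := ν) (Φ := fun x => x) (ℓ := ell ν) convex_univ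
    (fun x _ => (h.hasDerivAt_normal x).hasDerivWithinAt)
    (fun x _ => by rw [hℓ]; exact hasDerivWithinAt_id x _) (mem_univ 0) (mem_univ u)
  simpa using this

end IsLegendre

namespace IsFrameFlow

variable {γ₀ ν₀ : ℝ → ℂ} {γ ν : ℝ → ℝ → ℂ} {a b : ℝ → ℝ → ℝ}

lemma contDiffOn_mu (h : IsFrameFlow γ₀ ν₀ γ ν a b) :
    ContDiffOn ℝ ∞ (fun q : ℝ × ℝ => mu (ν q.1) q.2) halfPlane :=
  contDiffOn_const.mul h.smooth_normal

lemma norm_mu (h : IsFrameFlow γ₀ ν₀ γ ν a b) {t : ℝ} (ht : 0 ≤ t) (u : ℝ) :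
    ‖mu (ν t) u‖ = 1 := by
  rw [mu, norm_mul, Complex.norm_I, (h.legendre t ht).norm_normal, one_mul]

/-- The angular speed is smooth, being `⟨∂ₜ ν, μ⟩`. -/
lemma contDiffOn_rotation (h : IsFrameFlow γ₀ ν₀ γ ν a b) :
    ContDiffOn ℝ ∞ (fun q : ℝ × ℝ => a q.1 q.2) halfPlane := by
  have h1 := contDiffOn_deriv_time h.smooth_normal h.normal_eq
  refine (h1.inner ℝ h.contDiffOn_mu).congr fun q hq => ?_
  exact (inner_I_mul_self ((h.legendre q.1 hq.1).norm_normal q.2) _).symm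

lemma contDiffOn_ell (h : IsFrameFlow γ₀ ν₀ γ ν a b) :
    ContDiffOn ℝ ∞ (fun q : ℝ × ℝ => ell (ν q.1) q.2) halfPlane :=
  (contDiffOn_deriv_space h.smooth_normal).inner ℝ h.contDiffOn_mu

lemma contDiffOn_support (h : IsFrameFlow γ₀ ν₀ γ ν a b) :
    ContDiffOn ℝ ∞ (fun q : ℝ × ℝ => (inner ℝ (γ q.1 q.2) (ν q.1 q.2) : ℝ)) halfPlane :=
  h.smooth_curve.inner ℝ h.smooth_normal

lemma periodic_rotation (h : IsFrameFlow γ₀ ν₀ γ ν a b) {t : ℝ} (ht : 0 ≤ t) :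
    Function.Periodic (a t) (2 * Real.pi) := by
  intro u
  have h1 : HasDerivWithinAt (fun s => ν s u) ((a t (u + 2 * Real.pi) : ℂ) * mu (ν t) u)
      (Ici 0) t := by
    have := h.normal_eq t ht (u + 2 * Real.pi)
    rw [mu, (h.legendre t ht).periodic_normal u] at this
    exact this.congr (fun s hs => ((h.legendre s hs).periodic_normal u).symm)
      ((h.legendre t ht).periodic_normal u).symm
  have h2 := (uniqueDiffOn_Ici 0 t ht).eq_deriv _ h1 (h.normal_eq t ht u)
  have hne : mu (ν t) u ≠ 0 := norm_ne_zero_iff.1 (by rw [h.norm_mu ht]; exact one_ne_zero)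
  exact_mod_cast mul_right_cancel₀ hne h2

lemma continuous_rotation (h : IsFrameFlow γ₀ ν₀ γ ν a b) :
    Continuous fun q : ℝ × ℝ => a (max q.1 0) q.2 :=
  continuous_extend h.contDiffOn_rotation.continuousOn

lemma continuous_rotation_deriv (h : IsFrameFlow γ₀ ν₀ γ ν a b) :
    Continuous fun q : ℝ × ℝ => deriv (a (max q.1 0)) q.2 :=
  continuous_extend (contDiffOn_deriv_space h.contDiffOn_rotation).continuousOn

lemma hasDerivAt_rotation (h : IsFrameFlow γ₀ ν₀ γ ν a b) {t : ℝ} (ht : 0 ≤ t) (u : ℝ) :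
    HasDerivAt (a t) (deriv (a t) u) u := by
  have : ContDiffOn ℝ ∞ (a t) univ := h.contDiffOn_rotation.comp
    (contDiff_prodMk_right t).contDiffOn fun x _ => mem_halfPlane ht x
  exact ((contDiffOn_univ.1 this).differentiable (by simp) u).hasDerivAt

lemma angle_zero (u : ℝ) : angle a 0 u = u := by simp [angle]

lemma hasDerivAt_angle_time (h : IsFrameFlow γ₀ ν₀ γ ν a b) {t : ℝ} (ht : 0 ≤ t) (u : ℝ) :
    HasDerivAt (fun s => angle a s u) (a t u) t := by
  have := (h.continuous_rotation.comp (Continuous.prodMk_left u)).integral_hasStrictDerivAt 0 t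
  refine (this.hasDerivAt.const_add u).congr_deriv ?_
  simp [max_eq_left ht]

lemma continuous_angle (h : IsFrameFlow γ₀ ν₀ γ ν a b) :
    Continuous fun q : ℝ × ℝ => angle a q.1 q.2 :=
  continuous_snd.add (continuous_integral_zero (F := fun s u => a (max s 0) u)
    h.continuous_rotation)

lemma angle_add_two_pi (h : IsFrameFlow γ₀ ν₀ γ ν a b) (t u : ℝ) :
    angle a t (u + 2 * Real.pi) = angle a t u + 2 * Real.pi := by
  simp only [angle, h.periodic_rotation (le_max_right _ _) u]
  ring

lemma normal_eq_exp (h : IsFrameFlow γ₀ ν₀ γ ν a b) (hℓ : ∀ u, ell ν₀ u = 1) {t : ℝ} (ht : 0 ≤ t)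
    (u : ℝ) : ν t u = ν₀ 0 * Complex.exp (angle a t u * Complex.I) := by
  have h0 : IsLegendre (γ 0) (ν 0) := h.legendre 0 le_rfl
  have h1 : ν₀ u = ν₀ 0 * Complex.exp (u * Complex.I) := by
    rw [h.init_normal] at h0
    exact h0.normal_eq_exp hℓ u
  have := eq_mul_exp_of_hasDerivAt (ν := fun s => ν s u) (Φ := fun s => angle a s u)
    (ℓ := fun s => a s u) (convex_Ici 0) (fun s hs => h.normal_eq s hs u)
    (fun s hs => (h.hasDerivAt_angle_time hs u).hasDerivWithinAt) (mem_Ici.2 le_rfl)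
    (mem_Ici.2 ht)
  rw [this, h.init_normal, angle_zero, h1, mul_assoc (ν₀ 0), ← Complex.exp_add, add_neg_cancel,
    Complex.exp_zero, mul_one]

/-- `ℓ` is the space derivative of the angle; exchanging it with the time integral gives a formula
from which the time derivative of `ℓ` can be read off. -/
lemma ell_eq_integral (h : IsFrameFlow γ₀ ν₀ γ ν a b) (hℓ : ∀ u, ell ν₀ u = 1) {t : ℝ}
    (ht : 0 ≤ t) (u : ℝ) : HasDerivAt (angle a t) (ell (ν t) u) u ∧
      ell (ν t) u = 1 + ∫ s in (0 : ℝ)..t, deriv (a (max s 0)) u := by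
  have h1 : HasDerivAt (angle a t) (1 + ∫ s in (0 : ℝ)..t, deriv (a (max s 0)) u) u := by
    refine (hasDerivAt_id u).add (hasDerivAt_integral_of_continuousOn
      (F := fun u s => a (max s 0) u) (F' := fun u s => deriv (a (max s 0)) u) (s := univ)
      isOpen_univ (mem_univ u) (fun x _ => ?_) ?_
      fun x _ r _ => h.hasDerivAt_rotation (le_max_right _ _) x)
    · exact (h.continuous_rotation.comp (Continuous.prodMk_left x)).continuousOn
    · exact (h.continuous_rotation_deriv.comp
        (continuous_snd.prodMk continuous_fst)).continuousOn
  have h2 := HeatData.hasDerivAt_heatNormal (w := ν₀ 0) h1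
  simp only [← h.normal_eq_exp hℓ ht] at h2
  have h3 := ell_eq ((h.legendre t ht).norm_normal u) h2
  rw [← h3] at h1
  exact ⟨h1, h3⟩

lemma hasDerivAt_angle_space (h : IsFrameFlow γ₀ ν₀ γ ν a b) (hℓ : ∀ u, ell ν₀ u = 1) {t : ℝ}
    (ht : 0 ≤ t) (u : ℝ) : HasDerivAt (angle a t) (ell (ν t) u) u :=
  (h.ell_eq_integral hℓ ht u).1

lemma hasDerivAt_ell_time (h : IsFrameFlow γ₀ ν₀ γ ν a b) (hℓ : ∀ u, ell ν₀ u = 1) {t : ℝ}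
    (ht : 0 < t) (u : ℝ) : HasDerivAt (fun s => ell (ν s) u) (deriv (a t) u) t := by
  have h1 := (h.continuous_rotation_deriv.comp
    (Continuous.prodMk_left u)).integral_hasStrictDerivAt 0 t
  have h2 := (h1.hasDerivAt.const_add 1).congr_of_eventuallyEq
    ((lt_mem_nhds ht).mono fun s hs => (h.ell_eq_integral hℓ (le_of_lt hs) u).2)
  refine h2.congr_deriv ?_
  simp [max_eq_left ht.le]

lemma hasDerivWithinAt_support_time (h : IsFrameFlow γ₀ ν₀ γ ν a b) {t : ℝ} (ht : 0 ≤ t) (u : ℝ) :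
    HasDerivWithinAt (fun s => (inner ℝ (γ s u) (ν s u) : ℝ))
      (speed (γ t) (ν t) u + a t u * inner ℝ (γ t u) (mu (ν t) u)) (Ici 0) t := by
  refine ((h.curve_eq t ht u).inner ℝ (h.normal_eq t ht u)).congr_deriv ?_
  have hz : (ν t u).re * (ν t u).re + (ν t u).im * (ν t u).im = 1 := by
    rw [← Complex.normSq_apply, Complex.normSq_eq_norm_sq, (h.legendre t ht).norm_normal u, one_pow]
  simp [Complex.inner, mu]
  linear_combination speed (γ t) (ν t) u * hz

end IsFrameFlow

/-! ### The energy of the error of the support function -/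

lemma integral_deriv_of_periodic {f f' : ℝ → ℝ} {T : ℝ} (hd : ∀ x, HasDerivAt f (f' x) x)
    (hc : Continuous f') (hp : Function.Periodic f T) (x₀ : ℝ) :
    ∫ x in x₀..(x₀ + T), f' x = 0 := by
  rw [intervalIntegral.integral_eq_sub_of_hasDerivAt (fun x _ => hd x) (hc.intervalIntegrable _ _),
    hp x₀, sub_self]

/-- The error of the support function of `(γ, ν)` with respect to `support R κ Q`, compared at the
same angle of the normal. -/
def supportError (R : ℝ) (κ : ℂ) (Q : ℕ → ℝ → ℝ → ℝ) (a : ℝ → ℝ → ℝ) (γ ν : ℝ → ℝ → ℂ)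
    (t u : ℝ) : ℝ :=
  inner ℝ (γ t u) (ν t u) - support R κ Q t (angle a t u)

/-- The error of the coordinate `⟨γ, μ⟩`, which is `ℓ⁻¹` times the derivative of `supportError`. -/
def supportDerivError (κ : ℂ) (Q : ℕ → ℝ → ℝ → ℝ) (a : ℝ → ℝ → ℝ) (γ ν : ℝ → ℝ → ℂ)
    (t u : ℝ) : ℝ :=
  inner ℝ (γ t u) (mu (ν t) u) - supportDeriv κ Q t (angle a t u)

namespace IsFrameFlow

variable {γ₀ ν₀ : ℝ → ℂ} {γ ν : ℝ → ℝ → ℂ} {a b : ℝ → ℝ → ℝ} {p₀ : ℝ → ℝ} {R : ℝ} {κ : ℂ}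
  {Q : ℕ → ℝ → ℝ → ℝ}

lemma hasDerivAt_supportError (h : IsFrameFlow γ₀ ν₀ γ ν a b) (hℓ : ∀ u, ell ν₀ u = 1)
    (H : HeatData p₀ R κ Q) {t : ℝ} (ht : 0 ≤ t) (u : ℝ) :
    HasDerivAt (supportError R κ Q a γ ν t)
      (ell (ν t) u * supportDerivError κ Q a γ ν t u) u := by
  refine (((h.legendre t ht).hasDerivAt_support u).sub ((H.hasDerivAt_support_space t _).comp u
    (h.hasDerivAt_angle_space hℓ ht u))).congr_deriv ?_
  rw [supportDerivError]
  ring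

lemma hasDerivAt_supportDerivError (h : IsFrameFlow γ₀ ν₀ γ ν a b) (hℓ : ∀ u, ell ν₀ u = 1)
    (H : HeatData p₀ R κ Q) {t : ℝ} (ht : 0 ≤ t) (u : ℝ) :
    HasDerivAt (supportDerivError κ Q a γ ν t)
      (beta (γ t) (ν t) u - ell (ν t) u * curvRadius R Q t (angle a t u) -
        ell (ν t) u * supportError R κ Q a γ ν t u) u := by
  refine (((h.legendre t ht).hasDerivAt_support_mu u).sub
    ((H.hasDerivAt_supportDeriv_space t _).comp u
    (h.hasDerivAt_angle_space hℓ ht u))).congr_deriv ?_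
  rw [supportError]
  ring

lemma hasDerivAt_supportError_time (h : IsFrameFlow γ₀ ν₀ γ ν a b)
    (H : HeatData p₀ R κ Q) {t : ℝ} (ht : 0 < t) (u : ℝ) :
    HasDerivAt (fun s => supportError R κ Q a γ ν s u)
      (speed (γ t) (ν t) u + a t u * inner ℝ (γ t u) (mu (ν t) u) -
        (curvRadius R Q t (angle a t u) - R + a t u * supportDeriv κ Q t (angle a t u))) t :=
  ((h.hasDerivWithinAt_support_time ht.le u).hasDerivAt (Ici_mem_nhds ht)).sub
    (hasDerivAt_comp_graph (x := fun s => angle a s u)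
      (H.contDiff_support.differentiable (by simp) _) (H.hasDerivAt_support_time ht.le _)
      (H.hasDerivAt_support_space t _) (h.hasDerivAt_angle_time ht.le u))

lemma periodic_supportError (h : IsFrameFlow γ₀ ν₀ γ ν a b) (H : HeatData p₀ R κ Q) {t : ℝ}
    (ht : 0 ≤ t) : Function.Periodic (supportError R κ Q a γ ν t) (2 * Real.pi) := fun u => by
  simp only [supportError, support, h.angle_add_two_pi, exp_add_two_pi_mul_I, H.periodic 0 t _,
    (h.legendre t ht).periodic_curve u, (h.legendre t ht).periodic_normal u]

lemma periodic_supportDerivError (h : IsFrameFlow γ₀ ν₀ γ ν a b) (H : HeatData p₀ R κ Q) {t : ℝ}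
    (ht : 0 ≤ t) : Function.Periodic (supportDerivError κ Q a γ ν t) (2 * Real.pi) := fun u => by
  simp only [supportDerivError, supportDeriv, h.angle_add_two_pi, exp_add_two_pi_mul_I,
    H.periodic 1 t _, mu, (h.legendre t ht).periodic_curve u, (h.legendre t ht).periodic_normal u]

lemma continuousOn_supportError (h : IsFrameFlow γ₀ ν₀ γ ν a b) (H : HeatData p₀ R κ Q) :
    ContinuousOn (fun q : ℝ × ℝ => supportError R κ Q a γ ν q.1 q.2) halfPlane :=
  h.contDiffOn_support.continuousOn.sub
    (H.contDiff_support.continuous.comp (continuous_fst.prodMk h.continuous_angle)).continuousOn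

lemma continuousOn_supportError_time (h : IsFrameFlow γ₀ ν₀ γ ν a b) (H : HeatData p₀ R κ Q) :
    ContinuousOn (fun q : ℝ × ℝ =>
      speed (γ q.1) (ν q.1) q.2 + a q.1 q.2 * inner ℝ (γ q.1 q.2) (mu (ν q.1) q.2) -
        (curvRadius R Q q.1 (angle a q.1 q.2) - R +
          a q.1 q.2 * supportDeriv κ Q q.1 (angle a q.1 q.2))) halfPlane := by
  have hΦ : Continuous fun q : ℝ × ℝ => (q.1, angle a q.1 q.2) :=
    continuous_fst.prodMk h.continuous_angle
  have h1 := contDiffOn_deriv_time h.contDiffOn_support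
    (fun t ht u => h.hasDerivWithinAt_support_time ht u)
  exact h1.continuousOn.sub ((((H.contDiff_curvRadius.continuous.comp hΦ).continuousOn).sub
    continuousOn_const).add (h.contDiffOn_rotation.continuousOn.mul
      (H.contDiff_supportDeriv.continuous.comp hΦ).continuousOn))

lemma continuous_curvRadius_angle (h : IsFrameFlow γ₀ ν₀ γ ν a b) (H : HeatData p₀ R κ Q) (t : ℝ) :
    Continuous fun u => curvRadius R Q t (angle a t u) :=
  H.contDiff_curvRadius.continuous.comp
    (continuous_const.prodMk (h.continuous_angle.comp (Continuous.prodMk_right t)))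

lemma integral_ell_mul_curvRadius (h : IsFrameFlow γ₀ ν₀ γ ν a b) (hℓ : ∀ u, ell ν₀ u = 1)
    (H : HeatData p₀ R κ Q) {t : ℝ} (ht : 0 ≤ t) (u₀ : ℝ) :
    ∫ u in u₀..(u₀ + 2 * Real.pi), ell (ν t) u * curvRadius R Q t (angle a t u) =
      2 * Real.pi * R := by
  have := intervalIntegral.integral_comp_mul_deriv (a := u₀) (b := u₀ + 2 * Real.pi)
    (f := angle a t) (f' := ell (ν t)) (g := curvRadius R Q t)
    (fun u _ => h.hasDerivAt_angle_space hℓ ht u)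
    (h.legendre t ht).continuous_ell.continuousOn
    (contDiff_slice H.contDiff_curvRadius t).continuous
  rw [← H.integral_curvRadius t (angle a t u₀), ← h.angle_add_two_pi, ← this]
  refine intervalIntegral.integral_congr fun u _ => ?_
  simp only [Function.comp_apply]
  ring

/-- The derivative of the energy `∫ d² ℓ` of the error `d` is at most twice the energy: after an
integration by parts, the remaining terms are `-2 ∫ ℓ e²` with `e = d' / ℓ`, and a negative multiple
of the square of `∫ d ℓ`, which is the error of the algebraic length. -/
lemma energy_derivative_le (h : IsFrameFlow γ₀ ν₀ γ ν a b) (hℓ : ∀ u, ell ν₀ u = 1)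
    (H : HeatData p₀ R κ Q) {t : ℝ} (ht : 0 ≤ t) (hpos : ∀ u, 0 < ell (ν t) u) (u₀ : ℝ) :
    ∫ u in u₀..(u₀ + 2 * Real.pi), (2 * supportError R κ Q a γ ν t u *
        (speed (γ t) (ν t) u + a t u * inner ℝ (γ t u) (mu (ν t) u) -
          (curvRadius R Q t (angle a t u) - R + a t u * supportDeriv κ Q t (angle a t u))) *
        ell (ν t) u + supportError R κ Q a γ ν t u ^ 2 * deriv (a t) u) ≤
      2 * ∫ u in u₀..(u₀ + 2 * Real.pi), supportError R κ Q a γ ν t u ^ 2 * ell (ν t) u := by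
  set d := supportError R κ Q a γ ν t with hd_def
  set e := supportDerivError κ Q a γ ν t with he_def
  set L := algLength (γ t) (ν t) with hL_def
  have hpi := Real.pi_pos
  have hLeg := h.legendre t ht
  have hd : ∀ u, HasDerivAt d (ell (ν t) u * e u) u := h.hasDerivAt_supportError hℓ H ht
  have he : ∀ u, HasDerivAt e (beta (γ t) (ν t) u - ell (ν t) u * curvRadius R Q t (angle a t u) -
      ell (ν t) u * d u) u := h.hasDerivAt_supportDerivError hℓ H ht
  have hdc : Continuous d := continuous_iff_continuousAt.2 fun u => (hd u).continuousAt
  have hec : Continuous e := continuous_iff_continuousAt.2 fun u => (he u).continuousAt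
  have hℓc := hLeg.continuous_ell
  have hβc := hLeg.continuous_beta
  have hBc := h.continuous_curvRadius_angle H t
  have hac : Continuous (a t) :=
    continuous_iff_continuousAt.2 fun u => (h.hasDerivAt_rotation ht u).continuousAt
  have ha'c : Continuous fun u => deriv (a t) u := by
    have := h.continuous_rotation_deriv.comp (Continuous.prodMk_right t)
    simpa only [Function.comp_def, max_eq_left ht] using this
  have hdp : Function.Periodic d (2 * Real.pi) := h.periodic_supportError H ht
  have hep : Function.Periodic e (2 * Real.pi) := h.periodic_supportDerivError H ht
  have hap := h.periodic_rotation ht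
  -- the error of the algebraic length
  have hlen : ∫ u in u₀..(u₀ + 2 * Real.pi), d u * ell (ν t) u = L - 2 * Real.pi * R := by
    have h1 := integral_deriv_of_periodic he (by fun_prop) hep u₀
    rw [intervalIntegral.integral_sub
      (Continuous.intervalIntegrable (by fun_prop) _ _)
      (Continuous.intervalIntegrable (by fun_prop) _ _),
      intervalIntegral.integral_sub (Continuous.intervalIntegrable (by fun_prop) _ _)
      (Continuous.intervalIntegrable (by fun_prop) _ _),
      h.integral_ell_mul_curvRadius hℓ H ht, hLeg.periodic_beta.intervalIntegral_add_eq u₀ 0,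
      zero_add, ← algLength] at h1
    simp only [mul_comm (d _)]
    linarith
  -- the integral of the derivative of the periodic function `2 d e + d² a`
  have hparts : ∫ u in u₀..(u₀ + 2 * Real.pi),
      (2 * (ell (ν t) u * e u * e u + d u * (beta (γ t) (ν t) u -
        ell (ν t) u * curvRadius R Q t (angle a t u) - ell (ν t) u * d u)) +
        (2 * d u * (ell (ν t) u * e u) * a t u + d u ^ 2 * deriv (a t) u)) = 0 := by
    refine integral_deriv_of_periodic (f := fun u => 2 * (d u * e u) + d u ^ 2 * a t u)
      (fun u => ?_) (by fun_prop) (fun u => by simp only [hdp u, hep u, hap u]) u₀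
    refine ((((hd u).mul (he u)).const_mul 2).add
      (((hd u).pow 2).mul (h.hasDerivAt_rotation ht u))).congr_deriv ?_
    simp
  have hsq : 0 ≤ ∫ u in u₀..(u₀ + 2 * Real.pi), ell (ν t) u * e u ^ 2 :=
    intervalIntegral.integral_nonneg (by linarith) fun u _ =>
      mul_nonneg (hpos u).le (sq_nonneg _)
  have hpt : ∀ u, 2 * d u *
        (speed (γ t) (ν t) u + a t u * inner ℝ (γ t u) (mu (ν t) u) -
          (curvRadius R Q t (angle a t u) - R + a t u * supportDeriv κ Q t (angle a t u))) *
        ell (ν t) u + d u ^ 2 * deriv (a t) u =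
      (2 * (ell (ν t) u * e u * e u + d u * (beta (γ t) (ν t) u -
        ell (ν t) u * curvRadius R Q t (angle a t u) - ell (ν t) u * d u)) +
        (2 * d u * (ell (ν t) u * e u) * a t u + d u ^ 2 * deriv (a t) u)) -
      2 * (ell (ν t) u * e u ^ 2) + 2 * (d u ^ 2 * ell (ν t) u) -
      (L - 2 * Real.pi * R) / Real.pi * (d u * ell (ν t) u) := by
    intro u
    have h1 : speed (γ t) (ν t) u * ell (ν t) u =
        beta (γ t) (ν t) u - L / (2 * Real.pi) * ell (ν t) u := by
      rw [speed, sub_mul, div_mul_cancel₀ _ (hpos u).ne']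
    have h2 : e u = inner ℝ (γ t u) (mu (ν t) u) - supportDeriv κ Q t (angle a t u) := rfl
    have h3 : (L - 2 * Real.pi * R) / Real.pi = 2 * (L / (2 * Real.pi) - R) := by
      field_simp
    rw [h3]
    have h4 : inner ℝ (γ t u) (mu (ν t) u) = e u + supportDeriv κ Q t (angle a t u) := by
      rw [h2]; ring
    rw [h4]
    linear_combination 2 * d u * h1
  rw [intervalIntegral.integral_congr fun u _ => hpt u]
  rw [intervalIntegral.integral_sub (Continuous.intervalIntegrable (by fun_prop) _ _)
      (Continuous.intervalIntegrable (by fun_prop) _ _),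
    intervalIntegral.integral_add (Continuous.intervalIntegrable (by fun_prop) _ _)
      (Continuous.intervalIntegrable (by fun_prop) _ _),
    intervalIntegral.integral_sub (Continuous.intervalIntegrable (by fun_prop) _ _)
      (Continuous.intervalIntegrable (by fun_prop) _ _), hparts,
    intervalIntegral.integral_const_mul, intervalIntegral.integral_const_mul,
    intervalIntegral.integral_const_mul, hlen]
  have : 0 ≤ (L - 2 * Real.pi * R) / Real.pi * (L - 2 * Real.pi * R) := by
    rw [div_mul_eq_mul_div]
    exact div_nonneg (mul_self_nonneg _) hpi.le
  linarith

end IsFrameFlow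

/-- Grönwall's inequality for a nonnegative function vanishing at `0`. -/
lemma eq_zero_of_deriv_le {E E' : ℝ → ℝ} {T : ℝ} (hc : ContinuousOn E (Ico 0 T))
    (hd : ∀ t ∈ Ioo 0 T, HasDerivAt E (E' t) t) (hle : ∀ t ∈ Ioo 0 T, E' t ≤ 2 * E t)
    (h0 : E 0 = 0) (hpos : ∀ t ∈ Ico 0 T, 0 ≤ E t) {t : ℝ} (ht : t ∈ Ico 0 T) : E t = 0 := by
  have hd' : ∀ t ∈ Ioo 0 T, HasDerivAt (fun t => E t * Real.exp (-(2 * t)))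
      ((E' t - 2 * E t) * Real.exp (-(2 * t))) t := by
    intro t ht
    refine ((hd t ht).mul ((hasDerivAt_id t).const_mul 2).neg.exp).congr_deriv ?_
    simp
    ring
  have hanti : AntitoneOn (fun t => E t * Real.exp (-(2 * t))) (Ico 0 T) := by
    refine antitoneOn_of_deriv_nonpos (convex_Ico 0 T) (hc.mul (by fun_prop)) ?_ ?_
    · rw [interior_Ico]
      exact fun t ht => (hd' t ht).differentiableAt.differentiableWithinAt
    · rw [interior_Ico]
      intro t ht
      rw [(hd' t ht).deriv]
      exact mul_nonpos_of_nonpos_of_nonneg (by linarith [hle t ht]) (Real.exp_nonneg _)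
  have h1 := hanti ⟨le_rfl, ht.1.trans_lt ht.2⟩ ht ht.1
  simp only [h0, zero_mul] at h1
  have h2 := nonpos_of_mul_nonpos_left h1 (Real.exp_pos _)
  exact le_antisymm h2 (hpos t ht)

namespace IsFrameFlow

variable {γ₀ ν₀ : ℝ → ℂ} {γ ν : ℝ → ℝ → ℂ} {a b : ℝ → ℝ → ℝ} {R : ℝ} {κ : ℂ}
  {Q : ℕ → ℝ → ℝ → ℝ} {T : ℝ}

/-! ### Uniqueness -/

/-- As long as `ℓ > 0`, the support function is the solution of the heat equation. -/
lemma supportError_eq_zero (h : IsFrameFlow γ₀ ν₀ γ ν a b) (hℓ : ∀ u, ell ν₀ u = 1)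
    (H : HeatData (fun u => inner ℝ (γ₀ u) (ν₀ u)) R κ Q)
    (hpos : ∀ t ∈ Ico 0 T, ∀ u, 0 < ell (ν t) u) {t : ℝ} (ht : t ∈ Ico 0 T) (u : ℝ) :
    supportError R κ Q a γ ν t u = 0 := by
  let g : ℝ → ℝ → ℝ := fun t u => supportError R κ Q a γ ν t u ^ 2 * ell (ν t) u
  have hg : ContinuousOn (fun q : ℝ × ℝ => g q.1 q.2) halfPlane :=
    ((h.continuousOn_supportError H).pow 2).mul h.contDiffOn_ell.continuousOn
  have hgs : ∀ t, 0 ≤ t → Continuous (g t) := fun t ht =>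
    hg.comp_continuous (Continuous.prodMk_right t) fun x => mem_halfPlane ht x
  have hg' := (((continuousOn_const (c := (2 : ℝ)).mul (h.continuousOn_supportError H)).mul
    (h.continuousOn_supportError_time H)).mul h.contDiffOn_ell.continuousOn).add
    (((h.continuousOn_supportError H).pow 2).mul
      (contDiffOn_deriv_space h.contDiffOn_rotation).continuousOn)
  have hE0 : ∫ x in u..(u + 2 * Real.pi), g t x = 0 := by
    refine eq_zero_of_deriv_le (E := fun t => ∫ x in u..(u + 2 * Real.pi), g t x) (T := T) ?_
      (fun s hs => hasDerivAt_integral_of_continuousOn (F := g) (F' := fun t u =>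
        2 * supportError R κ Q a γ ν t u *
        (speed (γ t) (ν t) u + a t u * inner ℝ (γ t u) (mu (ν t) u) -
          (curvRadius R Q t (angle a t u) - R + a t u * supportDeriv κ Q t (angle a t u))) *
        ell (ν t) u + supportError R κ Q a γ ν t u ^ 2 * deriv (a t) u) (s := Ioi 0) isOpen_Ioi
        hs.1 (fun x hx => (hgs x (le_of_lt hx)).continuousOn)
        (hg'.mono fun q hq => mem_halfPlane (le_of_lt hq.1) q.2) fun x hx r _ => ?_)
      (fun s hs => h.energy_derivative_le hℓ H hs.1.le (hpos s ⟨hs.1.le, hs.2⟩) u) ?_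
      (fun s hs => intervalIntegral.integral_nonneg (by linarith [Real.pi_pos]) fun x _ =>
        mul_nonneg (sq_nonneg _) (hpos s hs x).le) ht
    · have hc : Continuous fun s => ∫ x in u..(u + 2 * Real.pi), g (max s 0) x :=
        intervalIntegral.continuous_parametric_intervalIntegral_of_continuous'
          (f := fun s x => g (max s 0) x) (continuous_extend hg) _ _
      exact hc.continuousOn.congr fun s hs => by simp only [max_eq_left hs.1]
    · refine (((h.hasDerivAt_supportError_time H hx r).pow 2).mul
        (h.hasDerivAt_ell_time hℓ hx r)).congr_deriv ?_
      simp
    · have : ∀ x, g 0 x = 0 := fun x => by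
        have h0 : supportError R κ Q a γ ν 0 x = 0 := by
          rw [supportError, angle_zero, h.init_curve, h.init_normal, support, ← H.init x, sub_self]
        simp [g, h0]
      simp [this]
  by_contra hne
  have hlt : 0 < ∫ x in u..(u + 2 * Real.pi), g t x :=
    intervalIntegral.integral_pos (by linarith [Real.pi_pos]) (hgs t ht.1).continuousOn
      (fun x _ => mul_nonneg (sq_nonneg _) (hpos t ht x).le)
      ⟨u, ⟨le_rfl, by linarith [Real.pi_pos]⟩, mul_pos (by positivity) (hpos t ht u)⟩
  exact hlt.ne' hE0

lemma supportDerivError_eq_zero (h : IsFrameFlow γ₀ ν₀ γ ν a b) (hℓ : ∀ u, ell ν₀ u = 1)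
    (H : HeatData (fun u => inner ℝ (γ₀ u) (ν₀ u)) R κ Q)
    (hpos : ∀ t ∈ Ico 0 T, ∀ u, 0 < ell (ν t) u) {t : ℝ} (ht : t ∈ Ico 0 T) (u : ℝ) :
    supportDerivError κ Q a γ ν t u = 0 := by
  have h1 := h.hasDerivAt_supportError hℓ H ht.1 u
  rw [show supportError R κ Q a γ ν t = fun _ => 0 from
    funext fun x => h.supportError_eq_zero hℓ H hpos ht x] at h1
  exact (mul_eq_zero.1 (h1.unique (hasDerivAt_const u 0))).resolve_left (hpos t ht u).ne'

/-- Differentiating `⟨γ, μ⟩` shows that `β / ℓ` is the radius of curvature of the heat solution. -/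
lemma beta_eq_curvRadius (h : IsFrameFlow γ₀ ν₀ γ ν a b) (hℓ : ∀ u, ell ν₀ u = 1)
    (H : HeatData (fun u => inner ℝ (γ₀ u) (ν₀ u)) R κ Q)
    (hpos : ∀ t ∈ Ico 0 T, ∀ u, 0 < ell (ν t) u) {t : ℝ} (ht : t ∈ Ico 0 T) (u : ℝ) :
    beta (γ t) (ν t) u = ell (ν t) u * curvRadius R Q t (angle a t u) := by
  have h1 := h.hasDerivAt_supportDerivError hℓ H ht.1 u
  rw [show supportDerivError κ Q a γ ν t = fun _ => 0 from
    funext fun x => h.supportDerivError_eq_zero hℓ H hpos ht x,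
    h.supportError_eq_zero hℓ H hpos ht] at h1
  have := h1.unique (hasDerivAt_const u 0)
  linarith

lemma speed_eq_curvRadius (h : IsFrameFlow γ₀ ν₀ γ ν a b) (hℓ : ∀ u, ell ν₀ u = 1)
    (H : HeatData (fun u => inner ℝ (γ₀ u) (ν₀ u)) R κ Q)
    (hpos : ∀ t ∈ Ico 0 T, ∀ u, 0 < ell (ν t) u) {t : ℝ} (ht : t ∈ Ico 0 T) :
    speed (γ t) (ν t) = fun u => curvRadius R Q t (angle a t u) - R := by
  have hβ := h.beta_eq_curvRadius hℓ H hpos ht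
  have hL : algLength (γ t) (ν t) = 2 * Real.pi * R := by
    have := h.integral_ell_mul_curvRadius hℓ H ht.1 0
    rw [zero_add] at this
    rw [algLength, ← this]
    exact intervalIntegral.integral_congr fun u _ => hβ u
  funext u
  have := (hpos t ht u).ne'
  have := Real.pi_ne_zero
  rw [speed, hL, hβ]
  field_simp

lemma curve_eq_heatCurve (h : IsFrameFlow γ₀ ν₀ γ ν a b) (hℓ : ∀ u, ell ν₀ u = 1)
    (H : HeatData (fun u => inner ℝ (γ₀ u) (ν₀ u)) R κ Q)
    (hpos : ∀ t ∈ Ico 0 T, ∀ u, 0 < ell (ν t) u) {t : ℝ} (ht : t ∈ Ico 0 T) (u : ℝ) :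
    γ t u = heatCurve R κ Q (ν₀ 0) (angle a) t u := by
  have h1 := sub_eq_zero.1 (h.supportError_eq_zero hℓ H hpos ht u)
  have h2 := sub_eq_zero.1 (h.supportDerivError_eq_zero hℓ H hpos ht u)
  rw [heatCurve_eq_support, heatNormal, ← h.normal_eq_exp hℓ ht.1, ← h1, ← h2]
  exact eq_frame ((h.legendre t ht.1).norm_normal u) (γ t u)

/-- Positivity of `ℓ` follows if it extends from `[0, T)` to `T` for each `T`. -/
lemma ell_pos_of_extension (h : IsFrameFlow γ₀ ν₀ γ ν a b) (hℓ : ∀ u, ell ν₀ u = 1)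
    (hext : ∀ T, 0 < T → (∀ t ∈ Ico 0 T, ∀ u, 0 < ell (ν t) u) → ∀ u, 0 < ell (ν T) u) {t : ℝ}
    (ht : 0 ≤ t) (u : ℝ) : 0 < ell (ν t) u := by
  by_contra hcon
  have hper : ∀ s, 0 ≤ s → ∀ u, ∃ v ∈ Icc 0 (2 * Real.pi), ell (ν s) u = ell (ν s) v := by
    intro s hs u
    obtain ⟨v, hv, hv'⟩ := (h.legendre s hs).periodic_ell.exists_mem_Ico₀ Real.two_pi_pos u
    exact ⟨v, Ico_subset_Icc_self hv, hv'⟩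
  let D : Set (ℝ × ℝ) := Icc 0 t ×ˢ Icc 0 (2 * Real.pi)
  have hD : D ⊆ halfPlane := fun q hq => mem_halfPlane hq.1.1 q.2
  have hcl : IsCompact (D ∩ (fun q : ℝ × ℝ => ell (ν q.1) q.2) ⁻¹' Iic 0) :=
    (isCompact_Icc.prod isCompact_Icc).of_isClosed_subset
      ((h.contDiffOn_ell.continuousOn.mono hD).preimage_isClosed_of_isClosed
        (isCompact_Icc.prod isCompact_Icc).isClosed isClosed_Iic) inter_subset_left
  obtain ⟨v, hv, hv'⟩ := hper t ht u
  have hne : (D ∩ (fun q : ℝ × ℝ => ell (ν q.1) q.2) ⁻¹' Iic 0).Nonempty :=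
    ⟨(t, v), ⟨⟨ht, le_rfl⟩, hv⟩, by simpa [← hv'] using hcon⟩
  -- the first time at which `ℓ` is not positive
  obtain ⟨T, ⟨⟨T', x⟩, hTx, rfl⟩, hT⟩ := (hcl.image continuous_fst).exists_isLeast (hne.image _)
  simp only at hT
  have hpos : ∀ s ∈ Ico 0 T', ∀ u, 0 < ell (ν s) u := by
    intro s hs u
    by_contra hs'
    obtain ⟨y, hy, hy'⟩ := hper s hs.1 u
    have : T' ≤ s := hT ⟨(s, y), ⟨⟨⟨hs.1, hs.2.le.trans hTx.1.1.2⟩, hy⟩,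
      by simpa [← hy'] using hs'⟩, rfl⟩
    exact absurd hs.2 (not_lt.2 this)
  have hle : ell (ν T') x ≤ 0 := hTx.2
  rcases hTx.1.1.1.eq_or_lt with h0 | h0
  · simp only at h0
    rw [← h0, h.init_normal, hℓ] at hle
    linarith
  · exact absurd (hext T' h0 hpos x) (not_lt.2 hle)

lemma continuous_angle_time (h : IsFrameFlow γ₀ ν₀ γ ν a b) (u : ℝ) :
    Continuous fun s => angle a s u :=
  h.continuous_angle.comp (f := fun s : ℝ => (s, u)) (by fun_prop)

lemma continuousOn_ell_time (h : IsFrameFlow γ₀ ν₀ γ ν a b) (u : ℝ) :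
    ContinuousOn (fun s => ell (ν s) u) (Ici 0) :=
  ContinuousOn.comp (g := fun q : ℝ × ℝ => ell (ν q.1) q.2) (f := fun s : ℝ => (s, u))
    h.contDiffOn_ell.continuousOn (by fun_prop) fun _ hs => mem_halfPlane hs u

end IsFrameFlow

lemma IsBoundedField.continuous_stretch_time {V V₁ : ℝ → ℝ → ℝ} {M K : NNReal}
    (hV : IsBoundedField V V₁ M K) (u : ℝ) : Continuous fun s => hV.stretch s u :=
  Continuous.comp (g := fun q : ℝ × ℝ => hV.stretch q.1 q.2) (f := fun s : ℝ => (s, u))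
    hV.contDiff_stretch.continuous (by fun_prop)

namespace IsFrameFlow

variable {γ₀ ν₀ : ℝ → ℂ} {γ ν : ℝ → ℝ → ℂ} {a b : ℝ → ℝ → ℝ} {R : ℝ} {κ : ℂ}
  {Q : ℕ → ℝ → ℝ → ℝ} {T : ℝ} {V V₁ : ℝ → ℝ → ℝ} {M K : NNReal}

lemma angle_eq_flow (h : IsFrameFlow γ₀ ν₀ γ ν a b) (hV : IsBoundedField V V₁ M K)
    (ha : ∀ t ∈ Ico 0 T, ∀ u, a t u = V t (angle a t u)) {t : ℝ} (ht : t ∈ Ico 0 T) :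
    angle a t = hV.flow t := by
  funext u
  refine ODE_solution_unique (v := V) (K := K) (a := 0) (b := t)
    (f := fun s => angle a s u) (g := fun s => hV.flow s u) hV.lipschitzWith
    (h.continuous_angle_time u).continuousOn (fun s hs => ?_)
    (hV.continuous_flow_time u).continuousOn
    (fun s _ => (hV.hasDerivAt_flow_time s u).hasDerivWithinAt) ?_ ⟨ht.1, le_rfl⟩
  · rw [← ha s ⟨hs.1, hs.2.trans ht.2⟩ u]
    exact (h.hasDerivAt_angle_time hs.1 u).hasDerivWithinAt
  · rw [angle_zero, hV.flow_zero]

/-- On each interval on which `ℓ > 0`, it equals the stretching factor of the flow of `V`, which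
stays positive at the end of the interval. -/
lemma ell_pos (h : IsFrameFlow γ₀ ν₀ γ ν a b) (hℓ : ∀ u, ell ν₀ u = 1)
    (hV : IsBoundedField V V₁ M K)
    (ha : ∀ T, (∀ t ∈ Ico 0 T, ∀ u, 0 < ell (ν t) u) →
      ∀ t ∈ Ico 0 T, ∀ u, a t u = V t (angle a t u)) {t : ℝ} (ht : 0 ≤ t) (u : ℝ) :
    0 < ell (ν t) u := by
  refine h.ell_pos_of_extension hℓ (fun T hT hpos u => ?_) ht u
  have heq : ∀ t ∈ Ico 0 T, hV.stretch t u = ell (ν t) u := fun t ht => by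
    have h1 := h.hasDerivAt_angle_space hℓ ht.1 u
    rw [h.angle_eq_flow hV (ha T hpos) ht] at h1
    exact (hV.hasDerivAt_flow_space t u).unique h1
  have hmem : ∀ᶠ t in 𝓝[<] T, hV.stretch t u = ell (ν t) u :=
    Filter.mem_of_superset (Ico_mem_nhdsLT hT) heq
  have hc : Tendsto (fun t => ell (ν t) u) (𝓝[<] T) (𝓝 (ell (ν T) u)) :=
    (((h.continuousOn_ell_time u).continuousAt (Ici_mem_nhds hT)).continuousWithinAt).tendsto
  have hs : Tendsto (fun t => hV.stretch t u) (𝓝[<] T) (𝓝 (hV.stretch T u)) :=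
    ((hV.continuous_stretch_time u).tendsto T).mono_left nhdsWithin_le_nhds
  rw [tendsto_nhds_unique hc (hs.congr' hmem)]
  exact hV.stretch_pos T u

/-- If the normal rotates with angular speed `V`, as long as `ℓ > 0`, then the solution is the one
built from the heat equation and the flow of `V`. -/
theorem eq_heatCurve (h : IsFrameFlow γ₀ ν₀ γ ν a b) (hℓ : ∀ u, ell ν₀ u = 1)
    (H : HeatData (fun u => inner ℝ (γ₀ u) (ν₀ u)) R κ Q) (hV : IsBoundedField V V₁ M K)
    (ha : ∀ T, (∀ t ∈ Ico 0 T, ∀ u, 0 < ell (ν t) u) →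
      ∀ t ∈ Ico 0 T, ∀ u, a t u = V t (angle a t u)) {t : ℝ} (ht : 0 ≤ t) :
    γ t = heatCurve R κ Q (ν₀ 0) hV.flow t ∧ ν t = heatNormal (ν₀ 0) hV.flow t := by
  have hmem : t ∈ Ico 0 (t + 1) := ⟨ht, by linarith⟩
  have hpos : ∀ s ∈ Ico 0 (t + 1), ∀ u, 0 < ell (ν s) u := fun s hs =>
    h.ell_pos hℓ hV ha hs.1
  have hfl := h.angle_eq_flow hV (ha _ hpos) hmem
  constructor
  · funext u
    rw [h.curve_eq_heatCurve hℓ H hpos hmem, heatCurve, heatCurve, hfl]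
  · funext u
    rw [h.normal_eq_exp hℓ ht, heatNormal, hfl]

end IsFrameFlow

/-! ### The initial curve -/

section Initial

variable {γ₀ ν₀ : ℝ → ℂ} {R : ℝ} {κ : ℂ} {Q : ℕ → ℝ → ℝ → ℝ} {V V₁ : ℝ → ℝ → ℝ} {M K : NNReal}

lemma IsLegendre.exists_heatData (h : IsLegendre γ₀ ν₀) :
    ∃ R κ Q, HeatData (fun u => inner ℝ (γ₀ u) (ν₀ u)) R κ Q :=
  LegendreCurve.exists_heatData (h.smooth_curve.inner ℝ h.smooth_normal) fun u => by
    simp only [h.periodic_curve u, h.periodic_normal u]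

namespace HeatData

lemma heatNormal_zero (h : IsLegendre γ₀ ν₀) (hℓ : ∀ u, ell ν₀ u = 1)
    (hV : IsBoundedField V V₁ M K) : heatNormal (ν₀ 0) hV.flow 0 = ν₀ := by
  funext u
  rw [heatNormal, hV.flow_zero, ← h.normal_eq_exp hℓ]

lemma heatCurve_zero (H : HeatData (fun u => inner ℝ (γ₀ u) (ν₀ u)) R κ Q)
    (h : IsLegendre γ₀ ν₀) (hℓ : ∀ u, ell ν₀ u = 1) (hV : IsBoundedField V V₁ M K) :
    heatCurve R κ Q (ν₀ 0) hV.flow 0 = γ₀ := by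
  have h0 : support R κ Q 0 = fun u => inner ℝ (γ₀ u) (ν₀ u) :=
    funext fun u => (H.init u).symm
  funext u
  have h1 : supportDeriv κ Q 0 u = inner ℝ (γ₀ u) (Complex.I * ν₀ u) := by
    have h2 := H.hasDerivAt_support_space 0 u
    rw [h0] at h2
    have h3 := h2.unique (h.hasDerivAt_support u)
    rwa [hℓ, one_mul] at h3
  rw [heatCurve_eq_support, heatNormal_zero h hℓ hV, hV.flow_zero, h0, h1]
  exact (eq_frame (h.norm_normal u) (γ₀ u)).symm

lemma algLength_eq (H : HeatData (fun u => inner ℝ (γ₀ u) (ν₀ u)) R κ Q)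
    (h : IsLegendre γ₀ ν₀) (hℓ : ∀ u, ell ν₀ u = 1) : algLength γ₀ ν₀ = 2 * Real.pi * R := by
  obtain ⟨V₁, M, K, hV⟩ := H.exists_isBoundedField
  have := H.algLength_heatCurve (h.norm_normal 0) hV H.periodic_field 0
  rwa [H.heatCurve_zero h hℓ hV, heatNormal_zero h hℓ hV] at this

end HeatData

end Initial

/-- The field of the modified flow, for which the normal does not move. -/
lemma isBoundedField_zero : IsBoundedField (fun _ _ => 0) (fun _ _ => 0) 0 0 where
  smooth := contDiff_const
  smooth₁ := contDiff_const
  hasDerivAt _ u := hasDerivAt_const u _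
  bound _ _ := by simp
  bound₁ _ _ := by simp

lemma DerivBdd.zero (w : ℝ → ℝ) (k : ℕ) : DerivBdd w k fun _ _ => (0 : ℝ) := by
  induction k with
  | zero => exact ⟨0, by simp⟩
  | succ k ih => exact succ_of_hasDerivAt ⟨0, by simp⟩ (fun _ u => hasDerivAt_const u 0) ih

/-! ### Both flows -/

section Flows

variable {γ₀ ν₀ : ℝ → ℂ} {γ ν : ℝ → ℝ → ℂ}

lemma IsFlow.isFrameFlow (h : IsFlow γ₀ ν₀ γ ν) : IsFrameFlow γ₀ ν₀ γ ν
    (fun t u => -(beta (γ t) (ν t) u * deriv (speed (γ t) (ν t)) u /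
      (ell (ν t) u ^ 2 + beta (γ t) (ν t) u ^ 2)))
    (fun t u => ell (ν t) u * deriv (speed (γ t) (ν t)) u /
      (ell (ν t) u ^ 2 + beta (γ t) (ν t) u ^ 2)) where
  toIsEvolution := h.toIsEvolution
  curve_eq := h.curve_eq
  normal_eq t ht u := by
    rw [Complex.ofReal_neg]
    exact h.normal_eq t ht u

lemma IsModifiedFlow.isFrameFlow (h : IsModifiedFlow γ₀ ν₀ γ ν) : IsFrameFlow γ₀ ν₀ γ ν
    (fun _ _ => 0) (fun t u => deriv (speed (γ t) (ν t)) u / ell (ν t) u) where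
  toIsEvolution := h.toIsEvolution
  curve_eq := h.curve_eq
  normal_eq t ht u := by
    rw [Complex.ofReal_zero, zero_mul]
    exact h.normal_eq t ht u

lemma TendstoSmooth.congr {g g' : ℝ → ℝ → ℂ} {f : ℝ → ℂ} (h : TendstoSmooth g f)
    (hg : ∀ t, 0 ≤ t → g' t = g t) : TendstoSmooth g' f := fun k V hV =>
  ((h k V hV).and (eventually_ge_atTop 0)).mono fun t ht u => by
    simpa only [hg t ht.2] using ht.1 u

lemma ConvergesToCircle.congr {γ' ν' : ℝ → ℝ → ℂ} {c : ℂ} {R : ℝ} (h : ConvergesToCircle γ ν c R)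
    (hγ : ∀ t, 0 ≤ t → γ' t = γ t) (hν : ∀ t, 0 ≤ t → ν' t = ν t) :
    ConvergesToCircle γ' ν' c R := by
  obtain ⟨φ, h1, h2, h3, h4, h5⟩ := h
  exact ⟨φ, h1, h2, h3, h4.congr hγ, h5.congr hν⟩

lemma ConvergesToCircle.tendstoSmooth_const {c : ℂ} (h : ConvergesToCircle γ ν c 0) :
    TendstoSmooth γ fun _ => c := by
  obtain ⟨φ, -, -, -, h, -⟩ := h
  simpa using h

variable {R : ℝ} {κ : ℂ} {Q : ℕ → ℝ → ℝ → ℝ} {V V₁ : ℝ → ℝ → ℝ} {M K : NNReal}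

/-- The properties of a solution that agrees with the one built from the heat equation. -/
lemma HeatData.properties (H : HeatData (fun u => inner ℝ (γ₀ u) (ν₀ u)) R κ Q)
    (h₀ : IsLegendre γ₀ ν₀) (hℓ : ∀ u, ell ν₀ u = 1) (hV : IsBoundedField V V₁ M K)
    (hdecay : ∀ k, DerivBdd decayWeight k V) (hper : ∀ t, Function.Periodic (V t) (2 * Real.pi))
    (heq : ∀ t, 0 ≤ t →
      γ t = heatCurve R κ Q (ν₀ 0) hV.flow t ∧ ν t = heatNormal (ν₀ 0) hV.flow t) :
    (∀ t, 0 ≤ t → IsEllConvex (γ t) (ν t)) ∧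
      (∀ t, 0 ≤ t → algLength (γ t) (ν t) = algLength γ₀ ν₀) ∧
      ∃ c : ℂ, ConvergesToCircle γ ν c (algLength γ₀ ν₀ / (2 * Real.pi)) ∧
        (algLength γ₀ ν₀ = 0 → TendstoSmooth γ fun _ => c) := by
  have hw := h₀.norm_normal 0
  have hL := H.algLength_eq h₀ hℓ
  have hR : algLength γ₀ ν₀ / (2 * Real.pi) = R := by
    rw [hL, mul_div_cancel_left₀ _ Real.two_pi_pos.ne']
  have hconv := (H.convergesToCircle_heatCurve hw hV hdecay hper).congr
    (fun t ht => (heq t ht).1) fun t ht => (heq t ht).2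
  refine ⟨fun t ht => ?_, fun t ht => ?_, ν₀ 0 * (starRingEnd ℂ) κ, by rwa [hR], fun h0 => ?_⟩
  · rw [(heq t ht).1, (heq t ht).2]
    refine ⟨H.isLegendre_heatCurve hw hV hper t, fun u => ?_⟩
    rw [ell_heatNormal hw hV]
    exact hV.stretch_pos t u
  · rw [(heq t ht).1, (heq t ht).2, H.algLength_heatCurve hw hV hper, hL]
  · rw [h0, zero_div] at hR
    rw [← hR] at hconv
    exact hconv.tendstoSmooth_const

/-- As long as `ℓ > 0`, the angular speed of the normal prescribed by the unmodified flow is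
`field R Q`, since then `β = ℓ * curvRadius`. -/
lemma IsFrameFlow.rotation_eq_field {a b : ℝ → ℝ → ℝ} {T : ℝ} (h : IsFrameFlow γ₀ ν₀ γ ν a b)
    (hℓ : ∀ u, ell ν₀ u = 1) (H : HeatData (fun u => inner ℝ (γ₀ u) (ν₀ u)) R κ Q)
    (hpos : ∀ t ∈ Ico 0 T, ∀ u, 0 < ell (ν t) u) {t : ℝ}
    (ht : t ∈ Ico 0 T) (u : ℝ) :
    -(beta (γ t) (ν t) u * deriv (speed (γ t) (ν t)) u /
      (ell (ν t) u ^ 2 + beta (γ t) (ν t) u ^ 2)) = HeatData.field R Q t (angle a t u) := by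
  have hs : deriv (speed (γ t) (ν t)) u = curvRadiusDeriv Q t (angle a t u) * ell (ν t) u := by
    rw [h.speed_eq_curvRadius hℓ H hpos ht]
    exact (((H.hasDerivAt_curvRadius t _).comp u
      (h.hasDerivAt_angle_space hℓ ht.1 u)).sub_const R).deriv
  have h1 := (hpos t ht u).ne'
  rw [hs, h.beta_eq_curvRadius hℓ H hpos ht, HeatData.field]
  congr 1
  field_simp

end Flows

end LegendreCurve

end

theorem theorem1p2 (γ₀ ν₀ : ℝ → ℂ) (h₀ : LegendreCurve.IsLegendre γ₀ ν₀)
    (hℓ : ∀ u, LegendreCurve.ell ν₀ u = 1) :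
    ((∃ γ ν : ℝ → ℝ → ℂ, LegendreCurve.IsFlow γ₀ ν₀ γ ν) ∧
      ∀ γ ν : ℝ → ℝ → ℂ, LegendreCurve.IsFlow γ₀ ν₀ γ ν →
        (∀ t, 0 ≤ t → LegendreCurve.IsEllConvex (γ t) (ν t)) ∧
        (∀ t, 0 ≤ t → LegendreCurve.algLength (γ t) (ν t) = LegendreCurve.algLength γ₀ ν₀) ∧
        ∃ c : ℂ,
          LegendreCurve.ConvergesToCircle γ ν c
            (LegendreCurve.algLength γ₀ ν₀ / (2 * Real.pi)) ∧
          (LegendreCurve.algLength γ₀ ν₀ = 0 →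
            LegendreCurve.TendstoSmooth γ (fun _ => c))) ∧
    ((∃ γ ν : ℝ → ℝ → ℂ, LegendreCurve.IsModifiedFlow γ₀ ν₀ γ ν) ∧
      ∀ γ ν : ℝ → ℝ → ℂ, LegendreCurve.IsModifiedFlow γ₀ ν₀ γ ν →
        (∀ t, 0 ≤ t → LegendreCurve.IsEllConvex (γ t) (ν t) ∧
          ∀ u, LegendreCurve.ell (ν t) u = 1) ∧
        (∀ t, 0 ≤ t → LegendreCurve.algLength (γ t) (ν t) = LegendreCurve.algLength γ₀ ν₀) ∧
        ∃ c : ℂ,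
          LegendreCurve.ConvergesToCircle γ ν c
            (LegendreCurve.algLength γ₀ ν₀ / (2 * Real.pi)) ∧
          (LegendreCurve.algLength γ₀ ν₀ = 0 →
            LegendreCurve.TendstoSmooth γ (fun _ => c))) := by
  open LegendreCurve in
  obtain ⟨R, κ, Q, H⟩ := h₀.exists_heatData
  have hw := h₀.norm_normal 0
  refine ⟨?_, ?_⟩
  · obtain ⟨V₁, M, K, hV⟩ := H.exists_isBoundedField
    refine ⟨⟨heatCurve R κ Q (ν₀ 0) hV.flow, heatNormal (ν₀ 0) hV.flow, ?_⟩, fun γ ν h => ?_⟩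
    · have := H.isFlow_heatCurve hw hV H.periodic_field
      rwa [H.heatCurve_zero h₀ hℓ hV, HeatData.heatNormal_zero h₀ hℓ hV] at this
    · exact H.properties h₀ hℓ hV H.derivBdd_field H.periodic_field fun t ht =>
        h.isFrameFlow.eq_heatCurve hℓ H hV (fun T hpos t ht u =>
          h.isFrameFlow.rotation_eq_field hℓ H hpos ht u) ht
  · have hV := isBoundedField_zero
    refine ⟨⟨heatCurve R κ Q (ν₀ 0) hV.flow, heatNormal (ν₀ 0) hV.flow, ?_⟩, fun γ ν h => ?_⟩
    · have := H.isModifiedFlow_heatCurve hw hV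
      rwa [H.heatCurve_zero h₀ hℓ hV, HeatData.heatNormal_zero h₀ hℓ hV] at this
    · obtain ⟨h1, h2⟩ := H.properties h₀ hℓ hV (DerivBdd.zero _) (fun _ _ => rfl) fun t ht =>
        h.isFrameFlow.eq_heatCurve hℓ H hV (fun T hpos t ht u => rfl) ht
      refine ⟨fun t ht => ⟨h1 t ht, fun u => ?_⟩, h2⟩
      rw [(h.isFrameFlow.ell_eq_integral hℓ ht u).2]
      simp
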